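/- Let $\mathcal A(\mathbb R)$ be one of the spaces $C_c^\infty(\mathbb R)$, $\mathcal S(\mathbb R)$, or $W^{\infty,1}(\mathbb R)=\{f\in C^\infty(\mathbb R): f^{(k)}\in L^1(\mathbb R)\text{ for all }k\ge 0\}$, and let $\mathcal A_1(\mathbb R)=\{f\in C^\infty(\mathbb R): f'\in\mathcal A(\mathbb R),\ \lim_{x\to-\infty}f(x)=0\}$. Put $\mathrm{Diff}_{\mathcal A}(\mathbb R)=\{\mathrm{Id}+f: f\in\mathcal A(\mathbb R),\ f'>-1\}$ and $\mathrm{Diff}_{\mathcal A_1}(\mathbb R)=\{\mathrm{Id}+f: f\in\mathcal A_1(\mathbb R),\ f'>-1\}$, and let $$\mathcal M=\mathrm{Diff}_{\mathcal A}(\mathbb R)\ltimes\mathcal A(\mathbb R),\qquad \widetilde{\mathcal M}=\mathrm{Diff}_{\mathcal A_1}(\mathbb R)\ltimes\mathcal A(\mathbb R)$$ be the semidirect product Lie groups with multiplication $(\varphi,\alpha)(\psi,\beta)=(\varphi\circ\psi,\ \beta+\alpha\circ\psi)$. Their Lie algebras are $\mathfrak g=\mathcal A(\mathbb R)\times\mathcal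 A(\mathbb R)$ and $\tilde{\mathfrak g}=\mathcal A_1(\mathbb R)\times\mathcal A(\mathbb R)$, with $\mathrm{ad}(X,a)(Z,c)=(X'Z-XZ',\ a'Z-Xc')$. Consider on both groups the right-invariant weak Riemannian metric $G$ given at the neutral element by $$G\big((X,a),(Y,b)\big)=\int_{\mathbb R}X'(x)Y'(x)+a(x)b(x)\,dx .$$ Let $\check G$ denote the induced map from the Lie algebra to its dual. The geodesic equation $\partial_t\xi=-\check G^{-1}\,\mathrm{ad}(\xi)^*\check G(\xi)$ is said to exist if $\mathrm{ad}(\xi)^*\check G(\xi)$ lies in the image of $\check G$ for every $\xi$ in the Lie algebra. 1. On $\widetilde{\mathcal M}$ the geodesic equation exists, and for all $(X,a)\in\tilde{\mathfrak g}$ $$\check G^{-1}\,\mathrm{ad}(X,a)^*\check G(X,a)=\Big(XX'-\tfrac12\int_{-\infty}^x (X'^2+a^2)\,dz,\ (aX)'\Big)\in\tilde{\mathfrak g} .$$ It is the non-periodic two-component Hunter–Saxton system: a smooth curve $(\varphi(t),\alpha(t))$, $t\in[a,b]$ with $a<b$, in $\widetilde{\mathcal M}$ (the restriction of a smooth curve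 on an open neighbourhood of $[a,b]$) is a geodesic, i.e. a critical point of the energy $\frac12\int_a^b G(\partial_t(\varphi,\alpha),\partial_t(\varphi,\alpha))\,dt$ under smooth variations in $\widetilde{\mathcal M}$ with fixed endpoints, if and only if $(u,\rho)=(\varphi_t\circ\varphi^{-1},\ \alpha_t\circ\varphi^{-1})$ satisfies, on $[a,b]\times\mathbb R$, $$u_t=-u\,u_x+\frac12\int_{-\infty}^x\big(u_x(t,z)^2+\rho(t,z)^2\big)\,dz,\qquad \rho_t=-(\rho u)_x .$$ 2. On $\mathcal M$ the geodesic equation does not exist. In fact $\mathrm{ad}(X,a)^*\check G(X,a)\notin\check G(\mathfrak g)$ for every $(X,a)\in\mathfrak g\setminus\{0\}$. Moreover $(\mathcal M,G)$ has no Levi-Civita covariant derivative: in the global chart $(\varphi,\alpha)\mapsto(\varphi-\mathrm{Id},\alpha)$ the Koszul equation for the Christoffel symbols is not solvable at all points with values in $\mathfrak g$. Hence $(\mathcal M,G)$ is not a robust Riemannian manifold, where robust means that the Levi-Civita covariant derivative exists and that the inner products $G_g$, $g\in\mathcal M$, are bounded with respect to each other in this chart, so that the completions of the tangent spaces form a smooth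 vector bundle. -/

import Mathlib

open scoped ContDiff Topology

noncomputable section

namespace TwoHS

/-- The three choices of the function space `𝒜(ℝ)`: smooth functions with compact support,
rapidly decreasing functions, and `W^{∞,1}(ℝ)` (all derivatives are in `L¹`). -/
inductive DecayClass where
  | compactSupport
  | schwartz
  | sobolev

/-- `f ∈ 𝒜(ℝ)`. -/
def InA (A : DecayClass) (f : ℝ → ℝ) : Prop :=
  ContDiff ℝ ∞ f ∧
    match A with
    | .compactSupport => HasCompactSupport f
    | .schwartz => ∀ m n : ℕ, ∃ C : ℝ, ∀ x : ℝ, |x| ^ m * |iteratedDeriv n f x| ≤ C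
    | .sobolev => ∀ n : ℕ, MeasureTheory.Integrable (iteratedDeriv n f)

/-- `f ∈ 𝒜₁(ℝ)`: `f' ∈ 𝒜(ℝ)` and `f(-∞) = 0`. -/
def InA1 (A : DecayClass) (f : ℝ → ℝ) : Prop :=
  ContDiff ℝ ∞ f ∧ InA A (deriv f) ∧ Filter.Tendsto f Filter.atBot (𝓝 0)

/-- Smooth maps `p ↦ f(p, ·)` from an open subset `U` of a finite dimensional space to `𝒜(ℝ)`:
`f` is jointly smooth, and all its (total) derivatives satisfy the decay condition of `𝒜`,
locally uniformly in the parameter. For `𝒜 = C_c^∞` this says that the supports are, locally in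
the parameter, contained in a common compact set. -/
def IsSmoothInA {P : Type*} [NormedAddCommGroup P] [NormedSpace ℝ P] (A : DecayClass)
    (U : Set P) (f : P → ℝ → ℝ) : Prop :=
  ContDiffOn ℝ ∞ (fun q : P × ℝ => f q.1 q.2) (U ×ˢ Set.univ) ∧
    ∀ K : Set P, IsCompact K → K ⊆ U →
      match A with
      | .compactSupport => ∃ R : ℝ, ∀ p ∈ K, ∀ x : ℝ, R < |x| → f p x = 0
      | .schwartz => ∀ m n : ℕ, ∃ C : ℝ, ∀ p ∈ K, ∀ x : ℝ,
          |x| ^ m * ‖iteratedFDeriv ℝ n (fun q : P × ℝ => f q.1 q.2) (p, x)‖ ≤ C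
      | .sobolev => ∀ n : ℕ, ∃ C : ℝ, ∀ p ∈ K,
          MeasureTheory.Integrable
            (fun x : ℝ => ‖iteratedFDeriv ℝ n (fun q : P × ℝ => f q.1 q.2) (p, x)‖) ∧
          ∫ x : ℝ, ‖iteratedFDeriv ℝ n (fun q : P × ℝ => f q.1 q.2) (p, x)‖ ≤ C

/-- Smooth maps `p ↦ f(p, ·)` from an open subset `U` of a finite dimensional space to `𝒜₁(ℝ)`,
which is isomorphic to `𝒜(ℝ)` through `f ↦ f'`. -/
def IsSmoothInA1 {P : Type*} [NormedAddCommGroup P] [NormedSpace ℝ P] (A : DecayClass)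
    (U : Set P) (f : P → ℝ → ℝ) : Prop :=
  ContDiffOn ℝ ∞ (fun q : P × ℝ => f q.1 q.2) (U ×ˢ Set.univ) ∧
    IsSmoothInA A U (fun p => deriv (f p)) ∧
    ∀ p ∈ U, Filter.Tendsto (f p) Filter.atBot (𝓝 0)

/-- Pairs of functions on the line: elements `(φ, α)` of the semidirect products, and tangent
vectors to them. -/
abbrev Pair : Type := (ℝ → ℝ) × (ℝ → ℝ)

/-- The group multiplication `(φ, α)(ψ, β) = (φ ∘ ψ, β + α ∘ ψ)`. -/
def semiMul (g h : Pair) : Pair := (g.1 ∘ h.1, h.2 + g.2 ∘ h.1)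

/-- The neutral element `(Id, 0)`. -/
def semiOne : Pair := (id, 0)

/-- The group inverse `(φ, α)⁻¹ = (φ⁻¹, -α ∘ φ⁻¹)`. -/
def semiInv (g : Pair) : Pair :=
  (Function.invFun g.1, -(g.2 ∘ Function.invFun g.1))

theorem semiInv_mul (g : Pair) (hg : Function.Bijective g.1) :
    semiMul (semiInv g) g = semiOne ∧ semiMul g (semiInv g) = semiOne := by
  have hl : ∀ x, Function.invFun g.1 (g.1 x) = x := Function.leftInverse_invFun hg.1
  have hr : ∀ x, g.1 (Function.invFun g.1 x) = x := Function.rightInverse_invFun hg.2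
  constructor <;> ext x <;> simp [semiMul, semiInv, semiOne, hl, hr]

/-- `Diff_𝒜(ℝ) ⋉ 𝒜(ℝ)`, as a set of pairs; here `Diff_𝒜 = {Id + f : f ∈ 𝒜, f' > -1}`. -/
def groupA (A : DecayClass) : Set Pair :=
  {g | InA A (fun x => g.1 x - x) ∧ (∀ x, 0 < deriv g.1 x) ∧ InA A g.2}

/-- `Diff_{𝒜₁}(ℝ) ⋉ 𝒜(ℝ)`, as a set of pairs; here
`Diff_{𝒜₁} = {Id + f : f ∈ 𝒜₁, f' > -1}`. -/
def groupA1 (A : DecayClass) : Set Pair :=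
  {g | InA1 A (fun x => g.1 x - x) ∧ (∀ x, 0 < deriv g.1 x) ∧ InA A g.2}

/-- The Lie algebra `𝒜(ℝ) × 𝒜(ℝ)` of `Diff_𝒜(ℝ) ⋉ 𝒜(ℝ)`; in the global chart
`(φ, α) ↦ (φ - Id, α)` it is also every tangent space. -/
def lieA (A : DecayClass) : Set Pair := {ξ | InA A ξ.1 ∧ InA A ξ.2}

/-- The Lie algebra `𝒜₁(ℝ) × 𝒜(ℝ)` of `Diff_{𝒜₁}(ℝ) ⋉ 𝒜(ℝ)`. -/
def lieA1 (A : DecayClass) : Set Pair := {ξ | InA1 A ξ.1 ∧ InA A ξ.2}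

/-- Smooth maps from an open set `U` to `Diff_{𝒜₁}(ℝ) ⋉ 𝒜(ℝ)`. -/
def IsSmoothInGroupA1 {P : Type*} [NormedAddCommGroup P] [NormedSpace ℝ P] (A : DecayClass)
    (U : Set P) (g : P → Pair) : Prop :=
  (∀ p ∈ U, g p ∈ groupA1 A) ∧ IsSmoothInA1 A U (fun p x => (g p).1 x - x) ∧
    IsSmoothInA A U (fun p => (g p).2)

/-- The tangent map of the right translation `g ↦ g k`, applied to the tangent vector `h`. -/
def tangentRightMul (k h : Pair) : Pair := (h.1 ∘ k.1, h.2 ∘ k.1)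

theorem semiMul_add_smul (g h k : Pair) (s : ℝ) :
    semiMul (g + s • h) k = semiMul g k + s • tangentRightMul k h := by
  ext x
  · simp [semiMul, tangentRightMul]
  · simp [semiMul, tangentRightMul]; ring

/-- The adjoint action `ad(X, a)(Z, c) = (X' Z - X Z', a' Z - X c')` of the Lie algebra, i.e. the
Lie bracket `[(X, a), (Z, c)]` of the semidirect product. -/
def ad (ξ η : Pair) : Pair :=
  (fun x => deriv ξ.1 x * η.1 x - ξ.1 x * deriv η.1 x,
   fun x => deriv ξ.2 x * η.1 x - ξ.1 x * deriv η.2 x)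

theorem semiMul_mixed_deriv (ξ η : Pair) (h1 : Differentiable ℝ ξ.1) (h2 : Differentiable ℝ ξ.2)
    (x : ℝ) :
    deriv (fun s : ℝ => deriv (fun t : ℝ =>
      (semiMul (semiOne + s • ξ) (semiOne + t • η)).1 x) 0) 0 = deriv ξ.1 x * η.1 x ∧
    deriv (fun s : ℝ => deriv (fun t : ℝ =>
      (semiMul (semiOne + s • ξ) (semiOne + t • η)).2 x) 0) 0 = deriv ξ.2 x * η.1 x := by
  have hin : ∀ c : ℝ, HasDerivAt (fun t : ℝ => x + t * c) c 0 := fun c => by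
    simpa using ((hasDerivAt_id (0 : ℝ)).mul_const c).const_add x
  have key : ∀ f : ℝ → ℝ, Differentiable ℝ f →
      HasDerivAt (fun t : ℝ => f (x + t * η.1 x)) (deriv f x * η.1 x) 0 := fun f hf => by
    have h : HasDerivAt f (deriv f x) (x + 0 * η.1 x) := by
      rw [zero_mul, add_zero]
      exact (hf x).hasDerivAt
    exact h.comp (0 : ℝ) (hin (η.1 x))
  have lin : ∀ p q : ℝ, deriv (fun s : ℝ => p + s * q) 0 = q := fun p q => by
    have := ((hasDerivAt_id (0 : ℝ)).mul_const q).const_add p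
    simpa using this.deriv
  constructor
  · have : ∀ s : ℝ, deriv (fun t : ℝ =>
        (semiMul (semiOne + s • ξ) (semiOne + t • η)).1 x) 0
          = η.1 x + s * (deriv ξ.1 x * η.1 x) := fun s => by
      have h : HasDerivAt (fun t : ℝ => x + t * η.1 x + s * ξ.1 (x + t * η.1 x))
          (η.1 x + s * (deriv ξ.1 x * η.1 x)) 0 :=
        (hin (η.1 x)).add ((key ξ.1 h1).const_mul s)
      simpa [semiMul, semiOne] using h.deriv
    simp only [this, lin]
  · have : ∀ s : ℝ, deriv (fun t : ℝ =>
        (semiMul (semiOne + s • ξ) (semiOne + t • η)).2 x) 0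
          = η.2 x + s * (deriv ξ.2 x * η.1 x) := fun s => by
      have h0 : HasDerivAt (fun t : ℝ => t * η.2 x) (η.2 x) 0 := by
        simpa using (hasDerivAt_id (0 : ℝ)).mul_const (η.2 x)
      have h : HasDerivAt (fun t : ℝ => t * η.2 x + s * ξ.2 (x + t * η.1 x))
          (η.2 x + s * (deriv ξ.2 x * η.1 x)) 0 :=
        h0.add ((key ξ.2 h2).const_mul s)
      simpa [semiMul, semiOne] using h.deriv
    simp only [this, lin]

/-- `ad ξ η` is the Lie bracket which belongs to the multiplication `semiMul`: in a chart centred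
at the neutral element, the bracket is the antisymmetrization of the mixed second derivative of
the multiplication. -/
theorem ad_eq_mixed_deriv (ξ η : Pair) (h1 : Differentiable ℝ ξ.1) (h2 : Differentiable ℝ ξ.2)
    (k1 : Differentiable ℝ η.1) (k2 : Differentiable ℝ η.2) (x : ℝ) :
    (ad ξ η).1 x =
      deriv (fun s : ℝ => deriv (fun t : ℝ =>
        (semiMul (semiOne + s • ξ) (semiOne + t • η)).1 x) 0) 0 -
      deriv (fun s : ℝ => deriv (fun t : ℝ =>
        (semiMul (semiOne + s • η) (semiOne + t • ξ)).1 x) 0) 0 ∧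
    (ad ξ η).2 x =
      deriv (fun s : ℝ => deriv (fun t : ℝ =>
        (semiMul (semiOne + s • ξ) (semiOne + t • η)).2 x) 0) 0 -
      deriv (fun s : ℝ => deriv (fun t : ℝ =>
        (semiMul (semiOne + s • η) (semiOne + t • ξ)).2 x) 0) 0 := by
  obtain ⟨a1, a2⟩ := semiMul_mixed_deriv ξ η h1 h2 x
  obtain ⟨b1, b2⟩ := semiMul_mixed_deriv η ξ k1 k2 x
  rw [a1, a2, b1, b2]
  simp only [ad]
  constructor <;> ring

/-- The inner product `∫ X' Y' + a b dx` of `(X, a)` and `(Y, b)` on the Lie algebra. -/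
def innerLie (ξ η : Pair) : ℝ :=
  ∫ x : ℝ, deriv ξ.1 x * deriv η.1 x + ξ.2 x * η.2 x

/-- The right-invariant metric at the point `g`: tangent vectors at `g` are carried to the
neutral element by the right translation by `g⁻¹`. -/
def metricAt (g h k : Pair) : ℝ :=
  innerLie (tangentRightMul (semiInv g) h) (tangentRightMul (semiInv g) k)

/-- The velocity `∂_t g(t)` of a curve of pairs. -/
def velocity (g : ℝ → Pair) (t : ℝ) : Pair :=
  (fun x => deriv (fun τ => (g τ).1 x) t, fun x => deriv (fun τ => (g τ).2 x) t)

/-- The energy `½ ∫_a^b G_{g(t)}(∂_t g(t), ∂_t g(t)) dt`. -/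
def energy (a b : ℝ) (g : ℝ → Pair) : ℝ :=
  1 / 2 * ∫ t in a..b, metricAt (g t) (velocity g t) (velocity g t)

/-- The curve `g`, restricted to `[a, b]`, is a geodesic of `Diff_{𝒜₁}(ℝ) ⋉ 𝒜(ℝ)`: it is a
critical point of the energy under all smooth variations `V(s, t)` with fixed endpoints. -/
def IsGeodesicA1 (A : DecayClass) (a b : ℝ) (g : ℝ → Pair) : Prop :=
  ∀ (ε : ℝ) (J : Set ℝ) (V : ℝ × ℝ → Pair), 0 < ε → IsOpen J → Set.Icc a b ⊆ J →
    IsSmoothInGroupA1 A (Set.Ioo (-ε) ε ×ˢ J) V →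
    (∀ t ∈ Set.Icc a b, V (0, t) = g t) →
    (∀ s ∈ Set.Ioo (-ε) ε, V (s, a) = g a ∧ V (s, b) = g b) →
    HasDerivAt (fun s => energy a b (fun t => V (s, t))) 0 0

/-- `ζ` is an element of the Lie algebra `𝔤` with `Ǧ(ζ) = ad(ξ)^* Ǧ(ξ)` as functionals on `𝔤`,
where `Ǧ : 𝔤 → 𝔤^*` is induced by the inner product. -/
def RepresentsAdjoint (𝔤 : Set Pair) (ξ ζ : Pair) : Prop :=
  ζ ∈ 𝔤 ∧ ∀ η ∈ 𝔤, innerLie ζ η = innerLie ξ (ad ξ η)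

/-- The geodesic equation `∂_t ξ = -Ǧ⁻¹ ad(ξ)^* Ǧ(ξ)` exists: `ad(ξ)^* Ǧ(ξ) ∈ Ǧ(𝔤)` for every
`ξ ∈ 𝔤`. -/
def GeodesicEquationExists (𝔤 : Set Pair) : Prop :=
  ∀ ξ ∈ 𝔤, ∃ ζ, RepresentsAdjoint 𝔤 ξ ζ

/-- The non-periodic two-component Hunter-Saxton system for times in `T`. -/
def SolvesTwoComponentHS (T : Set ℝ) (u ρ : ℝ → ℝ → ℝ) : Prop :=
  ∀ t ∈ T, ∀ x : ℝ,
    HasDerivAt (fun τ => u τ x)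
      (-(u t x * deriv (u t) x) +
        1 / 2 * ∫ z in Set.Iic x, (deriv (u t) z ^ 2 + ρ t z ^ 2)) t ∧
    HasDerivAt (fun τ => ρ τ x) (-deriv (fun y => ρ t y * u t y) x) t

/-- The derivative at `g`, in the direction `m`, of the metric coefficient `G(h, k)` in the global
chart `(φ, α) ↦ (φ - Id, α)`. -/
def metricDeriv (g m h k : Pair) : ℝ := deriv (fun s : ℝ => metricAt (g + s • m) h k) 0

/-- `Γ` solves the Koszul equation for the Christoffel symbols of the Levi-Civita covariant
derivative on `Diff_𝒜(ℝ) ⋉ 𝒜(ℝ)`, in the global chart. -/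
def IsChristoffel (A : DecayClass) (Γ : Pair → Pair → Pair → Pair) : Prop :=
  ∀ g ∈ groupA A, ∀ h ∈ lieA A, ∀ k ∈ lieA A, Γ g h k ∈ lieA A ∧
    ∀ m ∈ lieA A, 2 * metricAt g (Γ g h k) m =
      metricDeriv g h k m + metricDeriv g k h m - metricDeriv g m h k

/-- Smooth curves of tangent vectors of `Diff_𝒜(ℝ) ⋉ 𝒜(ℝ)`, in the global chart. -/
def IsSmoothCurveInLieA (A : DecayClass) (c : ℝ → Pair) : Prop :=
  IsSmoothInA A Set.univ (fun t => (c t).1) ∧ IsSmoothInA A Set.univ (fun t => (c t).2)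

/-- `Diff_𝒜(ℝ) ⋉ 𝒜(ℝ)` with the right-invariant metric is a robust Riemannian manifold: the
Levi-Civita covariant derivative exists (its Christoffel symbols are smooth, that is, they map
smooth curves to smooth curves), and the inner products on the tangent spaces are bounded with
respect to each other in the global chart, so that the completions of the tangent spaces form a
smooth vector bundle. -/
def IsRobustA (A : DecayClass) : Prop :=
  (∃ Γ, IsChristoffel A Γ ∧
    ∀ g h k : ℝ → Pair, (∀ t, g t ∈ groupA A) →
      IsSmoothCurveInLieA A (fun t => g t - semiOne) →
      IsSmoothCurveInLieA A h → IsSmoothCurveInLieA A k →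
      IsSmoothCurveInLieA A (fun t => Γ (g t) (h t) (k t))) ∧
  ∀ g₁ ∈ groupA A, ∀ g₂ ∈ groupA A, ∃ C : ℝ, ∀ h ∈ lieA A,
    metricAt g₁ h h ≤ C * metricAt g₂ h h

end TwoHS

end

/-! Everything rests on one integration by parts: for `ξ = (X, a)` and `η = (Z, c)`, `innerLie ξ (ad
ξ η) = ∫ K Z' + (aX)' c` with `K = X'²/2 + X X'' - a²/2 = (X X')' - (X'² + a²)/2` (`innerLie_ad`). A
representative `ζ` of the adjoint therefore needs `ζ.1' = K`, `ζ.2 = (aX)'`. On the large group the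
primitive of `K` that vanishes at `-∞` lies in `𝒜₁`, since `K ∈ 𝒜` is all that is required
(`representsAdjoint_lieA1`). On the small group `ζ.1` must lie in `𝒜`, so `∫ ζ.1' = 0`; as `∫ (X
X')' = 0` too, this forces `∫ X'² + a² = 0`, hence `X = 0` and `a = 0`
(`not_representsAdjoint_lieA`). The same obstruction defeats the Koszul equation. At the identity
with `h = k = (0, a)` it reads `2 ∫ Y' Z' = -∫ a² Z'`, so `2Y' = -a²`, and integrating gives `a = 0`
(`not_exists_isChristoffel`).

For geodesics, the substitution `y = φ(x)` removes the inverse from the metric. With `N = φ_x - 1`,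
twice the energy is the integral over `[a, b] × ℝ` of `N_t² / (1 + N) + α_t² (1 + N)`, in which only
the `𝒜`-valued families `N` and `α` occur (`metricAt_eq`, `IsSmoothInGroupA1.metricAt_velocity`).
The first variation is computed by differentiating under the integral and integrating by parts in
`t` (`hasDerivAt_action`), and the fundamental lemma of the calculus of variations makes criticality
equivalent to two pointwise equations (`isGeodesicA1_iff`). Differentiation under the integral needs
one integrable bound in `x`, locally uniform in the parameters. For `W^{∞,1}` only uniform `L¹`
bounds are given; a Sobolev inequality in the two parameters produces the pointwise bound
(`exists_domOn_nhds_sobolev`).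

Finally the Euler-Lagrange equations are put in Eulerian form. Since `u ∘ φ = φ_t`, one has `(u_t +
u u_x) ∘ φ = φ_tt`; the first equation is the `x`-derivative of `φ_tt = ½ ∫_{-∞}^{φ} (u_x² + ρ²)`,
and both sides of the latter vanish at `-∞`. The second is the conservation law `(α_t φ_x)_t = 0`,
which is `ρ_t + (ρu)_x = 0` multiplied by `φ_x` along `φ` (`eulerLagrange_iff_solves`). -/

noncomputable section

namespace TwoHS

open MeasureTheory Filter Set

/-! ### The spaces `𝒜` and `𝒜₁`: closure properties, bounds and decay. -/

section

/-- Smooth functions all of whose derivatives are bounded. -/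
def BddDerivs (h : ℝ → ℝ) : Prop :=
  ContDiff ℝ ∞ h ∧ ∀ n : ℕ, ∃ C : ℝ, ∀ x : ℝ, |iteratedDeriv n h x| ≤ C

theorem contDiff_deriv {f : ℝ → ℝ} (hf : ContDiff ℝ ∞ f) : ContDiff ℝ ∞ (deriv f) :=
  (contDiff_infty_iff_deriv.1 hf).2

theorem contDiff_iteratedDeriv {f : ℝ → ℝ} (hf : ContDiff ℝ ∞ f) (n : ℕ) :
    ContDiff ℝ ∞ (iteratedDeriv n f) := by
  induction n with
  | zero => simpa using hf
  | succ n ih => rw [iteratedDeriv_succ]; exact contDiff_deriv ih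

theorem hasDerivAt_of_contDiff {f : ℝ → ℝ} (hf : ContDiff ℝ ∞ f) (x : ℝ) :
    HasDerivAt f (deriv f x) x :=
  ((contDiff_infty_iff_deriv.1 hf).1 x).hasDerivAt

theorem bounded_of_integrable_deriv {f : ℝ → ℝ} (hf : ContDiff ℝ ∞ f)
    (h : Integrable (deriv f)) : ∃ C, ∀ x, |f x| ≤ C := by
  refine ⟨|f 0| + ∫ x, |deriv f x|, fun x => ?_⟩
  have h1 : ∫ y in (0 : ℝ)..x, deriv f y = f x - f 0 :=
    intervalIntegral.integral_eq_sub_of_hasDerivAt (fun y _ => hasDerivAt_of_contDiff hf y)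
      h.intervalIntegrable
  have h2 : |∫ y in (0 : ℝ)..x, deriv f y| ≤ ∫ x, |deriv f x| := by
    rw [← Real.norm_eq_abs]
    refine (intervalIntegral.norm_integral_le_integral_norm_uIoc (f := deriv f)).trans ?_
    exact setIntegral_le_integral h.norm (Eventually.of_forall fun _ => norm_nonneg _)
  have h3 : f x = f 0 + ∫ y in (0 : ℝ)..x, deriv f y := by rw [h1]; ring
  rw [h3]
  exact (abs_add_le _ _).trans (by gcongr)

theorem integrable_of_schwartz_bound {f : ℝ → ℝ} (hf : Continuous f)
    {C₀ C₂ : ℝ} (h0 : ∀ x, |f x| ≤ C₀) (h2 : ∀ x, |x| ^ 2 * |f x| ≤ C₂) : Integrable f := by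
  refine (integrable_inv_one_add_sq.const_mul (C₀ + C₂)).mono' hf.aestronglyMeasurable
    (Eventually.of_forall fun x => ?_)
  have hx : 0 < 1 + x ^ 2 := by positivity
  rw [← div_eq_mul_inv, le_div_iff₀ hx, Real.norm_eq_abs]
  have := h0 x
  have h2' := h2 x
  rw [sq_abs] at h2'
  linarith

theorem hasCompactSupport_iteratedDeriv {f : ℝ → ℝ} (hf : HasCompactSupport f) (n : ℕ) :
    HasCompactSupport (iteratedDeriv n f) := by
  induction n with
  | zero => simpa using hf
  | succ n ih => rw [iteratedDeriv_succ]; exact ih.deriv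

variable {A : DecayClass} {f g h : ℝ → ℝ}

/-- All three classes embed in `W^{∞,1}`. Boundedness of derivatives, limits at infinity and
vanishing boundary terms are all drawn from this, without further distinction of cases. -/
theorem InA.integrable_iteratedDeriv (hf : InA A f) (n : ℕ) :
    Integrable (iteratedDeriv n f) := by
  obtain ⟨hs, hd⟩ := hf
  have hc := (contDiff_iteratedDeriv hs n).continuous
  cases A with
  | compactSupport => exact hc.integrable_of_hasCompactSupport (hasCompactSupport_iteratedDeriv hd n)
  | schwartz =>
    obtain ⟨C₀, h0⟩ := hd 0 n
    obtain ⟨C₂, h2⟩ := hd 2 n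
    exact integrable_of_schwartz_bound hc (by simpa using h0) h2
  | sobolev => exact hd n

theorem InA.integrable (hf : InA A f) : Integrable f := by
  simpa using hf.integrable_iteratedDeriv 0

theorem InA.bddDerivs (hf : InA A f) : BddDerivs f :=
  ⟨hf.1, fun n => bounded_of_integrable_deriv (contDiff_iteratedDeriv hf.1 n)
    (by rw [← iteratedDeriv_succ]; exact hf.integrable_iteratedDeriv _)⟩

protected theorem InA.deriv (hf : InA A f) : InA A (deriv f) := by
  refine ⟨contDiff_deriv hf.1, ?_⟩
  obtain ⟨hs, hd⟩ := hf
  cases A with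
  | compactSupport => exact HasCompactSupport.deriv hd
  | schwartz => intro m n; rw [← iteratedDeriv_succ']; exact hd m (n + 1)
  | sobolev => intro n; rw [← iteratedDeriv_succ']; exact hd (n + 1)

protected theorem BddDerivs.deriv (hf : BddDerivs f) : BddDerivs (deriv f) :=
  ⟨contDiff_deriv hf.1, fun n => by rw [← iteratedDeriv_succ']; exact hf.2 (n + 1)⟩

theorem InA1.bddDerivs (hf : InA1 A f) : BddDerivs f := by
  refine ⟨hf.1, fun n => ?_⟩
  cases n with
  | zero => simpa using bounded_of_integrable_deriv hf.1 hf.2.1.integrable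
  | succ n => rw [iteratedDeriv_succ']; exact hf.2.1.bddDerivs.2 n

theorem bddDerivs_const (c : ℝ) : BddDerivs (fun _ => c) :=
  ⟨contDiff_const, fun n => ⟨|c|, fun x => by
    rw [iteratedDeriv_const]; split_ifs <;> simp⟩⟩

/-- By the Leibniz rule `𝒜` absorbs factors with bounded derivatives. This is the form needed on the
large group, where `X ∈ 𝒜₁` need not decay at `+∞`: every product that occurs has at least one
factor in `𝒜`. -/
theorem InA.mul_bdd (hf : InA A f) (hh : BddDerivs h) : InA A (fun x => f x * h x) := by
  have hL : ∀ n x, iteratedDeriv n (fun x => f x * h x) x = ∑ i ∈ Finset.range (n + 1),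
      (n.choose i : ℝ) * iteratedDeriv i f x * iteratedDeriv (n - i) h x := fun n x =>
    iteratedDeriv_fun_mul (hf.1.contDiffAt.of_le (by exact_mod_cast le_top))
      (hh.1.contDiffAt.of_le (by exact_mod_cast le_top))
  refine ⟨hf.1.mul hh.1, ?_⟩
  have hs := hf.1
  have hf' := hf
  obtain ⟨-, hd⟩ := hf
  choose B hB using hh.2
  cases A with
  | compactSupport => exact HasCompactSupport.mul_right hd
  | schwartz =>
    intro m n
    choose D hD using hd
    refine ⟨∑ i ∈ Finset.range (n + 1), (n.choose i : ℝ) * D m i * B (n - i), fun x => ?_⟩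
    rw [hL, ← abs_of_nonneg (pow_nonneg (abs_nonneg x) m), ← abs_mul, Finset.mul_sum]
    refine (Finset.abs_sum_le_sum_abs _ _).trans (Finset.sum_le_sum fun i _ => ?_)
    have h1 := hD m i x
    have h2 := hB (n - i) x
    have e : |(|x| ^ m * ((n.choose i : ℝ) * iteratedDeriv i f x * iteratedDeriv (n - i) h x))|
        = (n.choose i : ℝ) * (|x| ^ m * |iteratedDeriv i f x|) * |iteratedDeriv (n - i) h x| := by
      simp only [abs_mul, abs_pow, abs_abs, Nat.abs_cast]; ring
    rw [e]
    gcongr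
    exact mul_nonneg (Nat.cast_nonneg _) (le_trans (by positivity) h1)
  | sobolev =>
    intro n
    rw [show iteratedDeriv n (fun x => f x * h x) = fun x => ∑ i ∈ Finset.range (n + 1),
      (n.choose i : ℝ) * iteratedDeriv i f x * iteratedDeriv (n - i) h x from funext (hL n)]
    refine integrable_finsetSum _ fun i _ => ?_
    exact (((hd i).const_mul _).mul_bdd (c := B (n - i))
      (contDiff_iteratedDeriv hh.1 _).continuous.aestronglyMeasurable
      (Eventually.of_forall fun x => hB (n - i) x))

protected theorem InA.add (hf : InA A f) (hg : InA A g) : InA A (fun x => f x + g x) := by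
  have hL : ∀ n x, iteratedDeriv n (fun x => f x + g x) x =
      iteratedDeriv n f x + iteratedDeriv n g x := fun n x =>
    iteratedDeriv_fun_add (hf.1.contDiffAt.of_le (by exact_mod_cast le_top))
      (hg.1.contDiffAt.of_le (by exact_mod_cast le_top))
  refine ⟨hf.1.add hg.1, ?_⟩
  obtain ⟨-, hd⟩ := hf
  obtain ⟨-, hd'⟩ := hg
  cases A with
  | compactSupport => exact HasCompactSupport.add hd hd'
  | schwartz =>
    intro m n
    obtain ⟨C, hC⟩ := hd m n
    obtain ⟨D, hD⟩ := hd' m n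
    refine ⟨C + D, fun x => ?_⟩
    rw [hL]
    calc _ ≤ |x| ^ m * (|iteratedDeriv n f x| + |iteratedDeriv n g x|) := by
          gcongr; exact abs_add_le _ _
      _ ≤ _ := by rw [mul_add]; exact add_le_add (hC x) (hD x)
  | sobolev =>
    intro n
    rw [show iteratedDeriv n (fun x => f x + g x) = fun x => iteratedDeriv n f x +
      iteratedDeriv n g x from funext (hL n)]
    exact (hd n).add (hd' n)

protected theorem InA.mul_const (hf : InA A f) (c : ℝ) : InA A (fun x => f x * c) :=
  hf.mul_bdd (bddDerivs_const c)

protected theorem InA.sub (hf : InA A f) (hg : InA A g) : InA A (fun x => f x - g x) := by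
  simpa [sub_eq_add_neg] using hf.add (hg.mul_const (-1))

theorem InA.tendsto_atTop (hf : InA A f) : Tendsto f atTop (𝓝 0) :=
  tendsto_zero_of_hasDerivAt_of_integrableOn_Ioi (a := 0)
    (fun x _ => hasDerivAt_of_contDiff hf.1 x) hf.deriv.integrable.integrableOn
    hf.integrable.integrableOn

theorem InA.tendsto_atBot (hf : InA A f) : Tendsto f atBot (𝓝 0) :=
  tendsto_zero_of_hasDerivAt_of_integrableOn_Iic (a := 0)
    (fun x _ => hasDerivAt_of_contDiff hf.1 x) hf.deriv.integrable.integrableOn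
    hf.integrable.integrableOn

/-- Makes compactly supported test functions available in each of the three cases. -/
theorem inA_of_hasCompactSupport (hf : ContDiff ℝ ∞ f) (hc : HasCompactSupport f) : InA A f := by
  refine ⟨hf, ?_⟩
  cases A with
  | compactSupport => exact hc
  | schwartz =>
    intro m n
    have h1 : Continuous (fun x : ℝ => |x| ^ m * |iteratedDeriv n f x|) :=
      (continuous_abs.pow m).mul (contDiff_iteratedDeriv hf n).continuous.abs
    have h2 : HasCompactSupport (fun x : ℝ => |x| ^ m * |iteratedDeriv n f x|) :=
      HasCompactSupport.mul_left (hasCompactSupport_iteratedDeriv hc n).norm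
    obtain ⟨C, hC⟩ := h1.bounded_above_of_compact_support h2
    exact ⟨C, fun x => (le_abs_self _).trans (hC x)⟩
  | sobolev =>
    intro n
    exact (contDiff_iteratedDeriv hf n).continuous.integrable_of_hasCompactSupport
      (hasCompactSupport_iteratedDeriv hc n)

theorem inA_zero : InA A (fun _ => (0 : ℝ)) :=
  inA_of_hasCompactSupport contDiff_const HasCompactSupport.zero

theorem BddDerivs.exists_bound (hf : BddDerivs f) : ∃ C, ∀ x, |f x| ≤ C := by
  simpa using hf.2 0

theorem tendsto_mul_zero_of_bdd {l : Filter ℝ} (hf : Tendsto f l (𝓝 0)) (hh : BddDerivs h) :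
    Tendsto (fun x => f x * h x) l (𝓝 0) := by
  obtain ⟨C, hC⟩ := hh.exists_bound
  refine squeeze_zero_norm (a := fun x => |f x| * C) (fun x => ?_) ?_
  · rw [norm_mul, Real.norm_eq_abs, Real.norm_eq_abs]
    gcongr
    exact hC x
  · simpa using hf.abs.mul_const C

end

/-! ### The adjoint of `ad`: existence on the large Lie algebra, obstruction on the small one. -/

section

variable {A : DecayClass} {f g h : ℝ → ℝ}

theorem hasDerivAt_integral_Iic (hf : Continuous f) (hi : Integrable f) (x : ℝ) :
    HasDerivAt (fun x => ∫ z in Iic x, f z) (f x) x := by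
  have h1 : HasDerivAt (fun x => (∫ z in Iic (0 : ℝ), f z) + ∫ z in (0 : ℝ)..x, f z) (f x) x :=
    (intervalIntegral.integral_hasDerivAt_right hi.intervalIntegrable
      (hf.stronglyMeasurableAtFilter _ _) hf.continuousAt).const_add _
  refine h1.congr_of_eventuallyEq (Eventually.of_forall fun y => ?_)
  have := intervalIntegral.integral_Iic_sub_Iic (μ := volume) (f := f) (a := 0) (b := y)
    hi.integrableOn hi.integrableOn
  simp only [← this]
  ring

theorem tendsto_integral_Iic_atBot (hi : Integrable f) :
    Tendsto (fun x => ∫ z in Iic x, f z) atBot (𝓝 0) := by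
  have h1 : ∀ x, ∫ z in Iic x, f z = (∫ z in Iic (0 : ℝ), f z) - ∫ z in x..0, f z := fun x => by
    rw [← intervalIntegral.integral_Iic_sub_Iic (μ := volume) (f := f) (a := x) (b := 0)
      hi.integrableOn hi.integrableOn]
    ring
  rw [funext h1]
  have := (intervalIntegral_tendsto_integral_Iic (0 : ℝ) hi.integrableOn tendsto_id)
  simpa using this.const_sub (∫ z in Iic (0 : ℝ), f z)

/-- The primitive `∫_{-∞}^x f` of an element of `𝒜` belongs to `𝒜₁`. -/
theorem InA.integral_Iic (hf : InA A f) : InA1 A (fun x => ∫ z in Iic x, f z) := by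
  have hd : deriv (fun x => ∫ z in Iic x, f z) = f :=
    funext fun x => (hasDerivAt_integral_Iic hf.1.continuous hf.integrable x).deriv
  refine ⟨contDiff_infty_iff_deriv.2 ⟨fun x =>
    (hasDerivAt_integral_Iic hf.1.continuous hf.integrable x).differentiableAt, ?_⟩, ?_,
    tendsto_integral_Iic_atBot hf.integrable⟩
  · rw [hd]; exact hf.1
  · rw [hd]; exact hf

/-- Integration by parts, which moves the derivatives of `ad` away from the second argument. -/
theorem innerLie_ad {X a Z c : ℝ → ℝ} (hX : BddDerivs X) (hX' : InA A (deriv X)) (ha : InA A a)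
    (hZ : BddDerivs Z) (hZ' : InA A (deriv Z)) (hc : InA A c) :
    innerLie (X, a) (ad (X, a) (Z, c)) =
      ∫ x, (deriv X x ^ 2 / 2 + X x * deriv (deriv X) x - a x ^ 2 / 2) * deriv Z x +
        deriv (fun y => a y * X y) x * c x := by
  have dX := hasDerivAt_of_contDiff hX.1
  have ddX := hasDerivAt_of_contDiff hX'.1
  have dZ := hasDerivAt_of_contDiff hZ.1
  have ddZ := hasDerivAt_of_contDiff hZ'.1
  have da := hasDerivAt_of_contDiff ha.1
  have dc := hasDerivAt_of_contDiff hc.1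
  have bX' := hX.deriv
  have bX'' := hX.deriv.deriv
  have bZ' := hZ.deriv
  have e1 : ∀ x, deriv (fun x => deriv X x * Z x - X x * deriv Z x) x =
      deriv (deriv X) x * Z x - X x * deriv (deriv Z) x := fun x => by
    have := (((ddX x).mul (dZ x)).sub ((dX x).mul (ddZ x))).deriv
    simp only [Pi.mul_def, Pi.sub_def] at this
    rw [this]; ring
  have e2 : ∀ x, deriv (fun y => a y * X y) x = deriv a x * X x + a x * deriv X x := fun x => by
    have := ((da x).mul (dX x)).deriv
    simpa only [Pi.mul_def] using this
  have i1 : Integrable fun x => deriv X x * (deriv (deriv X) x * Z x - X x * deriv (deriv Z) x) +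
      a x * (deriv a x * Z x - X x * deriv c x) := by
    have := (((hX'.mul_bdd bX'').mul_bdd hZ).sub ((hX'.mul_bdd hX).mul_bdd bZ'.deriv)).add
      (((ha.mul_bdd ha.bddDerivs.deriv).mul_bdd hZ).sub ((ha.mul_bdd hX).mul_bdd hc.bddDerivs.deriv))
    exact this.integrable.congr (Eventually.of_forall fun x => by simp only []; ring)
  have i2 : Integrable fun x =>
      (deriv X x ^ 2 / 2 + X x * deriv (deriv X) x - a x ^ 2 / 2) * deriv Z x +
        (deriv a x * X x + a x * deriv X x) * c x := by
    have := ((((hX'.mul_bdd bX').mul_const (1 / 2)).add (hX'.deriv.mul_bdd hX)).sub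
      ((ha.mul_bdd ha.bddDerivs).mul_const (1 / 2))).mul_bdd bZ'
    have := this.add (((ha.deriv.mul_bdd hX).add (ha.mul_bdd bX')).mul_bdd hc.bddDerivs)
    exact this.integrable.congr (Eventually.of_forall fun x => by simp only []; ring)
  -- The two integrands differ by the derivative of this boundary expression.
  have hB : ∀ x, HasDerivAt (fun x => deriv X x * deriv X x * Z x / 2 - deriv X x * X x * deriv Z x
      + a x * a x * Z x / 2 - a x * X x * c x)
      (deriv X x * (deriv (deriv X) x * Z x - X x * deriv (deriv Z) x) +
      a x * (deriv a x * Z x - X x * deriv c x) -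
      ((deriv X x ^ 2 / 2 + X x * deriv (deriv X) x - a x ^ 2 / 2) * deriv Z x +
        (deriv a x * X x + a x * deriv X x) * c x)) x := fun x => by
    have := (((((((ddX x).mul (ddX x)).mul (dZ x)).div_const 2).sub
      (((ddX x).mul (dX x)).mul (ddZ x))).add ((((da x).mul (da x)).mul (dZ x)).div_const 2)).sub
      (((da x).mul (dX x)).mul (dc x)))
    refine this.congr_deriv ?_
    simp only [Pi.mul_apply]
    ring
  -- Each boundary term contains a factor `X'` or `a`, which tends to zero; `X` and `Z` need only be
  -- bounded, so the formula serves both groups.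
  have hlim : ∀ l : Filter ℝ, Tendsto (deriv X) l (𝓝 0) → Tendsto a l (𝓝 0) →
      Tendsto (fun x => deriv X x * deriv X x * Z x / 2 - deriv X x * X x * deriv Z x
      + a x * a x * Z x / 2 - a x * X x * c x) l (𝓝 0) := fun l h1 h2 => by
    have := (((tendsto_mul_zero_of_bdd (tendsto_mul_zero_of_bdd h1 bX') hZ).div_const 2).sub
      (tendsto_mul_zero_of_bdd (tendsto_mul_zero_of_bdd h1 hX) bZ')).add
      ((tendsto_mul_zero_of_bdd (tendsto_mul_zero_of_bdd h2 ha.bddDerivs) hZ).div_const 2)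
    have := this.sub (tendsto_mul_zero_of_bdd (tendsto_mul_zero_of_bdd h2 hX) hc.bddDerivs)
    simpa using this
  have key := integral_of_hasDerivAt_of_tendsto hB (i1.sub i2)
    (hlim _ hX'.tendsto_atBot ha.tendsto_atBot) (hlim _ hX'.tendsto_atTop ha.tendsto_atTop)
  rw [integral_sub i1 i2, sub_self, sub_eq_zero] at key
  simp only [innerLie, ad, e1, e2]
  exact key

/-- The function is `(X X')' - (X'² + a²)/2`, the derivative of the first component of the candidate
representative. -/
theorem inA_adjoint_fst {X a : ℝ → ℝ} (hX : BddDerivs X) (hX' : InA A (deriv X)) (ha : InA A a) :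
    InA A (fun x => deriv X x ^ 2 / 2 + X x * deriv (deriv X) x - a x ^ 2 / 2) := by
  have := (((hX'.mul_bdd hX.deriv).mul_const (1 / 2)).add (hX'.deriv.mul_bdd hX)).sub
      ((ha.mul_bdd ha.bddDerivs).mul_const (1 / 2))
  convert this using 2
  ring

/-- The nonlocal term generally has a nonzero limit at `+∞`. Membership in `𝒜₁` asks only for its
derivative to lie in `𝒜` and its limit at `-∞` to be zero, so the primitive is admissible. -/
theorem representsAdjoint_lieA1 {X a : ℝ → ℝ} (h : (X, a) ∈ lieA1 A) :
    RepresentsAdjoint (lieA1 A) (X, a)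
      (fun x => X x * deriv X x - 1 / 2 * ∫ z in Iic x, (deriv X z ^ 2 + a z ^ 2),
        fun x => deriv (fun y => a y * X y) x) := by
  obtain ⟨hX, ha⟩ := h
  simp only at hX ha
  have bX := hX.bddDerivs
  have hE : InA A (fun z => deriv X z ^ 2 + a z ^ 2) := by
    simpa only [pow_two] using (hX.2.1.mul_bdd bX.deriv).add (ha.mul_bdd ha.bddDerivs)
  have hd : ∀ x, HasDerivAt (fun x => X x * deriv X x -
      1 / 2 * ∫ z in Iic x, (deriv X z ^ 2 + a z ^ 2))
      (deriv X x ^ 2 / 2 + X x * deriv (deriv X) x - a x ^ 2 / 2) x := fun x => by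
    have := ((hasDerivAt_of_contDiff hX.1 x).mul (hasDerivAt_of_contDiff hX.2.1.1 x)).sub
      ((hasDerivAt_integral_Iic hE.1.continuous hE.integrable x).const_mul (1 / 2))
    refine this.congr_deriv ?_
    ring
  have hd' := funext fun x => (hd x).deriv
  have hA := inA_adjoint_fst bX hX.2.1 ha
  refine ⟨⟨⟨contDiff_infty_iff_deriv.2 ⟨fun x => (hd x).differentiableAt, ?_⟩, ?_, ?_⟩, ?_⟩, ?_⟩
  · rw [hd']; exact hA.1
  · simp only [hd']; exact hA
  · have h1 := tendsto_mul_zero_of_bdd hX.2.2 bX.deriv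
    simpa only [mul_zero, sub_zero] using h1.sub ((tendsto_integral_Iic_atBot hE.integrable).const_mul (1 / 2))
  · exact (ha.mul_bdd bX).deriv
  · rintro ⟨Z, c⟩ ⟨hZ, hc⟩
    rw [innerLie_ad bX hX.2.1 ha hZ.bddDerivs hZ.2.1 hc]
    simp only [innerLie, hd']

/-- An integrable `𝒜`-function whose integral against all derivatives of test functions
vanishes is zero. -/
theorem InA.eq_zero_of_integral_mul_deriv {w : ℝ → ℝ} (hw : InA A w)
    (h : ∀ Z : ℝ → ℝ, ContDiff ℝ ∞ Z → HasCompactSupport Z → ∫ x, w x * deriv Z x = 0) :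
    w = 0 := by
  -- Integration by parts makes `w'` orthogonal to all test functions. Hence `w` is constant, and
  -- decay makes the constant zero.
  have h1 : ∀ᵐ x, deriv w x = 0 := by
    refine ae_eq_zero_of_integral_contDiff_smul_eq_zero
      (hw.deriv.integrable.locallyIntegrable) fun Z hZ hc => ?_
    have hZA : InA A Z := inA_of_hasCompactSupport hZ hc
    have := integral_mul_deriv_eq_deriv_mul_of_integrable (u := w) (v := Z) (u' := deriv w)
      (v' := deriv Z)
      (fun x _ => hasDerivAt_of_contDiff hw.1 x) (fun x _ => hasDerivAt_of_contDiff hZ x)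
      (hw.mul_bdd hZA.bddDerivs.deriv).integrable (hw.deriv.mul_bdd hZA.bddDerivs).integrable
      (hw.mul_bdd hZA.bddDerivs).integrable
    rw [h Z hZ hc, eq_comm, neg_eq_zero] at this
    simpa only [smul_eq_mul, mul_comm] using this
  have h2 : deriv w = fun _ => 0 :=
    (hw.deriv.1.continuous.ae_eq_iff_eq volume continuous_const).1 h1
  have h3 : ∀ x, w x = w 0 := fun x =>
    is_const_of_deriv_eq_zero (contDiff_infty_iff_deriv.1 hw.1).1 (fun x => congrFun h2 x) x 0
  have h4 : w 0 = 0 := by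
    have := hw.tendsto_atTop
    rw [show w = fun _ => w 0 from funext h3] at this
    exact tendsto_nhds_unique tendsto_const_nhds this
  exact funext fun x => (h3 x).trans h4

theorem InA.integral_deriv (hf : InA A f) : ∫ x, deriv f x = 0 := by
  simpa using integral_of_hasDerivAt_of_tendsto (hasDerivAt_of_contDiff hf.1)
    hf.deriv.integrable hf.tendsto_atBot hf.tendsto_atTop

theorem eq_zero_of_integral_sq_add_sq (hf : InA A f) (hg : InA A g)
    (h : ∫ x, (f x ^ 2 + g x ^ 2) = 0) : f = 0 ∧ g = 0 := by
  have hi : Integrable fun x => f x ^ 2 + g x ^ 2 := by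
    simpa only [pow_two] using ((hf.mul_bdd hf.bddDerivs).add (hg.mul_bdd hg.bddDerivs)).integrable
  have hc : Continuous fun x => f x ^ 2 + g x ^ 2 :=
    (hf.1.continuous.pow 2).add (hg.1.continuous.pow 2)
  have h1 := (integral_eq_zero_iff_of_nonneg (fun x => by positivity) hi).1 h
  have h2 : (fun x => f x ^ 2 + g x ^ 2) = fun _ => 0 :=
    (hc.ae_eq_iff_eq volume continuous_const).1 h1
  constructor <;> ext x <;> have h3 : f x ^ 2 + g x ^ 2 = 0 := congrFun h2 x <;>
    simp only [Pi.zero_apply] <;> nlinarith [sq_nonneg (f x), sq_nonneg (g x)]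

/-- A representative would satisfy `ζ.1' = (X X')' - (X'² + a²)/2`. Both `ζ.1` and `X X'` vanish at
both ends of the line, so integrating leaves `∫ X'² + a² = 0`. -/
theorem not_representsAdjoint_lieA {ξ : Pair} (h : ξ ∈ lieA A) (h0 : ξ ≠ 0) :
    ¬ ∃ ζ, RepresentsAdjoint (lieA A) ξ ζ := by
  rintro ⟨ζ, ⟨hζ, hζ2⟩, hr⟩
  obtain ⟨X, a⟩ := ξ
  obtain ⟨hX, ha⟩ := h
  simp only at hX ha
  have bX := hX.bddDerivs
  have hK := inA_adjoint_fst bX hX.deriv ha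
  have hw := hζ.deriv.sub hK
  -- Test vectors `(Z, 0)` determine only `ζ.1'`, and this already suffices for the contradiction.
  have hw0 := hw.eq_zero_of_integral_mul_deriv fun Z hZ hc => by
    have hZA : InA A Z := inA_of_hasCompactSupport hZ hc
    have h1 := hr (Z, fun _ => 0) ⟨hZA, inA_zero⟩
    rw [innerLie_ad bX hX.deriv ha hZA.bddDerivs hZA.deriv inA_zero] at h1
    simp only [innerLie, mul_zero, add_zero] at h1
    have h2 := integral_sub (hζ.deriv.mul_bdd hZA.bddDerivs.deriv).integrable
      (hK.mul_bdd hZA.bddDerivs.deriv).integrable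
    rw [h1, sub_self] at h2
    rw [← h2]
    exact integral_congr_ae (Eventually.of_forall fun x => by simp only [sub_mul])
  have hE : Integrable (fun x => deriv X x ^ 2 + a x ^ 2) := by
    simpa only [pow_two] using
      ((hX.deriv.mul_bdd bX.deriv).add (ha.mul_bdd ha.bddDerivs)).integrable
  have h2 : ∫ x, (deriv X x ^ 2 + a x ^ 2) = 0 := by
    have e : ∀ x, deriv X x ^ 2 + a x ^ 2 =
        2 * (deriv (fun x => deriv X x * X x) x - deriv ζ.1 x) := fun x => by
      have h3 := congrFun hw0 x
      have h4 := ((hasDerivAt_of_contDiff hX.deriv.1 x).mul (hasDerivAt_of_contDiff hX.1 x)).deriv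
      simp only [Pi.mul_def] at h4
      simp only [Pi.zero_apply] at h3
      rw [h4]
      linarith
    have hXX := hX.deriv.mul_bdd bX
    simp only [e]
    rw [integral_const_mul, integral_sub hXX.deriv.integrable hζ.deriv.integrable,
      hXX.integral_deriv, hζ.integral_deriv]
    simp
  obtain ⟨h3, h4⟩ := eq_zero_of_integral_sq_add_sq hX.deriv ha h2
  -- With `X' = 0`, integration by parts makes `X` orthogonal to every `Z'`, so the same lemma
  -- applies to `X` itself.
  have h5 : X = 0 := hX.eq_zero_of_integral_mul_deriv fun Z hZ hc => by
    have hZA : InA A Z := inA_of_hasCompactSupport hZ hc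
    have := integral_mul_deriv_eq_deriv_mul_of_integrable (u := X) (v := Z) (u' := deriv X)
      (v' := deriv Z)
      (fun x _ => hasDerivAt_of_contDiff hX.1 x) (fun x _ => hasDerivAt_of_contDiff hZ x)
      (hX.mul_bdd hZA.bddDerivs.deriv).integrable (hX.deriv.mul_bdd hZA.bddDerivs).integrable
      (hX.mul_bdd hZA.bddDerivs).integrable
    rw [this, h3]
    simp
  exact h0 (by rw [h5, h4]; rfl)

/-- A smooth bump function which is `1` at the origin. -/
theorem exists_inA_ne_zero : ∃ f : ℝ → ℝ, InA A f ∧ f 0 = 1 := by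
  let b : ContDiffBump (0 : ℝ) := ⟨1, 2, by norm_num, by norm_num⟩
  exact ⟨b, inA_of_hasCompactSupport b.contDiff b.hasCompactSupport,
    b.one_of_mem_closedBall (Metric.mem_closedBall_self b.rIn_pos.le)⟩

theorem not_geodesicEquationExists_lieA : ¬ GeodesicEquationExists (lieA A) := by
  obtain ⟨f, hf, h0⟩ := exists_inA_ne_zero (A := A)
  intro h
  refine not_representsAdjoint_lieA (A := A) (ξ := (f, f)) ⟨hf, hf⟩ (fun h1 => ?_) (h _ ⟨hf, hf⟩)
  have := congrFun (congrArg Prod.fst h1) 0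
  simp [h0] at this

end

/-! ### The metric in the global chart and the failure of the Koszul equation. -/

section

variable {A : DecayClass} {f g h : ℝ → ℝ}

theorem bijective_of_deriv_pos {φ : ℝ → ℝ} (hφ : Differentiable ℝ φ)
    (hpos : ∀ x, 0 < deriv φ x) {C : ℝ} (hC : ∀ x, |φ x - x| ≤ C) : Function.Bijective φ := by
  refine ⟨(strictMono_of_deriv_pos hpos).injective, hφ.continuous.surjective ?_ ?_⟩
  · refine tendsto_atTop_mono (f := fun x => x + -C) (fun x => ?_)
      (tendsto_atTop_add_const_right _ _ tendsto_id)
    have := (abs_le.1 (hC x)).1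
    linarith
  · refine tendsto_atBot_mono (f := fun x => x + C) (fun x => ?_)
      (tendsto_atBot_add_const_right _ _ tendsto_id)
    have := (abs_le.1 (hC x)).2
    linarith

theorem continuous_invFun_of_deriv_pos {φ : ℝ → ℝ} (hpos : ∀ x, 0 < deriv φ x)
    (hb : Function.Bijective φ) : Continuous (Function.invFun φ) := by
  let e := (strictMono_of_deriv_pos hpos).orderIsoOfSurjective φ hb.2
  have : Function.invFun φ = e.symm := funext fun y => hb.1 <| by
    rw [Function.rightInverse_invFun hb.2 y]
    exact (e.apply_symm_apply y).symm
  rw [this]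
  exact e.symm.continuous

theorem hasDerivAt_invFun {φ : ℝ → ℝ} (hφ : Differentiable ℝ φ)
    (hpos : ∀ x, 0 < deriv φ x) (hb : Function.Bijective φ) (y : ℝ) :
    HasDerivAt (Function.invFun φ) (deriv φ (Function.invFun φ y))⁻¹ y :=
  HasDerivAt.of_local_left_inverse (continuous_invFun_of_deriv_pos hpos hb).continuousAt
    (hφ _).hasDerivAt (hpos _).ne'
    (Eventually.of_forall fun y => Function.rightInverse_invFun hb.2 y)

/-- Evaluation at `φ x`, instead of at a general point, removes the inverse from the right-hand
side. -/
theorem deriv_comp_invFun {φ v : ℝ → ℝ} (hφ : Differentiable ℝ φ)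
    (hpos : ∀ x, 0 < deriv φ x) (hb : Function.Bijective φ) (hv : Differentiable ℝ v) (x : ℝ) :
    deriv (v ∘ Function.invFun φ) (φ x) = deriv v x / deriv φ x := by
  have h1 := hasDerivAt_invFun hφ hpos hb (φ x)
  rw [Function.leftInverse_invFun hb.1 x] at h1
  have h2 : HasDerivAt v (deriv v x) (Function.invFun φ (φ x)) := by
    rw [Function.leftInverse_invFun hb.1 x]; exact (hv x).hasDerivAt
  rw [(h2.comp (φ x) h1).deriv, div_eq_mul_inv]

theorem integral_Iic_comp_diffeo {φ : ℝ → ℝ} (hφ : Differentiable ℝ φ)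
    (hpos : ∀ x, 0 < deriv φ x) (hb : Function.Bijective φ) (F : ℝ → ℝ) (x : ℝ) :
    ∫ y in Iic (φ x), F y = ∫ y in Iic x, deriv φ y * F (φ y) := by
  have h1 : φ '' Iic x = Iic (φ x) :=
    ((strictMono_of_deriv_pos hpos).orderIsoOfSurjective φ hb.2).image_Iic x
  rw [← h1, integral_image_eq_integral_abs_deriv_smul measurableSet_Iic
    (fun y _ => (hφ y).hasDerivAt.hasDerivWithinAt) hb.1.injOn]
  simp only [abs_of_pos (hpos _), smul_eq_mul]

/-- Change of variables `y = φ(x)`: each derivative contributes `1/φ'` and the volume element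
contributes `φ'`. No integrability is needed, and the base point enters only through `φ'`. -/
theorem metricAt_eq {g h k : Pair} (hg : Differentiable ℝ g.1) (hpos : ∀ x, 0 < deriv g.1 x)
    (hb : Function.Bijective g.1) (hh : Differentiable ℝ h.1) (hk : Differentiable ℝ k.1) :
    metricAt g h k = ∫ x, deriv h.1 x * deriv k.1 x / deriv g.1 x +
      h.2 x * k.2 x * deriv g.1 x := by
  have h1 := integral_image_eq_integral_abs_deriv_smul (s := univ) (f := g.1) (f' := deriv g.1)
    MeasurableSet.univ (fun y _ => (hg y).hasDerivAt.hasDerivWithinAt) hb.1.injOn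
    (fun x => deriv (h.1 ∘ Function.invFun g.1) x * deriv (k.1 ∘ Function.invFun g.1) x +
      (h.2 ∘ Function.invFun g.1) x * (k.2 ∘ Function.invFun g.1) x)
  rw [image_univ_of_surjective hb.2, setIntegral_univ, setIntegral_univ] at h1
  refine h1.trans (integral_congr_ae (Eventually.of_forall fun x => ?_))
  have hx := (hpos x).ne'
  simp only [deriv_comp_invFun hg hpos hb hh, deriv_comp_invFun hg hpos hb hk, smul_eq_mul,
    Function.comp_apply, Function.leftInverse_invFun hb.1 x, abs_of_pos (hpos x)]
  field_simp

/-- For `h = k = (0, a)` at the identity only the derivative of the metric in the test direction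
survives. A Christoffel symbol with first component `Y` would satisfy `2Y' + a² = 0`, impossible for
`Y ∈ 𝒜` when `a ≠ 0`, because `∫ Y' = 0`. -/
theorem not_exists_isChristoffel : ¬ ∃ Γ, IsChristoffel A Γ := by
  rintro ⟨Γ, hΓ⟩
  obtain ⟨a, ha, ha0⟩ := exists_inA_ne_zero (A := A)
  have h1 : semiOne ∈ groupA A := by
    refine ⟨?_, fun x => ?_, inA_zero⟩
    · simpa [semiOne] using inA_zero (A := A)
    · simp [semiOne]
  have hh : ((fun _ => 0, a) : Pair) ∈ lieA A := ⟨inA_zero, ha⟩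
  obtain ⟨⟨hY, -⟩, hK⟩ := hΓ _ h1 _ hh _ hh
  have haa := ha.mul_bdd ha.bddDerivs
  have key : ∀ Z : ℝ → ℝ, ContDiff ℝ ∞ Z → HasCompactSupport Z →
      2 * ∫ x, deriv (Γ semiOne (fun _ => 0, a) (fun _ => 0, a)).1 x * deriv Z x =
        - ∫ x, a x * a x * deriv Z x := fun Z hZ hc => by
    have hZA : InA A Z := inA_of_hasCompactSupport hZ hc
    have dZ := (contDiff_infty_iff_deriv.1 hZ).1
    have h2 := hK (Z, fun _ => 0) ⟨hZA, inA_zero⟩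
    -- Moving the base point in the direction `(0, a)` leaves `φ` unchanged, and the metric does not
    -- depend on `α`.
    have h3 : ∀ k m : Pair, metricDeriv semiOne (fun _ => 0, a) k m = 0 := fun k m => by
      have : (fun s : ℝ => metricAt (semiOne + s • ((fun _ => 0, a) : Pair)) k m) =
          fun _ => metricAt semiOne k m := funext fun s => by
        have : (semiOne + s • ((fun _ => 0, a) : Pair)).1 = semiOne.1 := by
          ext x; simp [semiOne]
        simp only [metricAt, semiInv, tangentRightMul, this]
      rw [metricDeriv, this, deriv_const]
    have h4 : metricAt semiOne (Γ semiOne (fun _ => 0, a) (fun _ => 0, a)) (Z, fun _ => 0) =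
        ∫ x, deriv (Γ semiOne (fun _ => 0, a) (fun _ => 0, a)).1 x * deriv Z x := by
      rw [metricAt_eq (by simpa [semiOne] using differentiable_id) (by simp [semiOne])
        (by simpa [semiOne] using Function.bijective_id) (contDiff_infty_iff_deriv.1 hY.1).1 dZ]
      simp [semiOne]
    obtain ⟨B, hB⟩ := hZA.bddDerivs.exists_bound
    obtain ⟨C, hC⟩ := hZA.deriv.bddDerivs.exists_bound
    have h5 : metricDeriv semiOne (Z, fun _ => 0) (fun _ => 0, a) (fun _ => 0, a) =
        ∫ x, a x * a x * deriv Z x := by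
      -- For such `s` the map `Id + sZ` is still a diffeomorphism, and `metricAt_eq` shows that the
      -- metric coefficient is affine in `s`.
      have hs : ∀ᶠ s : ℝ in 𝓝 0, |s| * C < 1 := by
        have : Tendsto (fun s : ℝ => |s| * C) (𝓝 0) (𝓝 (|0| * C)) :=
          (continuous_abs.mul (continuous_const (y := C))).tendsto 0
        rw [abs_zero, zero_mul] at this
        exact this.eventually_lt_const one_pos
      have h6 : HasDerivAt (fun s : ℝ => (∫ x, a x * a x) + s * ∫ x, a x * a x * deriv Z x)
          (∫ x, a x * a x * deriv Z x) 0 := by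
        simpa using ((hasDerivAt_id (0 : ℝ)).mul_const (∫ x, a x * a x * deriv Z x)).const_add
          (∫ x, a x * a x)
      refine (h6.congr_of_eventuallyEq ?_).deriv
      filter_upwards [hs] with s hs
      have e : (semiOne + s • ((Z, fun _ => 0) : Pair)).1 = fun x => x + s * Z x := by
        ext x; simp [semiOne]
      have d : ∀ x, HasDerivAt (fun x => x + s * Z x) (1 + s * deriv Z x) x := fun x =>
        (hasDerivAt_id x).add ((dZ x).hasDerivAt.const_mul s)
      have hpos : ∀ x, 0 < deriv (fun x => x + s * Z x) x := fun x => by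
        rw [(d x).deriv]
        have : |s * deriv Z x| ≤ |s| * C := by
          rw [abs_mul]; gcongr; exact hC x
        linarith [neg_abs_le (s * deriv Z x)]
      rw [metricAt_eq]
      · rw [e]
        simp only [(d _).deriv, deriv_const, mul_zero, zero_div, zero_add]
        rw [← integral_const_mul, ← integral_add haa.integrable
          ((haa.mul_bdd hZA.bddDerivs.deriv).integrable.const_mul s)]
        exact integral_congr_ae (Eventually.of_forall fun x => by simp only []; ring)
      · rw [e]; exact fun x => (d x).differentiableAt
      · rw [e]; exact hpos
      · rw [e]
        refine bijective_of_deriv_pos (fun x => (d x).differentiableAt) hpos (C := |s| * B)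
          fun x => ?_
        rw [add_sub_cancel_left, abs_mul]; gcongr; exact hB x
      · exact differentiable_const _
      · exact differentiable_const _
    rw [h3, h4, h5] at h2
    rw [h2]; ring
  have hw := (hY.deriv.mul_const 2).add haa
  have hw0 := hw.eq_zero_of_integral_mul_deriv fun Z hZ hc => by
    have hZA : InA A Z := inA_of_hasCompactSupport hZ hc
    have h2 := integral_add ((hY.deriv.mul_bdd hZA.bddDerivs.deriv).integrable.const_mul 2)
      (haa.mul_bdd hZA.bddDerivs.deriv).integrable
    rw [integral_const_mul, key Z hZ hc, neg_add_cancel] at h2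
    refine Eq.trans (integral_congr_ae (Eventually.of_forall fun x => ?_)) h2
    simp only []; ring
  have h2 := integral_add (hY.deriv.mul_const 2).integrable haa.integrable
  rw [integral_mul_const, hY.integral_deriv, zero_mul, zero_add,
    integral_congr_ae (g := fun _ => 0) (Eventually.of_forall fun x => congrFun hw0 x),
    integral_zero] at h2
  have h3 := (eq_zero_of_integral_sq_add_sq (inA_zero (A := A)) ha (by
    refine Eq.trans (integral_congr_ae (Eventually.of_forall fun x => ?_)) h2.symm
    simp only []; ring)).2
  simp [h3] at ha0

theorem not_isRobustA : ¬ IsRobustA A := fun ⟨⟨Γ, hΓ, _⟩, _⟩ => not_exists_isChristoffel ⟨Γ, hΓ⟩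

end

/-! ### Calculus of smooth families in `𝒜`. -/

section

section Smooth

variable {A : DecayClass}
variable {P : Type*} [NormedAddCommGroup P] [NormedSpace ℝ P]
variable {P' : Type*} [NormedAddCommGroup P'] [NormedSpace ℝ P']
variable {U : Set P} {f g : P → ℝ → ℝ}

theorem iteratedFDeriv_continuousOn {E : Type*} [NormedAddCommGroup E] [NormedSpace ℝ E]
    {S : Set E} {F : E → ℝ} (hF : ContDiffOn ℝ ∞ F S) (hS : IsOpen S) (n : ℕ) :
    ContinuousOn (iteratedFDeriv ℝ n F) S :=
  (hF.continuousOn_iteratedFDerivWithin (by exact_mod_cast le_top) hS.uniqueDiffOn).congr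
    fun x hx => (iteratedFDerivWithin_of_isOpen n hS hx).symm

theorem continuous_slice {X Y : Type*} [TopologicalSpace X] [TopologicalSpace Y] {V : Set X}
    {F : X × ℝ → Y} (hF : ContinuousOn F (V ×ˢ univ)) {p : X} (hp : p ∈ V) : Continuous fun x => F (p, x) :=
  hF.comp_continuous (by fun_prop) fun _ => ⟨hp, mem_univ _⟩

/-- Decay passes from `f` to `g` if the derivatives of `g` are bounded by those of `f`. -/
theorem IsSmoothInA.transfer [LocallyCompactSpace P] {U' : Set P'} {g : P' → ℝ → ℝ}
    (hU : IsOpen U) (hU' : IsOpen U') (hf : IsSmoothInA A U f)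
    {π : P' → P} (hπ : Continuous π) (hm : MapsTo π U' U)
    (hg : ContDiffOn ℝ ∞ (fun q : P' × ℝ => g q.1 q.2) (U' ×ˢ univ))
    (hsupp : ∀ p ∈ U', ∀ x, (∀ᶠ q : P × ℝ in 𝓝 (π p, x), f q.1 q.2 = 0) → g p x = 0)
    (hd : ∀ n : ℕ, ∃ (m : ℕ) (c : ℝ), 0 ≤ c ∧ ∀ p ∈ U', ∀ x,
      ‖iteratedFDeriv ℝ n (fun q : P' × ℝ => g q.1 q.2) (p, x)‖ ≤
        c * ‖iteratedFDeriv ℝ m (fun q : P × ℝ => f q.1 q.2) (π p, x)‖) :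
    IsSmoothInA A U' g := by
  refine ⟨hg, fun K hK hKU => ?_⟩
  obtain ⟨hfs, hfd⟩ := hf
  have hK' : IsCompact (π '' K) := hK.image hπ
  have hKU' : π '' K ⊆ U := by rintro _ ⟨p, hp, rfl⟩; exact hm (hKU hp)
  cases A with
  | compactSupport =>
    -- Enlarging the compact set to a neighbourhood turns vanishing over the compact set into
    -- vanishing near `(π p, x)`, as required to annihilate derivatives in the parameter too.
    obtain ⟨L, hL, hKL, hLU⟩ := exists_compact_between hK' hU hKU'
    obtain ⟨R, hR⟩ := hfd L hL hLU
    refine ⟨R, fun p hp x hx => hsupp p (hKU hp) x ?_⟩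
    have h1 : ∀ᶠ q : P × ℝ in 𝓝 (π p, x), q.1 ∈ L :=
      continuous_fst.continuousAt.eventually_mem
        (mem_of_superset (isOpen_interior.mem_nhds (hKL ⟨p, hp, rfl⟩)) interior_subset)
    have h2 : ∀ᶠ q : P × ℝ in 𝓝 (π p, x), R < |q.2| :=
      (continuous_snd.abs.tendsto (π p, x)).eventually_const_lt hx
    filter_upwards [h1, h2] with q hq1 hq2 using hR _ hq1 _ hq2
  | schwartz =>
    intro m n
    obtain ⟨k, c, hc, hk⟩ := hd n
    obtain ⟨C, hC⟩ := hfd _ hK' hKU' m k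
    refine ⟨c * C, fun p hp x => ?_⟩
    calc _ ≤ |x| ^ m * (c * ‖iteratedFDeriv ℝ k (fun q : P × ℝ => f q.1 q.2) (π p, x)‖) := by
          gcongr; exact hk p (hKU hp) x
      _ = c * (|x| ^ m * ‖iteratedFDeriv ℝ k (fun q : P × ℝ => f q.1 q.2) (π p, x)‖) := by ring
      _ ≤ c * C := by gcongr; exact hC _ ⟨p, hp, rfl⟩ x
  | sobolev =>
    intro n
    obtain ⟨k, c, hc, hk⟩ := hd n
    obtain ⟨C, hC⟩ := hfd _ hK' hKU' k
    refine ⟨c * C, fun p hp => ?_⟩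
    obtain ⟨hi, hb⟩ := hC _ ⟨p, hp, rfl⟩
    have hi' : Integrable (fun x : ℝ =>
        ‖iteratedFDeriv ℝ n (fun q : P' × ℝ => g q.1 q.2) (p, x)‖) := by
      refine (hi.const_mul c).mono' ?_ (Eventually.of_forall fun x => ?_)
      · exact (continuous_slice (iteratedFDeriv_continuousOn hg (hU'.prod isOpen_univ) n)
          (hKU hp)).norm.aestronglyMeasurable
      · rw [norm_norm]; exact hk p (hKU hp) x
    refine ⟨hi', (integral_mono hi' (hi.const_mul c) fun x => hk p (hKU hp) x).trans ?_⟩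
    rw [integral_const_mul]
    gcongr

theorem contDiffOn_fderiv_apply {E : Type*} [NormedAddCommGroup E] [NormedSpace ℝ E]
    {S : Set E} {F : E → ℝ} (hF : ContDiffOn ℝ ∞ F S) (hS : IsOpen S) (v : E) :
    ContDiffOn ℝ ∞ (fun q => fderiv ℝ F q v) S :=
  (hF.fderiv_of_isOpen hS (m := ∞) (by simp)).clm_apply contDiffOn_const

/-- `IsSmoothInA` is closed under directional derivatives. -/
theorem IsSmoothInA.fderiv_apply [LocallyCompactSpace P] (hU : IsOpen U)
    (hf : IsSmoothInA A U f) (v : P × ℝ) :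
    IsSmoothInA A U (fun p x => fderiv ℝ (fun q : P × ℝ => f q.1 q.2) (p, x) v) := by
  refine hf.transfer hU hU continuous_id (mapsTo_id _)
    (contDiffOn_fderiv_apply hf.1 (hU.prod isOpen_univ) v) (fun p _ x h => ?_) fun n =>
    ⟨n + 1, ‖ContinuousLinearMap.apply ℝ ℝ v‖,
      ContinuousLinearMap.opNorm_nonneg _, fun p hp x => ?_⟩
  · have h' : (fun q : P × ℝ => f q.1 q.2) =ᶠ[𝓝 (p, x)] fun _ => 0 := h
    rw [h'.fderiv_eq]; simp
  · rw [id, ← norm_iteratedFDeriv_fderiv]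
    have h1 : ContDiffAt ℝ ∞ (fderiv ℝ (fun q : P × ℝ => f q.1 q.2)) (p, x) :=
      (hf.1.fderiv_of_isOpen (hU.prod isOpen_univ) (m := ∞) (by simp)).contDiffAt
        ((hU.prod isOpen_univ).mem_nhds ⟨hp, mem_univ _⟩)
    exact (ContinuousLinearMap.apply ℝ ℝ v).norm_iteratedFDeriv_comp_left h1
      (by exact_mod_cast le_top)

/-- `IsSmoothInA` is closed under linear substitutions of the parameter. -/
theorem IsSmoothInA.comp_clm [LocallyCompactSpace P] {U' : Set P'} (hU : IsOpen U)
    (hU' : IsOpen U') (hf : IsSmoothInA A U f) (π : P' →L[ℝ] P) (hm : MapsTo π U' U) :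
    IsSmoothInA A U' (fun p => f (π p)) := by
  let l : P' × ℝ →L[ℝ] P × ℝ := π.prodMap (ContinuousLinearMap.id ℝ ℝ)
  have hS := hU.prod (isOpen_univ (X := ℝ))
  have hS' := hU'.prod (isOpen_univ (X := ℝ))
  have hml : MapsTo l (U' ×ˢ univ) (U ×ˢ univ) := fun q hq => ⟨hm hq.1, mem_univ _⟩
  refine hf.transfer hU hU' π.continuous hm (hf.1.comp l.contDiff.contDiffOn hml)
    (fun p _ x h => h.self_of_nhds) fun n => ⟨n, ‖l‖ ^ n, by positivity, fun p hp x => ?_⟩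
  have hpre : IsOpen (l ⁻¹' (U ×ˢ univ)) := hS.preimage l.continuous
  have hmem : l (p, x) ∈ U ×ˢ (univ : Set ℝ) := hml ⟨hp, mem_univ _⟩
  have h1 := l.iteratedFDerivWithin_comp_right hf.1 hS.uniqueDiffOn hpre.uniqueDiffOn hmem
    (i := n) (by exact_mod_cast le_top)
  rw [iteratedFDerivWithin_of_isOpen n hpre hmem, iteratedFDerivWithin_of_isOpen n hS hmem] at h1
  have h2 := ContinuousMultilinearMap.norm_compContinuousLinearMap_le
    (iteratedFDeriv ℝ n (fun q : P × ℝ => f q.1 q.2) (l (p, x))) (fun _ => l)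
  rw [← h1, Finset.prod_const, Finset.card_univ, Fintype.card_fin, mul_comm] at h2
  exact h2

protected theorem IsSmoothInA.add (hU : IsOpen U) (hf : IsSmoothInA A U f) (hg : IsSmoothInA A U g) :
    IsSmoothInA A U (fun p x => f p x + g p x) := by
  have hS := hU.prod (isOpen_univ (X := ℝ))
  have hc := hf.1.add hg.1
  have hsum : ∀ n : ℕ, ∀ p ∈ U, ∀ x,
      ‖iteratedFDeriv ℝ n (fun q : P × ℝ => f q.1 q.2 + g q.1 q.2) (p, x)‖ ≤
      ‖iteratedFDeriv ℝ n (fun q : P × ℝ => f q.1 q.2) (p, x)‖ +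
      ‖iteratedFDeriv ℝ n (fun q : P × ℝ => g q.1 q.2) (p, x)‖ := fun n p hp x => by
    have hq : U ×ˢ univ ∈ 𝓝 (p, x) := hS.mem_nhds ⟨hp, mem_univ _⟩
    have h1 := iteratedFDeriv_add_apply (i := n)
      ((hf.1.contDiffAt hq).of_le (by exact_mod_cast le_top))
      ((hg.1.contDiffAt hq).of_le (by exact_mod_cast le_top))
    have h2 := norm_add_le (iteratedFDeriv ℝ n (fun q : P × ℝ => f q.1 q.2) (p, x))
      (iteratedFDeriv ℝ n (fun q : P × ℝ => g q.1 q.2) (p, x))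
    rw [← h1] at h2
    exact h2
  refine ⟨hc, fun K hK hKU => ?_⟩
  obtain ⟨hfs, hfd⟩ := hf
  obtain ⟨hgs, hgd⟩ := hg
  cases A with
  | compactSupport =>
    obtain ⟨R, hR⟩ := hfd K hK hKU
    obtain ⟨S, hS⟩ := hgd K hK hKU
    refine ⟨max R S, fun p hp x hx => ?_⟩
    simp only [hR p hp x ((le_max_left _ _).trans_lt hx), hS p hp x ((le_max_right _ _).trans_lt hx),
      add_zero]
  | schwartz =>
    intro m n
    obtain ⟨C, hC⟩ := hfd K hK hKU m n
    obtain ⟨D, hD⟩ := hgd K hK hKU m n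
    refine ⟨C + D, fun p hp x => ?_⟩
    refine (mul_le_mul_of_nonneg_left (hsum n p (hKU hp) x) (by positivity)).trans ?_
    rw [mul_add]
    exact add_le_add (hC p hp x) (hD p hp x)
  | sobolev =>
    intro n
    obtain ⟨C, hC⟩ := hfd K hK hKU n
    obtain ⟨D, hD⟩ := hgd K hK hKU n
    refine ⟨C + D, fun p hp => ?_⟩
    obtain ⟨hi, hb⟩ := hC p hp
    obtain ⟨hi', hb'⟩ := hD p hp
    have hi'' : Integrable (fun x : ℝ =>
        ‖iteratedFDeriv ℝ n (fun q : P × ℝ => f q.1 q.2 + g q.1 q.2) (p, x)‖) := by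
      refine (hi.add hi').mono' ?_ (Eventually.of_forall fun x => ?_)
      · exact (continuous_slice (iteratedFDeriv_continuousOn hc hS n)
          (hKU hp)).norm.aestronglyMeasurable
      · rw [norm_norm]; exact hsum n p (hKU hp) x
    refine ⟨hi'', (integral_mono hi'' (hi.add hi') fun x => hsum n p (hKU hp) x).trans ?_⟩
    simp only [Pi.add_apply]
    rw [integral_add hi hi']
    gcongr

/-- Jointly smooth functions with uniformly bounded supports are smooth maps to `𝒜`. -/
theorem isSmoothInA_of_support (hf : ContDiff ℝ ∞ (fun q : P × ℝ => f q.1 q.2)) {R : ℝ}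
    (hR : ∀ p x, R < |x| → f p x = 0) : IsSmoothInA A U f := by
  refine ⟨hf.contDiffOn, fun K hK _ => ?_⟩
  have h0 : ∀ (n : ℕ) p x, R < |x| →
      iteratedFDeriv ℝ n (fun q : P × ℝ => f q.1 q.2) (p, x) = 0 := fun n p x hx => by
    have h1 : (fun q : P × ℝ => f q.1 q.2) =ᶠ[𝓝 (p, x)] fun _ => 0 := by
      have h2 : ∀ᶠ q : P × ℝ in 𝓝 (p, x), R < |q.2| :=
        (continuous_snd.abs.tendsto (p, x)).eventually_const_lt hx
      filter_upwards [h2] with q hq using hR _ _ hq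
    rw [(h1.iteratedFDeriv ℝ n).self_of_nhds, iteratedFDeriv_fun_zero, Pi.zero_apply]
  have hc : ∀ n : ℕ, Continuous (iteratedFDeriv ℝ n (fun q : P × ℝ => f q.1 q.2)) := fun n =>
    hf.continuous_iteratedFDeriv (by exact_mod_cast le_top)
  have hbd : ∀ F : P × ℝ → ℝ, Continuous F → (∀ p x, R < |x| → F (p, x) = 0) →
      ∃ C, 0 ≤ C ∧ ∀ p ∈ K, ∀ x, |F (p, x)| ≤ C := fun F hF hF0 => by
    obtain ⟨C, hC⟩ := (hK.prod (isCompact_Icc (a := -R) (b := R))).exists_bound_of_continuousOn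
      hF.continuousOn
    refine ⟨max C 0, le_max_right _ _, fun p hp x => ?_⟩
    by_cases hx : R < |x|
    · rw [hF0 p x hx, abs_zero]; exact le_max_right _ _
    · exact (hC (p, x) ⟨hp, abs_le.1 (not_lt.1 hx)⟩).trans (le_max_left _ _)
  cases A with
  | compactSupport => exact ⟨R, fun p _ x hx => hR p x hx⟩
  | schwartz =>
    intro m n
    obtain ⟨C, -, hC⟩ := hbd
      (fun q => |q.2| ^ m * ‖iteratedFDeriv ℝ n (fun q : P × ℝ => f q.1 q.2) q‖)
      ((continuous_snd.abs.pow m).mul (hc n).norm) (fun p x hx => by simp [h0 n p x hx])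
    exact ⟨C, fun p hp x => (le_abs_self _).trans (hC p hp x)⟩
  | sobolev =>
    intro n
    obtain ⟨C, hC0, hC⟩ := hbd
      (fun q => ‖iteratedFDeriv ℝ n (fun q : P × ℝ => f q.1 q.2) q‖)
      (hc n).norm (fun p x hx => by simp [h0 n p x hx])
    have hi : Integrable ((Icc (-R) R).indicator fun _ : ℝ => C) :=
      (integrable_indicator_iff measurableSet_Icc).2
        (integrableOn_const (by simp) (by simp))
    refine ⟨∫ x, (Icc (-R) R).indicator (fun _ : ℝ => C) x, fun p hp => ?_⟩
    have hle : ∀ x, ‖iteratedFDeriv ℝ n (fun q : P × ℝ => f q.1 q.2) (p, x)‖ ≤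
        (Icc (-R) R).indicator (fun _ : ℝ => C) x := fun x => by
      by_cases hx : R < |x|
      · rw [h0 n p x hx, norm_zero]; exact indicator_nonneg (fun _ _ => hC0) x
      · rw [indicator_of_mem (show x ∈ Icc (-R) R from abs_le.1 (not_lt.1 hx))]
        exact (le_abs_self _).trans (hC p hp x)
    have hi' : Integrable (fun x : ℝ =>
        ‖iteratedFDeriv ℝ n (fun q : P × ℝ => f q.1 q.2) (p, x)‖) :=
      hi.mono' ((hc n).comp (by fun_prop : Continuous fun x : ℝ => (p, x))).norm.aestronglyMeasurable
        (Eventually.of_forall fun x => by rw [norm_norm]; exact hle x)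
    exact ⟨hi', integral_mono hi' hi hle⟩

end Smooth

end

/-! ### Locally uniform domination, decay and bounds for families with two parameters. -/

section

/-- On `K × ℝ` the function `F` is dominated by an integrable function of the second variable. -/
def DomOn {X : Type*} (K : Set X) (F : X × ℝ → ℝ) : Prop :=
  ∃ h : ℝ → ℝ, Integrable h ∧ ∀ p ∈ K, ∀ x, |F (p, x)| ≤ h x

/-- `F` is bounded on `K × ℝ`. -/
def BddOn {X : Type*} (K : Set X) (F : X × ℝ → ℝ) : Prop :=
  ∃ C : ℝ, ∀ p ∈ K, ∀ x, |F (p, x)| ≤ C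

section Dom

variable {X : Type*} {K L : Set X} {F G : X × ℝ → ℝ}

theorem DomOn.add (hF : DomOn K F) (hG : DomOn K G) : DomOn K fun q => F q + G q := by
  obtain ⟨h, hi, hb⟩ := hF
  obtain ⟨k, ki, kb⟩ := hG
  exact ⟨fun x => h x + k x, hi.add ki, fun p hp x =>
    (abs_add_le _ _).trans (add_le_add (hb p hp x) (kb p hp x))⟩

theorem DomOn.mul_bdd (hF : DomOn K F) (hG : BddOn K G) : DomOn K fun q => F q * G q := by
  obtain ⟨h, hi, hb⟩ := hF
  obtain ⟨C, hC⟩ := hG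
  refine ⟨fun x => h x * C, hi.mul_const C, fun p hp x => ?_⟩
  rw [abs_mul]
  exact mul_le_mul (hb p hp x) (hC p hp x) (abs_nonneg _) ((abs_nonneg _).trans (hb p hp x))

theorem DomOn.mono (hF : DomOn L F) (h : K ⊆ L) : DomOn K F :=
  let ⟨k, hi, hb⟩ := hF; ⟨k, hi, fun p hp => hb p (h hp)⟩

theorem BddOn.mul (hF : BddOn K F) (hG : BddOn K G) : BddOn K fun q => F q * G q := by
  obtain ⟨C, hC⟩ := hF
  obtain ⟨D, hD⟩ := hG
  refine ⟨C * D, fun p hp x => ?_⟩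
  rw [abs_mul]
  exact mul_le_mul (hC p hp x) (hD p hp x) (abs_nonneg _) ((abs_nonneg _).trans (hC p hp x))

theorem BddOn.add (hF : BddOn K F) (hG : BddOn K G) : BddOn K fun q => F q + G q := by
  obtain ⟨C, hC⟩ := hF
  obtain ⟨D, hD⟩ := hG
  exact ⟨C + D, fun p hp x => (abs_add_le _ _).trans (add_le_add (hC p hp x) (hD p hp x))⟩

theorem bddOn_const (c : ℝ) : BddOn K fun _ => c := ⟨|c|, fun _ _ _ => le_rfl⟩

theorem DomOn.neg (hF : DomOn K F) : DomOn K fun q => -F q := by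
  simpa using hF.mul_bdd (bddOn_const (-1))

theorem DomOn.sub (hF : DomOn K F) (hG : DomOn K G) : DomOn K fun q => F q - G q := by
  simpa [sub_eq_add_neg] using hF.add hG.neg

theorem DomOn.integrable_slice (hF : DomOn K F) {p : X} (hp : p ∈ K)
    (hc : Continuous fun x => F (p, x)) : Integrable fun x => F (p, x) :=
  let ⟨_, hi, hb⟩ := hF
  hi.mono' hc.aestronglyMeasurable (Eventually.of_forall fun x => hb p hp x)

end Dom

/-- A one-dimensional Sobolev inequality on the interval `[c - r, c + r]`. -/
theorem abs_le_setIntegral_of_hasDerivAt {g g' : ℝ → ℝ} {c r : ℝ} (hr : 0 < r)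
    (hg : ∀ y ∈ Icc (c - r) (c + r), HasDerivAt g (g' y) y)
    (hg' : ContinuousOn g' (Icc (c - r) (c + r))) {y : ℝ} (hy : y ∈ Icc (c - r) (c + r)) :
    |g y| ≤ ∫ z in Icc (c - r) (c + r), ((2 * r)⁻¹ * |g z| + |g' z|) := by
  have hgc : ContinuousOn g (Icc (c - r) (c + r)) := fun y hy =>
    (hg y hy).continuousAt.continuousWithinAt
  have hi : IntegrableOn (fun z => |g z|) (Icc (c - r) (c + r)) :=
    hgc.abs.integrableOn_compact isCompact_Icc
  have hi' : IntegrableOn (fun z => |g' z|) (Icc (c - r) (c + r)) :=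
    hg'.abs.integrableOn_compact isCompact_Icc
  -- The fundamental theorem of calculus bounds `|g y|` by `|g z|` plus the integral of `|g'|`;
  -- averaging over `z` in the interval of length `2r` gives the claim.
  have h1 : ∀ z ∈ Icc (c - r) (c + r), |g y| ≤ |g z| + ∫ w in Icc (c - r) (c + r), |g' w| :=
    fun z hz => by
    have hsub : uIcc z y ⊆ Icc (c - r) (c + r) := ordConnected_Icc.uIcc_subset hz hy
    have h2 : ∫ w in z..y, g' w = g y - g z :=
      intervalIntegral.integral_eq_sub_of_hasDerivAt (fun w hw => hg w (hsub hw))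
        (hg'.mono hsub).intervalIntegrable
    have h3 : |∫ w in z..y, g' w| ≤ ∫ w in Icc (c - r) (c + r), |g' w| := by
      refine (intervalIntegral.norm_integral_le_integral_norm_uIoc (f := g')).trans ?_
      exact setIntegral_mono_set hi' (Eventually.of_forall fun _ => abs_nonneg _)
        (uIoc_subset_uIcc.trans hsub).eventuallyLE
    rw [h2] at h3
    linarith [abs_sub_abs_le_abs_sub (g y) (g z)]
  have hv : volume.real (Icc (c - r) (c + r)) = 2 * r := by
    rw [Real.volume_real_Icc_of_le (by linarith)]; ring
  have hconst : ∀ a : ℝ, IntegrableOn (fun _ => a) (Icc (c - r) (c + r)) := fun a =>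
    integrableOn_const (by simp) (by simp)
  have h4 : ∫ _ in Icc (c - r) (c + r), |g y| ≤
      ∫ z in Icc (c - r) (c + r), (|g z| + ∫ w in Icc (c - r) (c + r), |g' w|) :=
    setIntegral_mono_on (hconst _) (hi.add (hconst _)) measurableSet_Icc h1
  rw [setIntegral_const, integral_add hi (hconst _), setIntegral_const, hv, smul_eq_mul,
    smul_eq_mul] at h4
  rw [integral_add (hi.const_mul _) hi', integral_const_mul]
  rw [inv_mul_eq_div, ← sub_le_iff_le_add, le_div_iff₀ (by positivity)]
  linarith

section Plane

variable {A : DecayClass} {U : Set (ℝ × ℝ)} {f : ℝ × ℝ → ℝ → ℝ}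

/-- The derivative of `f` in direction `v`. -/
def dir {P : Type*} [NormedAddCommGroup P] [NormedSpace ℝ P] (f : P → ℝ → ℝ) (v : P × ℝ) :
    P → ℝ → ℝ :=
  fun p x => fderiv ℝ (fun q : P × ℝ => f q.1 q.2) (p, x) v

theorem hasDerivAt_line {P : Type*} [NormedAddCommGroup P] [NormedSpace ℝ P] {U : Set P}
    {f : P → ℝ → ℝ} (hU : IsOpen U)
    (hf : ContDiffOn ℝ ∞ (fun q : P × ℝ => f q.1 q.2) (U ×ˢ univ)) {γ : ℝ → P × ℝ} {v : P × ℝ}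
    {t : ℝ} (hγ : HasDerivAt γ v t) (ht : (γ t).1 ∈ U) :
    HasDerivAt (fun τ => f (γ τ).1 (γ τ).2) (dir f v (γ t).1 (γ t).2) t := by
  have h1 : DifferentiableAt ℝ (fun q : P × ℝ => f q.1 q.2) (γ t) :=
    (hf.contDiffAt ((hU.prod isOpen_univ).mem_nhds ⟨ht, mem_univ _⟩)).differentiableAt (by simp)
  exact h1.hasFDerivAt.comp_hasDerivAt t hγ

theorem hasDerivAt_dir_fst (hU : IsOpen U)
    (hf : ContDiffOn ℝ ∞ (fun q : (ℝ × ℝ) × ℝ => f q.1 q.2) (U ×ˢ univ)) {s t : ℝ}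
    (h : (s, t) ∈ U) (x : ℝ) :
    HasDerivAt (fun σ => f (σ, t) x) (dir f ((1, 0), 0) (s, t) x) s :=
  hasDerivAt_line (γ := fun σ => ((σ, t), x)) hU hf
    (((hasDerivAt_id s).prodMk (hasDerivAt_const s t)).prodMk (hasDerivAt_const s x)) h

theorem hasDerivAt_dir_snd (hU : IsOpen U)
    (hf : ContDiffOn ℝ ∞ (fun q : (ℝ × ℝ) × ℝ => f q.1 q.2) (U ×ˢ univ)) {s t : ℝ}
    (h : (s, t) ∈ U) (x : ℝ) :
    HasDerivAt (fun τ => f (s, τ) x) (dir f ((0, 1), 0) (s, t) x) t :=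
  hasDerivAt_line (γ := fun τ => ((s, τ), x)) hU hf
    (((hasDerivAt_const t s).prodMk (hasDerivAt_id t)).prodMk (hasDerivAt_const t x)) h

theorem hasDerivAt_dir_space {P : Type*} [NormedAddCommGroup P] [NormedSpace ℝ P] {U : Set P}
    {f : P → ℝ → ℝ} (hU : IsOpen U)
    (hf : ContDiffOn ℝ ∞ (fun q : P × ℝ => f q.1 q.2) (U ×ˢ univ)) {p : P} (h : p ∈ U) (x : ℝ) :
    HasDerivAt (f p) (dir f (0, 1) p x) x :=
  hasDerivAt_line (γ := fun y => (p, y)) hU hf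
    ((hasDerivAt_const x p).prodMk (hasDerivAt_id x)) h

protected theorem IsSmoothInA.dir {P : Type*} [NormedAddCommGroup P] [NormedSpace ℝ P]
    [LocallyCompactSpace P] {U : Set P} {f : P → ℝ → ℝ} (hf : IsSmoothInA A U f) (hU : IsOpen U)
    (v : P × ℝ) : IsSmoothInA A U (dir f v) := hf.fderiv_apply hU v

theorem IsSmoothInA.continuousOn {P : Type*} [NormedAddCommGroup P] [NormedSpace ℝ P]
    {U : Set P} {f : P → ℝ → ℝ} (hf : IsSmoothInA A U f) :
    ContinuousOn (fun q : P × ℝ => f q.1 q.2) (U ×ˢ univ) := hf.1.continuousOn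

/-- Tonelli: the `L¹` norms in `x` are bounded uniformly on the compact parameter set, which has
finite measure. -/
theorem integrable_abs_of_isSmoothInA_sobolev (hf : IsSmoothInA .sobolev U f) {K : Set (ℝ × ℝ)}
    (hK : IsCompact K) (hKU : K ⊆ U) :
    Integrable (fun q : (ℝ × ℝ) × ℝ => |f q.1 q.2|) ((volume.restrict K).prod volume) := by
  have hKm := hK.measurableSet
  have hm : AEStronglyMeasurable (fun q : (ℝ × ℝ) × ℝ => |f q.1 q.2|)
      ((volume.restrict K).prod volume) := by
    have h1 : ContinuousOn (fun q : (ℝ × ℝ) × ℝ => |f q.1 q.2|) (K ×ˢ univ) :=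
      (hf.continuousOn.mono (prod_mono hKU Subset.rfl)).abs
    have h2 := h1.aestronglyMeasurable (μ := volume) (hKm.prod MeasurableSet.univ)
    rwa [Measure.volume_eq_prod, ← Measure.prod_restrict, Measure.restrict_univ] at h2
  obtain ⟨C, hC⟩ := hf.2 K hK hKU 0
  simp only [norm_iteratedFDeriv_zero] at hC
  have hfin : IsFiniteMeasure (volume.restrict K) := ⟨by simpa using hK.measure_lt_top⟩
  refine (integrable_prod_iff hm).2 ⟨?_, ?_⟩
  · exact (ae_restrict_iff' hKm).2 (Eventually.of_forall fun p hp => (hC p hp).1)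
  · refine (integrable_const C).mono' hm.norm.integral_prod_right' ?_
    refine (ae_restrict_iff' hKm).2 (Eventually.of_forall fun p hp => ?_)
    rw [Real.norm_of_nonneg (integral_nonneg fun _ => norm_nonneg _)]
    simpa using (hC p hp).2

/-- Uniform `L¹` bounds alone give no common dominating function. The one-dimensional Sobolev
inequality, applied in each parameter in turn, bounds `|f p x|` by an integral over a parameter box
of `f` and its first and mixed parameter derivatives. By Fubini that integral is integrable in `x`.
-/
theorem exists_domOn_nhds_sobolev (hU : IsOpen U) (hf : IsSmoothInA .sobolev U f) {p : ℝ × ℝ}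
    (hp : p ∈ U) : ∃ N ∈ 𝓝 p, DomOn N (fun q => f q.1 q.2) := by
  obtain ⟨s, t⟩ := p
  obtain ⟨r, hr, hrU⟩ := Metric.nhds_basis_closedBall.mem_iff.1 (hU.mem_nhds hp)
  have hB : Metric.closedBall (s, t) r = Icc (s - r) (s + r) ×ˢ Icc (t - r) (t + r) := by
    rw [← closedBall_prod_same, Real.closedBall_eq_Icc, Real.closedBall_eq_Icc]
  refine ⟨Metric.closedBall (s, t) r, Metric.closedBall_mem_nhds _ hr, ?_⟩
  rw [hB] at hrU ⊢
  set I := Icc (s - r) (s + r)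
  set J := Icc (t - r) (t + r)
  have hcI : IsCompact I := isCompact_Icc
  have hcJ : IsCompact J := isCompact_Icc
  have hcB : IsCompact (I ×ˢ J) := hcI.prod hcJ
  have hs := hf.dir hU ((1, 0), 0)
  have ht := hf.dir hU ((0, 1), 0)
  have hst := hs.dir hU ((0, 1), 0)
  set a := (2 * r)⁻¹
  have ha : 0 ≤ a := by positivity
  -- The integrand left by the two successive inequalities, with `a = 1/(2r)` from averaging over an
  -- interval of length `2r`.
  let H : (ℝ × ℝ) × ℝ → ℝ := fun q =>
    a * (a * |f q.1 q.2| + |dir f ((0, 1), 0) q.1 q.2|) +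
      (a * |dir f ((1, 0), 0) q.1 q.2| + |dir (dir f ((1, 0), 0)) ((0, 1), 0) q.1 q.2|)
  have hH : Integrable H ((volume.restrict (I ×ˢ J)).prod volume) :=
    ((((integrable_abs_of_isSmoothInA_sobolev hf hcB hrU).const_mul a).add
      (integrable_abs_of_isSmoothInA_sobolev ht hcB hrU)).const_mul a).add
      (((integrable_abs_of_isSmoothInA_sobolev hs hcB hrU).const_mul a).add
      (integrable_abs_of_isSmoothInA_sobolev hst hcB hrU))
  have hHc : ContinuousOn H (U ×ˢ univ) :=
    (continuousOn_const.mul ((continuousOn_const.mul hf.continuousOn.abs).add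
      ht.continuousOn.abs)).add ((continuousOn_const.mul hs.continuousOn.abs).add
      hst.continuousOn.abs)
  have hline : ∀ {F : (ℝ × ℝ) × ℝ → ℝ}, ContinuousOn F (U ×ˢ univ) → ∀ x, ∀ σ ∈ I,
      ContinuousOn (fun τ => F ((σ, τ), x)) J := fun hF x σ hσ =>
    hF.comp (by fun_prop) fun τ hτ => ⟨hrU ⟨hσ, hτ⟩, mem_univ _⟩
  have hline' : ∀ {F : (ℝ × ℝ) × ℝ → ℝ}, ContinuousOn F (U ×ˢ univ) → ∀ x, ∀ τ ∈ J,
      ContinuousOn (fun σ => F ((σ, τ), x)) I := fun hF x τ hτ =>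
    hF.comp (by fun_prop) fun σ hσ => ⟨hrU ⟨hσ, hτ⟩, mem_univ _⟩
  refine ⟨fun x => ∫ p in I ×ˢ J, H (p, x), hH.integral_prod_right, ?_⟩
  rintro ⟨σ, τ⟩ ⟨hσ, hτ⟩ x
  have h1 : |f (σ, τ) x| ≤ ∫ z in I, (a * |f (z, τ) x| + |dir f ((1, 0), 0) (z, τ) x|) :=
    abs_le_setIntegral_of_hasDerivAt (g := fun z => f (z, τ) x) hr
      (fun y hy => hasDerivAt_dir_fst hU hf.1 (hrU ⟨hy, hτ⟩) x)
      (hline' hs.continuousOn x τ hτ) hσ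
  have h2 : ∀ z ∈ I, a * |f (z, τ) x| + |dir f ((1, 0), 0) (z, τ) x| ≤
      ∫ w in J, H ((z, w), x) := fun z hz => by
    have e1 : |f (z, τ) x| ≤ ∫ w in J, (a * |f (z, w) x| + |dir f ((0, 1), 0) (z, w) x|) :=
      abs_le_setIntegral_of_hasDerivAt (g := fun w => f (z, w) x) hr
        (fun y hy => hasDerivAt_dir_snd hU hf.1 (hrU ⟨hz, hy⟩) x)
        (hline ht.continuousOn x z hz) hτ
    have e2 : |dir f ((1, 0), 0) (z, τ) x| ≤ ∫ w in J, (a * |dir f ((1, 0), 0) (z, w) x| +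
        |dir (dir f ((1, 0), 0)) ((0, 1), 0) (z, w) x|) :=
      abs_le_setIntegral_of_hasDerivAt (g := fun w => dir f ((1, 0), 0) (z, w) x) hr
        (fun y hy => hasDerivAt_dir_snd hU hs.1 (hrU ⟨hz, hy⟩) x)
        (hline hst.continuousOn x z hz) hτ
    have i1 := (((hline hf.continuousOn x z hz).abs.integrableOn_compact hcJ
      (μ := volume)).const_mul a).add
      ((hline ht.continuousOn x z hz).abs.integrableOn_compact hcJ)
    have i2 := (((hline hs.continuousOn x z hz).abs.integrableOn_compact hcJ
      (μ := volume)).const_mul a).add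
      ((hline hst.continuousOn x z hz).abs.integrableOn_compact hcJ)
    have e3 := integral_add (i1.const_mul a) i2
    rw [integral_const_mul] at e3
    refine le_of_le_of_eq ?_ e3.symm
    exact add_le_add (mul_le_mul_of_nonneg_left e1 ha) e2
  have hHx : IntegrableOn (fun p => H (p, x)) (I ×ˢ J) (volume.prod volume) := by
    rw [← Measure.volume_eq_prod]
    exact (hHc.comp (f := fun p : ℝ × ℝ => (p, x)) (by fun_prop)
      fun p hp => ⟨hrU hp, mem_univ _⟩).integrableOn_compact hcB
  beta_reduce
  rw [Measure.volume_eq_prod, setIntegral_prod _ hHx]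
  refine h1.trans (setIntegral_mono_on ?_ ?_ measurableSet_Icc h2)
  · exact (((hline' hf.continuousOn x τ hτ).abs.integrableOn_compact hcI).const_mul a).add
      ((hline' hs.continuousOn x τ hτ).abs.integrableOn_compact hcI)
  · rw [IntegrableOn, ← Measure.prod_restrict] at hHx
    exact hHx.integral_prod_left

theorem IsSmoothInA.domOn (hU : IsOpen U) (hf : IsSmoothInA A U f) {K : Set (ℝ × ℝ)}
    (hK : IsCompact K) (hKU : K ⊆ U) : DomOn K (fun q => f q.1 q.2) := by
  cases A with
  | compactSupport =>
    obtain ⟨R, hR⟩ := hf.2 K hK hKU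
    obtain ⟨C, hC⟩ := (hK.prod (isCompact_Icc (a := -R) (b := R))).exists_bound_of_continuousOn
      (hf.continuousOn.mono (prod_mono hKU (subset_univ _)))
    refine ⟨(Icc (-R) R).indicator fun _ => max C 0, (integrable_indicator_iff
      measurableSet_Icc).2 (integrableOn_const (by simp) (by simp)), fun p hp x => ?_⟩
    by_cases hx : R < |x|
    · simp only [hR p hp x hx, abs_zero]
      exact indicator_nonneg (fun _ _ => le_max_right _ _) x
    · have hx' : x ∈ Icc (-R) R := abs_le.1 (not_lt.1 hx)
      rw [indicator_of_mem hx']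
      exact (hC (p, x) ⟨hp, hx'⟩).trans (le_max_left _ _)
  | schwartz =>
    obtain ⟨C₀, h0⟩ := hf.2 K hK hKU 0 0
    obtain ⟨C₂, h2⟩ := hf.2 K hK hKU 2 0
    refine ⟨fun x => (C₀ + C₂) * (1 + x ^ 2)⁻¹, integrable_inv_one_add_sq.const_mul _,
      fun p hp x => ?_⟩
    have hx : 0 < 1 + x ^ 2 := by positivity
    have h0' := h0 p hp x
    have h2' := h2 p hp x
    rw [norm_iteratedFDeriv_zero, Real.norm_eq_abs] at h0' h2'
    rw [sq_abs] at h2'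
    beta_reduce
    rw [← div_eq_mul_inv, le_div_iff₀ hx]
    simp only [pow_zero, one_mul] at h0' h2' ⊢
    linarith
  | sobolev =>
    -- Local dominating functions are patched over a finite cover; a union of two sets is dominated
    -- by the sum of the absolute values.
    refine hK.induction_on (p := fun s => DomOn s fun q => f q.1 q.2)
      ⟨fun _ => 0, integrable_zero _ _ _, fun p hp => hp.elim⟩ (fun s t hst ht => ht.mono hst)
      ?_ fun p hp => ?_
    · rintro s t ⟨h, hi, hb⟩ ⟨k, ki, kb⟩
      refine ⟨fun x => |h x| + |k x|, hi.abs.add ki.abs, ?_⟩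
      rintro p (hp | hp) x
      · exact (hb p hp x).trans ((le_abs_self _).trans (le_add_of_nonneg_right (abs_nonneg _)))
      · exact (kb p hp x).trans ((le_abs_self _).trans (le_add_of_nonneg_left (abs_nonneg _)))
    · obtain ⟨N, hN, h⟩ := exists_domOn_nhds_sobolev hU hf (hKU hp)
      exact ⟨N, mem_nhdsWithin_of_mem_nhds hN, h⟩

/-- Both `f p` and its derivative are integrable, so `f p` tends to zero at both ends. -/
theorem IsSmoothInA.slice_eq_integral (hU : IsOpen U) (hf : IsSmoothInA A U f) {p : ℝ × ℝ}
    (hp : p ∈ U) :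
    (∀ x, f p x = ∫ y in Iic x, dir f (0, 1) p y) ∧ ∫ y, dir f (0, 1) p y = 0 := by
  have h1 := (hf.domOn hU isCompact_singleton (singleton_subset_iff.2 hp)).integrable_slice
    (mem_singleton p) (continuous_slice hf.continuousOn hp)
  have hx := hf.dir hU (0, 1)
  have h2 := (hx.domOn hU isCompact_singleton (singleton_subset_iff.2 hp)).integrable_slice
    (mem_singleton p) (continuous_slice hx.continuousOn hp)
  have hd := fun x => hasDerivAt_dir_space hU hf.1 hp x
  have hbot : Tendsto (f p) atBot (𝓝 0) := tendsto_zero_of_hasDerivAt_of_integrableOn_Iic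
    (a := 0) (fun x _ => hd x) h2.integrableOn h1.integrableOn
  have htop : Tendsto (f p) atTop (𝓝 0) := tendsto_zero_of_hasDerivAt_of_integrableOn_Ioi
    (a := 0) (fun x _ => hd x) h2.integrableOn h1.integrableOn
  refine ⟨fun x => ?_, ?_⟩
  · rw [integral_Iic_of_hasDerivAt_of_tendsto' (fun y _ => hd y) h2.integrableOn hbot, sub_zero]
  · rw [integral_of_hasDerivAt_of_tendsto hd h2 hbot htop, sub_zero]

/-- Locally uniform decay at infinity. -/
theorem IsSmoothInA.exists_decay (hU : IsOpen U) (hf : IsSmoothInA A U f) {K : Set (ℝ × ℝ)}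
    (hK : IsCompact K) (hKU : K ⊆ U) {ε : ℝ} (hε : 0 < ε) :
    ∃ R : ℝ, ∀ p ∈ K, ∀ x, R < |x| → |f p x| ≤ ε := by
  have hx := hf.dir hU (0, 1)
  obtain ⟨h, hi, hb⟩ := hx.domOn hU hK hKU
  -- One function `h` dominates `f_x` for all parameters in `K`, so the tails of `∫ h` control `f`
  -- uniformly.
  have hbot := (tendsto_integral_Iic_atBot hi).eventually_lt_const hε
  have htop : ∀ᶠ x in atTop, (∫ y, h y) - ∫ y in Iic x, h y < ε := by
    have h1 : Tendsto (fun x => ∫ y in Iic x, h y) atTop (𝓝 (∫ y, h y)) := by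
      have h2 : ∀ x, ∫ y in Iic x, h y =
          (∫ y in Iic (0 : ℝ), h y) + ∫ y in (0 : ℝ)..x, h y := fun x => by
        rw [← intervalIntegral.integral_Iic_sub_Iic hi.integrableOn hi.integrableOn]; ring
      have h3 := (intervalIntegral_tendsto_integral_Ioi (0 : ℝ) hi.integrableOn
        tendsto_id).const_add (∫ y in Iic (0 : ℝ), h y)
      rw [intervalIntegral.integral_Iic_add_Ioi hi.integrableOn hi.integrableOn] at h3
      rw [funext h2]
      exact h3
    have h4 := h1.const_sub (∫ y, h y)
    rw [sub_self] at h4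
    exact h4.eventually_lt_const hε
  obtain ⟨a, ha⟩ := eventually_atBot.1 hbot
  obtain ⟨b, hb'⟩ := eventually_atTop.1 htop
  refine ⟨max |a| |b|, fun p hp x hx' => ?_⟩
  obtain ⟨e1, e2⟩ := hf.slice_eq_integral hU (hKU hp)
  have ix := (hx.domOn hU isCompact_singleton
    (singleton_subset_iff.2 (hKU hp))).integrable_slice
    (mem_singleton p) (continuous_slice hx.continuousOn (hKU hp))
  rcases le_total x 0 with h0 | h0
  · have hxa : x ≤ a := by
      have := (le_max_left |a| |b|).trans_lt hx'
      rw [abs_of_nonpos h0] at this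
      linarith [neg_abs_le a]
    rw [e1 x]
    refine ((norm_integral_le_of_norm_le (f := dir f (0, 1) p) hi.integrableOn
      (Eventually.of_forall fun y => hb p hp y)).trans (ha x hxa).le)
  · have hxb : b ≤ x := by
      have := (le_max_right |a| |b|).trans_lt hx'
      rw [abs_of_nonneg h0] at this
      linarith [le_abs_self b]
    -- Since `∫ f_x = 0`, the value `f p x` is also minus the integral of `f_x` over the right tail.
    have e3 := intervalIntegral.integral_Iic_add_Ioi (b := x) ix.integrableOn ix.integrableOn
    have e4 := intervalIntegral.integral_Iic_add_Ioi (b := x) hi.integrableOn hi.integrableOn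
    rw [e2, ← e1 x] at e3
    rw [eq_neg_of_add_eq_zero_left e3, abs_neg]
    refine (norm_integral_le_of_norm_le (f := dir f (0, 1) p) hi.integrableOn
      (Eventually.of_forall fun y => hb p hp y)).trans ?_
    linarith [hb' x hxb]

theorem IsSmoothInA.bddOn (hU : IsOpen U) (hf : IsSmoothInA A U f) {K : Set (ℝ × ℝ)}
    (hK : IsCompact K) (hKU : K ⊆ U) : BddOn K (fun q => f q.1 q.2) := by
  obtain ⟨h, hi, hb⟩ := (hf.dir hU (0, 1)).domOn hU hK hKU
  have h0 : ∀ p ∈ K, 0 ≤ᵐ[volume] h := fun p hp =>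
    Eventually.of_forall fun x => (abs_nonneg _).trans (hb p hp x)
  refine ⟨∫ y, h y, fun p hp x => ?_⟩
  simp only [(hf.slice_eq_integral hU (hKU hp)).1 x]
  refine (norm_integral_le_of_norm_le (f := dir f (0, 1) p) hi.integrableOn
      (Eventually.of_forall fun y => hb p hp y)).trans ?_
  exact setIntegral_le_integral hi (h0 p hp)

/-- If `1 + f > 0`, then `(1 + f)⁻¹` is bounded locally uniformly in the parameter. -/
theorem IsSmoothInA.bddOn_inv (hU : IsOpen U) (hf : IsSmoothInA A U f)
    (hpos : ∀ p ∈ U, ∀ x, 0 < 1 + f p x) {K : Set (ℝ × ℝ)}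
    (hK : IsCompact K) (hKU : K ⊆ U) : BddOn K (fun q => (1 + f q.1 q.2)⁻¹) := by
  -- Where `|f| ≤ 1/2` the inverse is at most 2; the remaining region is compact.
  obtain ⟨R, hR⟩ := hf.exists_decay hU hK hKU (ε := 1 / 2) (by norm_num)
  have hc : ContinuousOn (fun q : (ℝ × ℝ) × ℝ => (1 + f q.1 q.2)⁻¹) (K ×ˢ Icc (-R) R) :=
    ((continuousOn_const.add hf.continuousOn).mono (prod_mono hKU (subset_univ _))).inv₀
      fun q hq => (hpos q.1 (hKU hq.1) q.2).ne'
  obtain ⟨C, hC⟩ := (hK.prod isCompact_Icc).exists_bound_of_continuousOn hc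
  refine ⟨max C 2, fun p hp x => ?_⟩
  by_cases hx : R < |x|
  · refine le_trans ?_ (le_max_right _ _)
    have h1 := (abs_le.1 (hR p hp x hx)).1
    rw [abs_inv, abs_of_pos (hpos p (hKU hp) x)]
    exact inv_le_of_inv_le₀ (by norm_num) (by norm_num; linarith)
  · exact (hC (p, x) ⟨hp, abs_le.1 (not_lt.1 hx)⟩).trans (le_max_left _ _)

end Plane

end

/-! ### Integrals over the strip `[a, b] × ℝ` and the first variation of the action. -/

section

/-- Continuous on `U × ℝ`, and dominated by an integrable function of the second variable,
locally uniformly in the first. -/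
def ContDom (U : Set (ℝ × ℝ)) (F : (ℝ × ℝ) × ℝ → ℝ) : Prop :=
  ContinuousOn F (U ×ˢ univ) ∧ ∀ K, IsCompact K → K ⊆ U → DomOn K F

/-- Continuous on `U × ℝ`, and bounded locally uniformly in the first variable. -/
def ContBdd (U : Set (ℝ × ℝ)) (F : (ℝ × ℝ) × ℝ → ℝ) : Prop :=
  ContinuousOn F (U ×ˢ univ) ∧ ∀ K, IsCompact K → K ⊆ U → BddOn K F

section Classes

variable {A : DecayClass} {U : Set (ℝ × ℝ)} {F G : (ℝ × ℝ) × ℝ → ℝ} {f : ℝ × ℝ → ℝ → ℝ}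

theorem ContDom.mul (hF : ContDom U F) (hG : ContBdd U G) : ContDom U fun q => F q * G q :=
  ⟨hF.1.mul hG.1, fun K hK h => (hF.2 K hK h).mul_bdd (hG.2 K hK h)⟩

theorem ContDom.add (hF : ContDom U F) (hG : ContDom U G) : ContDom U fun q => F q + G q :=
  ⟨hF.1.add hG.1, fun K hK h => (hF.2 K hK h).add (hG.2 K hK h)⟩

theorem ContDom.sub (hF : ContDom U F) (hG : ContDom U G) : ContDom U fun q => F q - G q :=
  ⟨hF.1.sub hG.1, fun K hK h => (hF.2 K hK h).sub (hG.2 K hK h)⟩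

theorem ContBdd.mul (hF : ContBdd U F) (hG : ContBdd U G) : ContBdd U fun q => F q * G q :=
  ⟨hF.1.mul hG.1, fun K hK h => (hF.2 K hK h).mul (hG.2 K hK h)⟩

theorem ContBdd.add (hF : ContBdd U F) (hG : ContBdd U G) : ContBdd U fun q => F q + G q :=
  ⟨hF.1.add hG.1, fun K hK h => (hF.2 K hK h).add (hG.2 K hK h)⟩

theorem contBdd_const (c : ℝ) : ContBdd U fun _ => c :=
  ⟨continuousOn_const, fun _ _ _ => bddOn_const c⟩

theorem IsSmoothInA.contDom (hf : IsSmoothInA A U f) (hU : IsOpen U) :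
    ContDom U fun q => f q.1 q.2 :=
  ⟨hf.continuousOn, fun _ hK h => hf.domOn hU hK h⟩

theorem IsSmoothInA.contBdd (hf : IsSmoothInA A U f) (hU : IsOpen U) :
    ContBdd U fun q => f q.1 q.2 :=
  ⟨hf.continuousOn, fun _ hK h => hf.bddOn hU hK h⟩

theorem IsSmoothInA.contBdd_inv (hf : IsSmoothInA A U f) (hU : IsOpen U)
    (hpos : ∀ p ∈ U, ∀ x, 0 < 1 + f p x) : ContBdd U fun q => (1 + f q.1 q.2)⁻¹ :=
  ⟨(continuousOn_const.add hf.continuousOn).inv₀ fun q hq => (hpos q.1 hq.1 q.2).ne',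
    fun _ hK h => hf.bddOn_inv hU hpos hK h⟩

end Classes

section Strip

variable {U : Set (ℝ × ℝ)} {F F' : (ℝ × ℝ) × ℝ → ℝ} {a b s : ℝ}

/-- Lebesgue measure on `[a, b] × ℝ`. -/
def stripMeasure (a b : ℝ) : Measure (ℝ × ℝ) := (volume.restrict (Icc a b)).prod volume

theorem ae_stripMeasure : ∀ᵐ q ∂stripMeasure a b, q.1 ∈ Icc a b :=
  Measure.quasiMeasurePreserving_fst.ae (ae_restrict_mem measurableSet_Icc)

theorem ContDom.aestronglyMeasurable (hF : ContinuousOn F (U ×ˢ univ))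
    (hs : ∀ t ∈ Icc a b, (s, t) ∈ U) :
    AEStronglyMeasurable (fun q : ℝ × ℝ => F ((s, q.1), q.2)) (stripMeasure a b) := by
  have h1 : ContinuousOn (fun q : ℝ × ℝ => F ((s, q.1), q.2)) (Icc a b ×ˢ univ) :=
    hF.comp (by fun_prop) fun q hq => ⟨hs q.1 hq.1, mem_univ _⟩
  have h2 := h1.aestronglyMeasurable (μ := volume) (measurableSet_Icc.prod MeasurableSet.univ)
  rwa [Measure.volume_eq_prod, ← Measure.prod_restrict, Measure.restrict_univ] at h2

theorem integrable_comp_snd_strip {h : ℝ → ℝ} (hi : Integrable h) :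
    Integrable (fun q : ℝ × ℝ => h q.2) (stripMeasure a b) :=
  hi.comp_snd _

theorem ContDom.integrable (hF : ContDom U F) (hs : ∀ t ∈ Icc a b, (s, t) ∈ U) :
    Integrable (fun q : ℝ × ℝ => F ((s, q.1), q.2)) (stripMeasure a b) := by
  obtain ⟨h, hi, hb⟩ := hF.2 ({s} ×ˢ Icc a b) (isCompact_singleton.prod isCompact_Icc)
    (by rintro ⟨σ, t⟩ ⟨rfl, ht⟩; exact hs t ht)
  refine (integrable_comp_snd_strip hi).mono' (ContDom.aestronglyMeasurable hF.1 hs) ?_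
  filter_upwards [ae_stripMeasure (a := a) (b := b)] with q hq
  exact hb (s, q.1) ⟨mem_singleton s, hq⟩ _

theorem ContDom.integral_strip (hF : ContDom U F) (hs : ∀ t ∈ Icc a b, (s, t) ∈ U)
    (hab : a ≤ b) :
    ∫ q, F ((s, q.1), q.2) ∂stripMeasure a b = ∫ t in a..b, ∫ x, F ((s, t), x) := by
  rw [intervalIntegral.integral_of_le hab, ← integral_Icc_eq_integral_Ioc]
  exact integral_prod _ (hF.integrable hs)

theorem eventually_forall_Icc_mem (hU : IsOpen U) (hs : ∀ t ∈ Icc a b, (s, t) ∈ U) :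
    ∀ᶠ σ in 𝓝 s, ∀ t ∈ Icc a b, (σ, t) ∈ U := by
  obtain ⟨u, v, hu, hv, hsu, hvt, huv⟩ := generalized_tube_lemma
    (isCompact_singleton (x := s)) (isCompact_Icc (a := a) (b := b)) hU
    (by rintro ⟨σ, t⟩ ⟨rfl, ht⟩; exact hs t ht)
  filter_upwards [hu.mem_nhds (hsu (mem_singleton s))] with σ hσ t ht using huv ⟨hσ, hvt ht⟩

/-- Differentiation of integrals over the strip with respect to the parameter. -/
theorem ContDom.hasDerivAt_integral (hF : ContDom U F) (hF' : ContDom U F') (hU : IsOpen U)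
    (hs : ∀ t ∈ Icc a b, (s, t) ∈ U)
    (hd : ∀ σ t, (σ, t) ∈ U → ∀ x, HasDerivAt (fun σ => F ((σ, t), x)) (F' ((σ, t), x)) σ) :
    HasDerivAt (fun σ => ∫ q, F ((σ, q.1), q.2) ∂stripMeasure a b)
      (∫ q, F' ((s, q.1), q.2) ∂stripMeasure a b) s := by
  obtain ⟨r, hr, hsub⟩ := Metric.nhds_basis_closedBall.mem_iff.1
    (eventually_forall_Icc_mem hU hs)
  replace hsub : ∀ σ ∈ Metric.closedBall s r, ∀ t ∈ Icc a b, (σ, t) ∈ U := fun σ hσ => hsub hσ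
  obtain ⟨h, hi, hb⟩ := hF'.2 (Metric.closedBall s r ×ˢ Icc a b)
    ((isCompact_closedBall s r).prod isCompact_Icc) fun p hp => hsub _ hp.1 _ hp.2
  have hnb : Metric.closedBall s r ∈ 𝓝 s := Metric.closedBall_mem_nhds _ hr
  refine (hasDerivAt_integral_of_dominated_loc_of_deriv_le (bound := fun q : ℝ × ℝ => h q.2)
    (F' := fun σ (q : ℝ × ℝ) => F' ((σ, q.1), q.2)) hnb ?_ (hF.integrable hs)
    (ContDom.aestronglyMeasurable hF'.1 hs) ?_ (integrable_comp_snd_strip hi) ?_).2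
  · filter_upwards [hnb] with σ hσ using ContDom.aestronglyMeasurable hF.1 (hsub σ hσ)
  · filter_upwards [ae_stripMeasure (a := a) (b := b)] with q hq σ hσ
    exact hb _ ⟨hσ, hq⟩ _
  · filter_upwards [ae_stripMeasure (a := a) (b := b)] with q hq σ hσ
    exact hd σ q.1 (hsub σ hσ _ hq) q.2

/-- The integral over the strip of a derivative in the direction of `t`. -/
theorem ContDom.integral_deriv_eq_zero (hF' : ContDom U F') (hab : a ≤ b)
    (hs : ∀ t ∈ Icc a b, (s, t) ∈ U)
    (hd : ∀ t, (s, t) ∈ U → ∀ x, HasDerivAt (fun τ => F ((s, τ), x)) (F' ((s, t), x)) t)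
    (ha : ∀ x, F ((s, a), x) = 0) (hb : ∀ x, F ((s, b), x) = 0) :
    ∫ q, F' ((s, q.1), q.2) ∂stripMeasure a b = 0 := by
  -- With the order of integration exchanged, the inner integral in `t` is a difference of endpoint
  -- values for each fixed `x`.
  rw [stripMeasure, integral_prod_symm _ (hF'.integrable hs)]
  refine integral_eq_zero_of_ae (Eventually.of_forall fun x => ?_)
  simp only [Pi.zero_apply]
  rw [integral_Icc_eq_integral_Ioc, ← intervalIntegral.integral_of_le hab]
  rw [intervalIntegral.integral_eq_sub_of_hasDerivAt (f := fun t => F ((s, t), x)), ha, hb, sub_self]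
  · intro t ht
    rw [uIcc_of_le hab] at ht
    exact hd t (hs t ht) x
  · refine ContinuousOn.intervalIntegrable ?_
    rw [uIcc_of_le hab]
    exact hF'.1.comp (f := fun t => ((s, t), x)) (by fun_prop) fun t ht => ⟨hs t ht, mem_univ _⟩

end Strip

theorem dir_comm {P : Type*} [NormedAddCommGroup P] [NormedSpace ℝ P] {U : Set P}
    {f : P → ℝ → ℝ} (hU : IsOpen U)
    (hf : ContDiffOn ℝ ∞ (fun q : P × ℝ => f q.1 q.2) (U ×ˢ univ)) (v w : P × ℝ) {p : P}
    (hp : p ∈ U) (x : ℝ) : dir (dir f v) w p x = dir (dir f w) v p x := by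
  have hc : ContDiffAt ℝ ∞ (fun q : P × ℝ => f q.1 q.2) (p, x) :=
    hf.contDiffAt ((hU.prod isOpen_univ).mem_nhds ⟨hp, mem_univ _⟩)
  have hd : DifferentiableAt ℝ (fderiv ℝ (fun q : P × ℝ => f q.1 q.2)) (p, x) :=
    (hc.fderiv_right (m := ∞) (by simp)).differentiableAt (by simp)
  have hsym := hc.isSymmSndFDerivAt (by
    rw [minSmoothness_of_isRCLikeNormedField]
    exact WithTop.coe_le_coe.2 (le_top : (2 : ℕ∞) ≤ ⊤))
  have key : ∀ v w : P × ℝ, dir (dir f v) w p x =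
      fderiv ℝ (fderiv ℝ (fun q : P × ℝ => f q.1 q.2)) (p, x) w v := fun v w => by
    have h1 : fderiv ℝ (fun q : P × ℝ => fderiv ℝ (fun q : P × ℝ => f q.1 q.2) q v) (p, x) w =
        fderiv ℝ (fderiv ℝ (fun q : P × ℝ => f q.1 q.2)) (p, x) w v := by
      rw [fderiv_clm_apply hd (differentiableAt_const v)]
      simp
    exact h1
  rw [key, key]
  exact hsym w v

theorem dir_congr {P : Type*} [NormedAddCommGroup P] [NormedSpace ℝ P] {U : Set P}
    {f g : P → ℝ → ℝ} (hU : IsOpen U) (h : ∀ p ∈ U, f p = g p) (v : P × ℝ) {p : P}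
    (hp : p ∈ U) (x : ℝ) : dir f v p x = dir g v p x := by
  have : (fun q : P × ℝ => f q.1 q.2) =ᶠ[𝓝 (p, x)] fun q => g q.1 q.2 := by
    filter_upwards [(hU.prod isOpen_univ).mem_nhds
      (show (p, x) ∈ U ×ˢ univ from ⟨hp, mem_univ _⟩)] with q hq
    rw [h q.1 hq.1]
  rw [dir, dir, this.fderiv_eq]

/-- The first component of the Euler-Lagrange expression, for the family with `φ_x = 1 + N`. -/
def eulerLagrange₁ (N α : ℝ × ℝ → ℝ → ℝ) (p : ℝ × ℝ) (x : ℝ) : ℝ :=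
  dir (dir N ((0, 1), 0)) ((0, 1), 0) p x -
    (dir N ((0, 1), 0) p x * dir N ((0, 1), 0) p x * (1 + N p x)⁻¹ +
      dir α ((0, 1), 0) p x * dir α ((0, 1), 0) p x * (1 + N p x)) * (1 / 2)

/-- The second component of the Euler-Lagrange expression. -/
def eulerLagrange₂ (N α : ℝ × ℝ → ℝ → ℝ) (p : ℝ × ℝ) (x : ℝ) : ℝ :=
  dir (dir α ((0, 1), 0)) ((0, 1), 0) p x * (1 + N p x) +
    dir α ((0, 1), 0) p x * dir N ((0, 1), 0) p x

theorem hasDerivAt_inv_one_add {f : ℝ → ℝ} {f' t : ℝ} (hf : HasDerivAt f f' t)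
    (h : 1 + f t ≠ 0) :
    HasDerivAt (fun τ => (1 + f τ)⁻¹) (-f' * ((1 + f t)⁻¹ * (1 + f t)⁻¹)) t :=
  ((hf.const_add 1).fun_inv h).congr_deriv (by rw [div_eq_mul_inv, pow_two, mul_inv])

section Variation

variable {A : DecayClass} {U : Set (ℝ × ℝ)} {N α : ℝ × ℝ → ℝ → ℝ} {a b : ℝ}

/-- The first variation of `∫∫ N_t² / (1 + N) + α_t² (1 + N) dx dt`. -/
theorem hasDerivAt_action (hU : IsOpen U) (hN : IsSmoothInA A U N) (hα : IsSmoothInA A U α)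
    (hpos : ∀ p ∈ U, ∀ x, 0 < 1 + N p x) (hab : a ≤ b) (hs : ∀ t ∈ Icc a b, ((0 : ℝ), t) ∈ U)
    (hNa : ∀ x, dir N ((1, 0), 0) (0, a) x = 0) (hNb : ∀ x, dir N ((1, 0), 0) (0, b) x = 0)
    (hαa : ∀ x, dir α ((1, 0), 0) (0, a) x = 0) (hαb : ∀ x, dir α ((1, 0), 0) (0, b) x = 0) :
    HasDerivAt (fun s : ℝ => 1 / 2 * ∫ t in a..b, ∫ x,
      (dir N ((0, 1), 0) (s, t) x * dir N ((0, 1), 0) (s, t) x * (1 + N (s, t) x)⁻¹ +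
      dir α ((0, 1), 0) (s, t) x * dir α ((0, 1), 0) (s, t) x * (1 + N (s, t) x)))
      (-∫ q, (dir N ((1, 0), 0) (0, q.1) q.2 * (1 + N (0, q.1) q.2)⁻¹ *
        eulerLagrange₁ N α (0, q.1) q.2 +
        dir α ((1, 0), 0) (0, q.1) q.2 * eulerLagrange₂ N α (0, q.1) q.2) ∂stripMeasure a b) 0 := by
  have hNs := hN.dir hU ((1, 0), 0)
  have hNt := hN.dir hU ((0, 1), 0)
  have hNts := hNt.dir hU ((1, 0), 0)
  have hNtt := hNt.dir hU ((0, 1), 0)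
  have hαs := hα.dir hU ((1, 0), 0)
  have hαt := hα.dir hU ((0, 1), 0)
  have hαts := hαt.dir hU ((1, 0), 0)
  have hαtt := hαt.dir hU ((0, 1), 0)
  have bI := hN.contBdd_inv hU hpos
  have bW : ContBdd U fun q => 1 + N q.1 q.2 := (contBdd_const 1).add (hN.contBdd hU)
  have bNs := hNs.contBdd hU
  have bNt := hNt.contBdd hU
  have bαs := hαs.contBdd hU
  have bαt := hαt.contBdd hU
  have cL : ContDom U fun q =>
      dir N ((0, 1), 0) q.1 q.2 * dir N ((0, 1), 0) q.1 q.2 * (1 + N q.1 q.2)⁻¹ +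
      dir α ((0, 1), 0) q.1 q.2 * dir α ((0, 1), 0) q.1 q.2 * (1 + N q.1 q.2) :=
    (((hNt.contDom hU).mul bNt).mul bI).add (((hαt.contDom hU).mul bαt).mul bW)
  -- The `s`-derivative of the Lagrangian density.
  have cLs : ContDom U fun q =>
      ((dir (dir N ((0, 1), 0)) ((1, 0), 0) q.1 q.2 * dir N ((0, 1), 0) q.1 q.2 *
        (1 + N q.1 q.2)⁻¹) * 2 -
      dir N ((0, 1), 0) q.1 q.2 * dir N ((0, 1), 0) q.1 q.2 * dir N ((1, 0), 0) q.1 q.2 *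
        ((1 + N q.1 q.2)⁻¹ * (1 + N q.1 q.2)⁻¹)) +
      ((dir (dir α ((0, 1), 0)) ((1, 0), 0) q.1 q.2 * dir α ((0, 1), 0) q.1 q.2 *
        (1 + N q.1 q.2)) * 2 +
      dir α ((0, 1), 0) q.1 q.2 * dir α ((0, 1), 0) q.1 q.2 * dir N ((1, 0), 0) q.1 q.2) :=
    (((((hNts.contDom hU).mul bNt).mul bI).mul (contBdd_const 2)).sub
      ((((hNt.contDom hU).mul bNt).mul bNs).mul (bI.mul bI))).add
      (((((hαts.contDom hU).mul bαt).mul bW).mul (contBdd_const 2)).add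
      (((hαt.contDom hU).mul bαt).mul bNs))
  -- The `t`-derivative of `N_t N_s / (1 + N) + α_t (1 + N) α_s`. This expression vanishes at both
  -- endpoints, so subtracting its derivative removes the mixed derivatives `N_ts`, `α_ts` at no
  -- cost.
  have cBt : ContDom U fun q =>
      (dir (dir N ((0, 1), 0)) ((0, 1), 0) q.1 q.2 * dir N ((1, 0), 0) q.1 q.2 *
        (1 + N q.1 q.2)⁻¹ +
      dir (dir N ((0, 1), 0)) ((1, 0), 0) q.1 q.2 * dir N ((0, 1), 0) q.1 q.2 *
        (1 + N q.1 q.2)⁻¹ -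
      dir N ((0, 1), 0) q.1 q.2 * dir N ((1, 0), 0) q.1 q.2 * dir N ((0, 1), 0) q.1 q.2 *
        ((1 + N q.1 q.2)⁻¹ * (1 + N q.1 q.2)⁻¹)) +
      (dir (dir α ((0, 1), 0)) ((0, 1), 0) q.1 q.2 * (1 + N q.1 q.2) *
        dir α ((1, 0), 0) q.1 q.2 +
      dir α ((0, 1), 0) q.1 q.2 * dir N ((0, 1), 0) q.1 q.2 * dir α ((1, 0), 0) q.1 q.2 +
      dir (dir α ((0, 1), 0)) ((1, 0), 0) q.1 q.2 * (1 + N q.1 q.2) *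
        dir α ((0, 1), 0) q.1 q.2) :=
    ((((hNtt.contDom hU).mul bNs).mul bI).add (((hNts.contDom hU).mul bNt).mul bI) |>.sub
      ((((hNt.contDom hU).mul bNs).mul bNt).mul (bI.mul bI))).add
      (((((hαtt.contDom hU).mul bW).mul bαs).add
      (((hαt.contDom hU).mul bNt).mul bαs)).add
      (((hαts.contDom hU).mul bW).mul bαt))
  have h1 := cL.hasDerivAt_integral (a := a) (b := b) (s := 0) cLs hU hs fun σ t hp x => by
    have dN := hasDerivAt_dir_fst hU hN.1 hp x
    have dNt := hasDerivAt_dir_fst hU hNt.1 hp x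
    have dαt := hasDerivAt_dir_fst hU hαt.1 hp x
    have dI := hasDerivAt_inv_one_add dN (hpos _ hp x).ne'
    refine (((dNt.mul dNt).mul dI).add ((dαt.mul dαt).mul (dN.const_add 1))).congr_deriv ?_
    simp only [Pi.mul_apply]
    ring
  have h2 := cBt.integral_deriv_eq_zero (F := fun q =>
      dir N ((0, 1), 0) q.1 q.2 * dir N ((1, 0), 0) q.1 q.2 * (1 + N q.1 q.2)⁻¹ +
      dir α ((0, 1), 0) q.1 q.2 * (1 + N q.1 q.2) * dir α ((1, 0), 0) q.1 q.2) hab hs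
    (fun t hp x => by
      have dN := hasDerivAt_dir_snd hU hN.1 hp x
      have dNt := hasDerivAt_dir_snd hU hNt.1 hp x
      have dαt := hasDerivAt_dir_snd hU hαt.1 hp x
      have dNs := hasDerivAt_dir_snd hU hNs.1 hp x
      have dαs := hasDerivAt_dir_snd hU hαs.1 hp x
      rw [dir_comm hU hN.1 _ _ hp] at dNs
      rw [dir_comm hU hα.1 _ _ hp] at dαs
      have dI := hasDerivAt_inv_one_add dN (hpos _ hp x).ne'
      refine (((dNt.mul dNs).mul dI).add ((dαt.mul (dN.const_add 1)).mul dαs)).congr_deriv ?_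
      simp only [Pi.mul_apply]
      ring)
    (fun x => by simp only [hNa, hαa]; ring) (fun x => by simp only [hNb, hαb]; ring)
  refine ((h1.const_mul (1 / 2)).congr_of_eventuallyEq ?_).congr_deriv ?_
  · filter_upwards [eventually_forall_Icc_mem hU hs] with s hs'
    rw [← cL.integral_strip hs' hab]
  · rw [← integral_const_mul]
    have h3 := integral_sub ((cLs.integrable hs).const_mul (1 / 2)) (cBt.integrable hs)
    rw [h2, sub_zero] at h3
    rw [← h3, ← integral_neg]
    refine integral_congr_ae ?_
    filter_upwards [ae_stripMeasure (a := a) (b := b)] with q hq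
    have hI : (1 + N (0, q.1) q.2)⁻¹ * (1 + N (0, q.1) q.2) = 1 :=
      inv_mul_cancel₀ (hpos _ (hs _ hq) _).ne'
    simp only [eulerLagrange₁, eulerLagrange₂]
    generalize (1 + N (0, q.1) q.2)⁻¹ = I at hI ⊢
    -- The factor `(1 + N)⁻¹` in front of the first Euler-Lagrange expression must be cancelled in
    -- one term only, the one with `α_t² N_s`.
    linear_combination (-(1 / 2) * dir α ((0, 1), 0) (0, q.1) q.2 ^ 2 *
      dir N ((1, 0), 0) (0, q.1) q.2) * hI

end Variation

end

/-! ### The energy of families in the large group, and the fundamental lemma. -/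

section

variable {A : DecayClass}

theorem IsSmoothInA.congr {P : Type*} [NormedAddCommGroup P] [NormedSpace ℝ P]
    [LocallyCompactSpace P] {U : Set P} {f g : P → ℝ → ℝ} (hU : IsOpen U)
    (hf : IsSmoothInA A U f) (h : ∀ p ∈ U, g p = f p) : IsSmoothInA A U g := by
  have hev : ∀ p ∈ U, ∀ x, (fun q : P × ℝ => g q.1 q.2) =ᶠ[𝓝 (p, x)] fun q => f q.1 q.2 :=
    fun p hp x => by
      filter_upwards [(hU.prod isOpen_univ).mem_nhds
        (show (p, x) ∈ U ×ˢ univ from ⟨hp, mem_univ _⟩)] with q hq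
      rw [h q.1 hq.1]
  refine hf.transfer hU hU continuous_id (mapsTo_id _)
    (hf.1.congr fun q hq => by rw [h q.1 hq.1])
    (fun p hp x hx => by rw [h p hp]; exact hx.self_of_nhds) fun n =>
    ⟨n, 1, zero_le_one, fun p hp x => ?_⟩
  rw [((hev p hp x).iteratedFDeriv ℝ n).self_of_nhds, one_mul, id]

theorem IsSmoothInGroupA1.comp_clm {P P' : Type*} [NormedAddCommGroup P] [NormedSpace ℝ P]
    [NormedAddCommGroup P'] [NormedSpace ℝ P'] [LocallyCompactSpace P] {U : Set P} {U' : Set P'}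
    {g : P → Pair} (hU : IsOpen U) (hU' : IsOpen U') (hg : IsSmoothInGroupA1 A U g)
    (π : P' →L[ℝ] P) (hm : MapsTo π U' U) : IsSmoothInGroupA1 A U' (fun p => g (π p)) := by
  obtain ⟨h1, ⟨h2, h3, h4⟩, h5⟩ := hg
  refine ⟨fun p hp => h1 _ (hm hp), ⟨?_, h3.comp_clm hU hU' π hm, fun p hp => h4 _ (hm hp)⟩,
    h5.comp_clm hU hU' π hm⟩
  exact h2.comp (π.prodMap (ContinuousLinearMap.id ℝ ℝ)).contDiff.contDiffOn
    fun q hq => ⟨hm hq.1, mem_univ _⟩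

/-- `φ_x - 1` for a family of elements `(φ, α)`. -/
def slopeSub (V : ℝ × ℝ → Pair) (p : ℝ × ℝ) : ℝ → ℝ := deriv fun x => (V p).1 x - x

section Family

variable {U : Set (ℝ × ℝ)} {V : ℝ × ℝ → Pair}

theorem IsSmoothInGroupA1.differentiable {p : ℝ × ℝ} (hV : IsSmoothInGroupA1 A U V)
    (hp : p ∈ U) : Differentiable ℝ (V p).1 := by
  have h1 := ((contDiff_infty_iff_deriv.1 (hV.1 p hp).1.1).1).add differentiable_id
  have h2 : (fun x => (V p).1 x - x) + id = (V p).1 := by ext x; simp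
  rwa [h2] at h1

theorem IsSmoothInGroupA1.deriv_eq {p : ℝ × ℝ} (hV : IsSmoothInGroupA1 A U V)
    (hp : p ∈ U) (x : ℝ) : deriv (V p).1 x = 1 + slopeSub V p x := by
  have h1 := ((hV.differentiable hp x).hasDerivAt.sub (hasDerivAt_id x)).deriv
  rw [slopeSub]
  simp only [Pi.sub_def, id] at h1
  rw [h1]; ring

theorem IsSmoothInGroupA1.one_add_pos (hV : IsSmoothInGroupA1 A U V) :
    ∀ p ∈ U, ∀ x, 0 < 1 + slopeSub V p x := fun p hp x => by
  rw [← hV.deriv_eq hp]; exact (hV.1 p hp).2.1 x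

theorem IsSmoothInGroupA1.bijective {p : ℝ × ℝ} (hV : IsSmoothInGroupA1 A U V) (hp : p ∈ U) :
    Function.Bijective (V p).1 := by
  obtain ⟨C, hC⟩ := (hV.1 p hp).1.bddDerivs.exists_bound
  exact bijective_of_deriv_pos (hV.differentiable hp) (hV.1 p hp).2.1 hC

theorem IsSmoothInGroupA1.slopeSub_eq (hV : IsSmoothInGroupA1 A U V) (hU : IsOpen U) :
    ∀ p ∈ U, slopeSub V p = dir (fun p x => (V p).1 x - x) (0, 1) p := fun _ hp =>
  funext fun x => (hasDerivAt_dir_space (f := fun p x => (V p).1 x - x) hU hV.2.1.1 hp x).deriv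

/-- The `x`-derivative of `φ_t` is the `t`-derivative of `φ_x`. -/
theorem IsSmoothInGroupA1.hasDerivAt_dir (hV : IsSmoothInGroupA1 A U V) (hU : IsOpen U)
    {p : ℝ × ℝ} (hp : p ∈ U) (v : (ℝ × ℝ) × ℝ) (x : ℝ) :
    HasDerivAt (dir (fun p x => (V p).1 x - x) v p) (dir (slopeSub V) v p x) x := by
  have hc := contDiffOn_fderiv_apply hV.2.1.1 (hU.prod isOpen_univ) v
  have h1 := hasDerivAt_dir_space (f := dir (fun p x => (V p).1 x - x) v) hU hc hp x
  rw [dir_comm hU hV.2.1.1 _ _ hp, ← dir_congr hU (hV.slopeSub_eq hU) v hp] at h1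
  exact h1

theorem IsSmoothInGroupA1.velocity_eq (hV : IsSmoothInGroupA1 A U V) (hU : IsOpen U)
    {s t : ℝ} (hp : (s, t) ∈ U) :
    velocity (fun t => V (s, t)) t =
      (dir (fun p x => (V p).1 x - x) ((0, 1), 0) (s, t),
        dir (fun p => (V p).2) ((0, 1), 0) (s, t)) := by
  ext x
  · have h1 := (hasDerivAt_dir_snd (f := fun p x => (V p).1 x - x) hU hV.2.1.1 hp x).add_const x
    simp only [sub_add_cancel] at h1
    exact h1.deriv
  · exact (hasDerivAt_dir_snd (f := fun p => (V p).2) hU hV.2.2.1 hp x).deriv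

/-- The `𝒜₁`-valued component, which need not be integrable, disappears: `φ_t` enters only through
`(φ_t)_x = N_t`. What remains is built from families in `𝒜`, to which the dominated estimates apply.
-/
theorem IsSmoothInGroupA1.metricAt_velocity (hV : IsSmoothInGroupA1 A U V) (hU : IsOpen U)
    {s t : ℝ} (hp : (s, t) ∈ U) :
    metricAt (V (s, t)) (velocity (fun t => V (s, t)) t) (velocity (fun t => V (s, t)) t) =
      ∫ x, (dir (slopeSub V) ((0, 1), 0) (s, t) x * dir (slopeSub V) ((0, 1), 0) (s, t) x *
        (1 + slopeSub V (s, t) x)⁻¹ +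
        dir (fun p => (V p).2) ((0, 1), 0) (s, t) x * dir (fun p => (V p).2) ((0, 1), 0) (s, t) x *
        (1 + slopeSub V (s, t) x)) := by
  have hd := fun x => hV.hasDerivAt_dir hU hp ((0, 1), 0) x
  rw [hV.velocity_eq hU hp, metricAt_eq (hV.differentiable hp) (hV.1 _ hp).2.1 (hV.bijective hp)
    (fun x => (hd x).differentiableAt) (fun x => (hd x).differentiableAt)]
  simp only [(hd _).deriv, hV.deriv_eq hp, div_eq_mul_inv]

/-- The first variation of the energy. -/
theorem IsSmoothInGroupA1.hasDerivAt_energy {a b : ℝ} (hV : IsSmoothInGroupA1 A U V)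
    (hU : IsOpen U) (hab : a ≤ b) (hs : ∀ t ∈ Icc a b, ((0 : ℝ), t) ∈ U)
    (ha : ∀ᶠ s in 𝓝 (0 : ℝ), V (s, a) = V (0, a)) (hb : ∀ᶠ s in 𝓝 (0 : ℝ), V (s, b) = V (0, b)) :
    HasDerivAt (fun s => energy a b (fun t => V (s, t)))
      (-∫ q, (dir (slopeSub V) ((1, 0), 0) (0, q.1) q.2 * (1 + slopeSub V (0, q.1) q.2)⁻¹ *
        eulerLagrange₁ (slopeSub V) (fun p => (V p).2) (0, q.1) q.2 +
        dir (fun p => (V p).2) ((1, 0), 0) (0, q.1) q.2 *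
        eulerLagrange₂ (slopeSub V) (fun p => (V p).2) (0, q.1) q.2) ∂stripMeasure a b) 0 := by
  have hN : IsSmoothInA A U (slopeSub V) := hV.2.1.2.1
  -- An endpoint that stays fixed for all small `s` has zero variation there.
  have hz : ∀ t, ((0 : ℝ), t) ∈ U → (∀ᶠ s in 𝓝 (0 : ℝ), V (s, t) = V (0, t)) → ∀ x,
      dir (slopeSub V) ((1, 0), 0) (0, t) x = 0 ∧
      dir (fun p => (V p).2) ((1, 0), 0) (0, t) x = 0 := fun t ht h x => by
    constructor
    · refine (hasDerivAt_dir_fst hU hN.1 ht x).unique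
        ((hasDerivAt_const 0 (slopeSub V (0, t) x)).congr_of_eventuallyEq ?_)
      filter_upwards [h] with s hs
      simp only [slopeSub, hs]
    · refine (hasDerivAt_dir_fst hU hV.2.2.1 ht x).unique
        ((hasDerivAt_const 0 ((V (0, t)).2 x)).congr_of_eventuallyEq ?_)
      filter_upwards [h] with s hs
      rw [hs]
  have hza := hz a (hs a (left_mem_Icc.2 hab)) ha
  have hzb := hz b (hs b (right_mem_Icc.2 hab)) hb
  refine (hasDerivAt_action hU hN hV.2.2 hV.one_add_pos hab hs (fun x => (hza x).1)
    (fun x => (hzb x).1) (fun x => (hza x).2) (fun x => (hzb x).2)).congr_of_eventuallyEq ?_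
  filter_upwards [eventually_forall_Icc_mem hU hs] with s hs'
  rw [energy]
  congr 1
  refine intervalIntegral.integral_congr fun t ht => ?_
  rw [uIcc_of_le hab] at ht
  exact hV.metricAt_velocity hU (hs' t ht)

end Family

theorem dir_snd_congr {U₁ U₂ : Set (ℝ × ℝ)} {f₁ f₂ : ℝ × ℝ → ℝ → ℝ} (hU₁ : IsOpen U₁)
    (hU₂ : IsOpen U₂) (h₁ : ContDiffOn ℝ ∞ (fun q : (ℝ × ℝ) × ℝ => f₁ q.1 q.2) (U₁ ×ˢ univ))
    (h₂ : ContDiffOn ℝ ∞ (fun q : (ℝ × ℝ) × ℝ => f₂ q.1 q.2) (U₂ ×ˢ univ)) {s t : ℝ}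
    (ht₁ : (s, t) ∈ U₁) (ht₂ : (s, t) ∈ U₂) (h : ∀ᶠ τ in 𝓝 t, f₁ (s, τ) = f₂ (s, τ)) :
    dir f₁ ((0, 1), 0) (s, t) = dir f₂ ((0, 1), 0) (s, t) := by
  ext x
  refine (hasDerivAt_dir_snd hU₁ h₁ ht₁ x).unique
    ((hasDerivAt_dir_snd hU₂ h₂ ht₂ x).congr_of_eventuallyEq ?_)
  filter_upwards [h] with τ hτ
  rw [hτ]

/-- A variation agrees with the curve only for `s = 0` and `t ∈ [a, b]`. The Euler-Lagrange
expressions contain no `s`-derivatives, and their `t`-derivatives at interior times see only this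
slice. The endpoints are a null set for the strip measure. -/
theorem eulerLagrange_congr {U₁ U₂ : Set (ℝ × ℝ)} {V₁ V₂ : ℝ × ℝ → Pair} {a b : ℝ}
    (hU₁ : IsOpen U₁) (hU₂ : IsOpen U₂) (h₁ : IsSmoothInGroupA1 A U₁ V₁)
    (h₂ : IsSmoothInGroupA1 A U₂ V₂) (hs₁ : ∀ t ∈ Icc a b, ((0 : ℝ), t) ∈ U₁)
    (hs₂ : ∀ t ∈ Icc a b, ((0 : ℝ), t) ∈ U₂) (h : ∀ t ∈ Icc a b, V₁ (0, t) = V₂ (0, t))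
    {t : ℝ} (ht : t ∈ Ioo a b) :
    eulerLagrange₁ (slopeSub V₁) (fun p => (V₁ p).2) (0, t) =
      eulerLagrange₁ (slopeSub V₂) (fun p => (V₂ p).2) (0, t) ∧
    eulerLagrange₂ (slopeSub V₁) (fun p => (V₁ p).2) (0, t) =
      eulerLagrange₂ (slopeSub V₂) (fun p => (V₂ p).2) (0, t) := by
  have hN₁ : IsSmoothInA A U₁ (slopeSub V₁) := h₁.2.1.2.1
  have hN₂ : IsSmoothInA A U₂ (slopeSub V₂) := h₂.2.1.2.1
  have key : ∀ f₁ f₂ : ℝ × ℝ → ℝ → ℝ, IsSmoothInA A U₁ f₁ → IsSmoothInA A U₂ f₂ →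
      (∀ t ∈ Ioo a b, f₁ (0, t) = f₂ (0, t)) → ∀ t ∈ Ioo a b,
      dir f₁ ((0, 1), 0) (0, t) = dir f₂ ((0, 1), 0) (0, t) := fun f₁ f₂ hf₁ hf₂ hf t ht =>
    dir_snd_congr hU₁ hU₂ hf₁.1 hf₂.1 (hs₁ t (Ioo_subset_Icc_self ht))
      (hs₂ t (Ioo_subset_Icc_self ht)) (by
        filter_upwards [isOpen_Ioo.mem_nhds ht] with τ hτ using hf τ hτ)
  have e0 : ∀ t ∈ Ioo a b, slopeSub V₁ (0, t) = slopeSub V₂ (0, t) := fun t ht => by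
    simp only [slopeSub, h t (Ioo_subset_Icc_self ht)]
  have e1 := key _ _ hN₁ hN₂ e0
  have e2 := key _ _ (hN₁.dir hU₁ _) (hN₂.dir hU₂ _) e1
  have e3 := key _ _ h₁.2.2 h₂.2.2 fun t ht => by rw [h t (Ioo_subset_Icc_self ht)]
  have e4 := key _ _ (h₁.2.2.dir hU₁ _) (h₂.2.2.dir hU₂ _) e3
  constructor
  · ext x; simp only [eulerLagrange₁, e0 t ht, e1 t ht, e2 t ht, e3 t ht]
  · ext x; simp only [eulerLagrange₂, e0 t ht, e1 t ht, e3 t ht, e4 t ht]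

theorem ae_stripMeasure_Ioo {a b : ℝ} : ∀ᵐ q ∂stripMeasure a b, q.1 ∈ Ioo a b := by
  rw [stripMeasure, ← Measure.restrict_congr_set Ioo_ae_eq_Icc]
  exact Measure.quasiMeasurePreserving_fst.ae (ae_restrict_mem measurableSet_Ioo)

/-- The fundamental lemma of the calculus of variations, for products of test functions. -/
theorem eq_zero_of_integral_strip {h : ℝ × ℝ → ℝ} {a b : ℝ}
    (hc : ContinuousOn h (Ioo a b ×ˢ univ))
    (H : ∀ η β : ℝ → ℝ, ContDiff ℝ ∞ η → ContDiff ℝ ∞ β → HasCompactSupport β →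
      tsupport η ⊆ Ioo a b → ∫ q, η q.1 * β q.2 * h q ∂stripMeasure a b = 0) :
    ∀ t ∈ Ioo a b, ∀ x, h (t, x) = 0 := by
  intro t ht x
  by_contra hne
  have hO : IsOpen (Ioo a b ×ˢ (univ : Set ℝ)) := isOpen_Ioo.prod isOpen_univ
  have hmem : (t, x) ∈ Ioo a b ×ˢ (univ : Set ℝ) := ⟨ht, mem_univ _⟩
  -- Multiplication by the constant `h (t, x)` makes the function positive near the point, whatever
  -- the sign of `h` there.
  have hk : ContinuousOn (fun q => h q * h (t, x)) (Ioo a b ×ˢ univ) := hc.mul continuousOn_const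
  have hpos : ∀ᶠ q in 𝓝 (t, x), 0 < h q * h (t, x) ∧ q ∈ Ioo a b ×ˢ (univ : Set ℝ) :=
    ((hk.continuousAt (hO.mem_nhds hmem)).eventually_const_lt (mul_self_pos.2 hne)).and
      (hO.mem_nhds hmem)
  obtain ⟨r, hr, hrs⟩ := Metric.nhds_basis_closedBall.mem_iff.1 hpos
  rw [← closedBall_prod_same] at hrs
  let b₁ : ContDiffBump t := ⟨r / 2, r, by linarith, by linarith⟩
  let b₂ : ContDiffBump x := ⟨r / 2, r, by linarith, by linarith⟩
  have hx : x ∈ Metric.closedBall x r := Metric.mem_closedBall_self hr.le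
  have hb₁ : tsupport b₁ ⊆ Ioo a b := fun τ hτ => by
    rw [b₁.tsupport_eq] at hτ
    exact (hrs (show (τ, x) ∈ _ from ⟨hτ, hx⟩)).2.1
  have h0 := H b₁ b₂ b₁.contDiff b₂.contDiff b₂.hasCompactSupport hb₁
  let F : ℝ × ℝ → ℝ := fun q => b₁ q.1 * b₂ q.2 * (h q * h (t, x))
  have hF0 : ∀ q, q ∉ Metric.closedBall t r ×ˢ Metric.closedBall x r → F q = 0 := fun q hq => by
    by_cases h1 : q.1 ∈ Metric.closedBall t r
    · have h2 : q.2 ∉ Metric.closedBall x r := fun h2 => hq ⟨h1, h2⟩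
      have h3 : b₂ q.2 = 0 := image_eq_zero_of_notMem_tsupport (by rwa [b₂.tsupport_eq])
      simp only [F, h3]; ring
    · have h3 : b₁ q.1 = 0 := image_eq_zero_of_notMem_tsupport (by rwa [b₁.tsupport_eq])
      simp only [F, h3]; ring
  have hcomp : IsCompact (Metric.closedBall t r ×ˢ Metric.closedBall x r) :=
    (isCompact_closedBall t r).prod (isCompact_closedBall x r)
  have hsub : tsupport F ⊆ Metric.closedBall t r ×ˢ Metric.closedBall x r :=
    closure_minimal (fun q hq => by_contra fun hn => hq (hF0 q hn)) hcomp.isClosed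
  have hFc : Continuous F := by
    have h1 : ContinuousOn F (Ioo a b ×ˢ univ) :=
      ((b₁.continuous.comp continuous_fst).mul
        (b₂.continuous.comp continuous_snd)).continuousOn.mul hk
    refine continuous_iff_continuousAt.2 fun q => ?_
    by_cases hq : q ∈ tsupport F
    · exact h1.continuousAt (hO.mem_nhds (hrs (hsub hq)).2)
    · exact (continuousAt_const (y := (0 : ℝ))).congr
        ((notMem_tsupport_iff_eventuallyEq.1 hq).symm)
  have hFs : HasCompactSupport F := hcomp.of_isClosed_subset (isClosed_tsupport F) hsub
  have hFn : 0 ≤ F := fun q => by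
    by_cases hq : q ∈ Metric.closedBall t r ×ˢ Metric.closedBall x r
    · exact mul_nonneg (mul_nonneg b₁.nonneg b₂.nonneg) (hrs hq).1.le
    · rw [hF0 q hq]; rfl
  have hFx : F (t, x) ≠ 0 := by
    have e1 : b₁ t = 1 := b₁.one_of_mem_closedBall (Metric.mem_closedBall_self b₁.rIn_pos.le)
    have e2 : b₂ x = 1 := b₂.one_of_mem_closedBall (Metric.mem_closedBall_self b₂.rIn_pos.le)
    simp only [F, e1, e2, one_mul]
    exact mul_self_ne_zero.2 hne
  have hI : 0 < ∫ q, F q := hFc.integral_pos_of_hasCompactSupport_nonneg_nonzero hFs hFn hFx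
  have e : ∫ q, F q = ∫ q, F q ∂stripMeasure a b := by
    have h2 : stripMeasure a b = volume.restrict (Icc a b ×ˢ univ) := by
      rw [Measure.volume_eq_prod, ← Measure.prod_restrict, Measure.restrict_univ]; rfl
    rw [h2, setIntegral_eq_integral_of_forall_compl_eq_zero]
    intro q hq
    exact hF0 q fun hq' => hq ⟨Ioo_subset_Icc_self (hrs hq').2.1, mem_univ _⟩
  have e' : ∫ q, F q ∂stripMeasure a b =
      (∫ q, b₁ q.1 * b₂ q.2 * h q ∂stripMeasure a b) * h (t, x) := by
    rw [← integral_mul_const]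
    exact integral_congr_ae (Eventually.of_forall fun q => by simp only [F]; ring)
  rw [e, e', h0, zero_mul] at hI
  exact lt_irrefl _ hI

end

/-! ### Test variations, and geodesics as solutions of the Euler-Lagrange equations. -/

section

variable {A : DecayClass}

theorem InA1.add_const_mul {f g : ℝ → ℝ} (hf : InA1 A f) (hg : InA1 A g) (c : ℝ) :
    InA1 A (fun x => f x + c * g x) := by
  have hd : deriv (fun x => f x + c * g x) = fun x => deriv f x + deriv g x * c :=
    funext fun x => by
      have := ((hasDerivAt_of_contDiff hf.1 x).fun_add
        ((hasDerivAt_of_contDiff hg.1 x).const_mul c)).deriv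
      rw [this, mul_comm c]
  refine ⟨hf.1.add (contDiff_const.mul hg.1), ?_, ?_⟩
  · rw [hd]; exact hf.2.1.add (hg.2.1.mul_const c)
  · simpa using hf.2.2.add (hg.2.2.const_mul c)

theorem exists_forall_abs_eq_zero {β : ℝ → ℝ} (h : HasCompactSupport β) :
    ∃ R : ℝ, ∀ x, R < |x| → β x = 0 := by
  obtain ⟨R, hR⟩ := h.isCompact.isBounded.subset_closedBall 0
  refine ⟨R, fun x hx => image_eq_zero_of_notMem_tsupport fun hx' => ?_⟩
  have := hR hx'
  rw [mem_closedBall_zero_iff, Real.norm_eq_abs] at this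
  exact absurd hx (not_lt.2 this)

/-- The variation of the curve `g` in the direction `η(t) (∫_{-∞}^x β, ζ(x))`. -/
def testVariation (g : ℝ → Pair) (η β ζ : ℝ → ℝ) (p : ℝ × ℝ) : Pair :=
  (fun x => (g p.2).1 x + p.1 * η p.2 * ∫ z in Iic x, β z,
    fun x => (g p.2).2 x + p.1 * η p.2 * ζ x)

section Test

variable {J : Set ℝ} {g : ℝ → Pair} {η β ζ : ℝ → ℝ} {a b : ℝ}

theorem IsSmoothInGroupA1.lift (hJ : IsOpen J) (hg : IsSmoothInGroupA1 A J g) :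
    IsSmoothInGroupA1 A (univ ×ˢ J) fun p : ℝ × ℝ => g p.2 :=
  hg.comp_clm hJ (isOpen_univ.prod hJ) (ContinuousLinearMap.snd ℝ ℝ ℝ) fun _ hp => hp.2

/-- Varying `φ` by a primitive of `β` varies the slope by `β` itself, an arbitrary test function.
The primitive stays in `𝒜₁` but would leave `𝒜` if `∫ β ≠ 0`. -/
theorem slopeSub_testVariation (hg : IsSmoothInGroupA1 A J g)
    (hβ : ContDiff ℝ ∞ β) (hβc : HasCompactSupport β) {p : ℝ × ℝ} (hp : p.2 ∈ J) :
    slopeSub (testVariation g η β ζ) p =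
      fun x => slopeSub (fun p : ℝ × ℝ => g p.2) p x + p.1 * η p.2 * β x := by
  have hβA : InA A β := inA_of_hasCompactSupport hβ hβc
  ext x
  have h1 := hasDerivAt_of_contDiff (hg.1 _ hp).1.1 x
  have h2 := (hasDerivAt_integral_Iic hβ.continuous hβA.integrable x).const_mul (p.1 * η p.2)
  refine ((h1.add h2).congr_of_eventuallyEq (Eventually.of_forall fun y => ?_)).deriv
  simp only [testVariation, Pi.add_apply]
  ring

/-- One `ε` works for all of `J`: on the compact interval `[a, b]` the slope is bounded away from
zero uniformly in `x`, and outside it `η` vanishes and nothing is perturbed. -/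
theorem exists_testVariation_pos (hJ : IsOpen J) (hg : IsSmoothInGroupA1 A J g)
    (hIcc : Icc a b ⊆ J) (hη : Continuous η) (hηs : tsupport η ⊆ Ioo a b)
    (hβ : Continuous β) (hβc : HasCompactSupport β) :
    ∃ ε > 0, ∀ p ∈ Ioo (-ε) ε ×ˢ J, ∀ x,
      0 < 1 + (slopeSub (fun p : ℝ × ℝ => g p.2) p x + p.1 * η p.2 * β x) := by
  have hU : IsOpen (univ ×ˢ J : Set (ℝ × ℝ)) := isOpen_univ.prod hJ
  have hG := hg.lift hJ
  have hN : IsSmoothInA A (univ ×ˢ J) (slopeSub fun p : ℝ × ℝ => g p.2) := hG.2.1.2.1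
  obtain ⟨C, hC⟩ := hN.bddOn_inv hU hG.one_add_pos (K := {0} ×ˢ Icc a b)
    (isCompact_singleton.prod isCompact_Icc) fun p hp => ⟨mem_univ _, hIcc hp.2⟩
  obtain ⟨M₁, hM₁⟩ := hη.bounded_above_of_compact_support
    (isCompact_Icc.of_isClosed_subset (isClosed_tsupport η) (hηs.trans Ioo_subset_Icc_self))
  obtain ⟨M₂, hM₂⟩ := hβ.bounded_above_of_compact_support hβc
  have hM₁0 : 0 ≤ M₁ := (norm_nonneg _).trans (hM₁ 0)
  have hM₂0 : 0 ≤ M₂ := (norm_nonneg _).trans (hM₂ 0)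
  set C' := max C 1
  have hC' : 0 < C' := lt_max_of_lt_right one_pos
  -- The slope is at least `1/C'` on `[a, b]` and the perturbation is at most `|s| M₁ M₂`; the added
  -- 1 keeps the denominator positive when a bound is zero.
  refine ⟨1 / (C' * (M₁ * M₂ + 1)), by positivity, ?_⟩
  rintro ⟨s, t⟩ ⟨hs, ht⟩ x
  have hw : 0 < 1 + slopeSub (fun p : ℝ × ℝ => g p.2) (s, t) x :=
    hG.one_add_pos (s, t) ⟨mem_univ _, ht⟩ x
  by_cases htI : t ∈ Icc a b
  · have h1 : |(1 + slopeSub (fun p : ℝ × ℝ => g p.2) (s, t) x)⁻¹| ≤ C' :=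
      (hC (0, t) ⟨rfl, htI⟩ x).trans (le_max_left _ _)
    rw [abs_of_pos (inv_pos.2 hw)] at h1
    have h2 : C'⁻¹ ≤ 1 + slopeSub (fun p : ℝ × ℝ => g p.2) (s, t) x := inv_le_of_inv_le₀ hw h1
    have h3 : |s * η t * β x| ≤ |s| * (M₁ * M₂ + 1) := by
      rw [abs_mul, abs_mul, mul_assoc]
      refine mul_le_mul_of_nonneg_left ?_ (abs_nonneg s)
      have := mul_le_mul (hM₁ t) (hM₂ x) (norm_nonneg _) hM₁0
      rw [Real.norm_eq_abs, Real.norm_eq_abs] at this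
      linarith
    have h4 : |s| * (M₁ * M₂ + 1) < C'⁻¹ := by
      have h5 : |s| < 1 / (C' * (M₁ * M₂ + 1)) := abs_lt.2 hs
      rw [lt_div_iff₀ (by positivity)] at h5
      rw [← one_div, lt_div_iff₀ hC']
      linarith
    have h6 := neg_abs_le (s * η t * β x)
    simp only
    linarith
  · have h1 : η t = 0 := image_eq_zero_of_notMem_tsupport fun h =>
      htI (Ioo_subset_Icc_self (hηs h))
    simpa [h1] using hw

theorem exists_testVariation_smooth (hJ : IsOpen J) (hg : IsSmoothInGroupA1 A J g)
    (hIcc : Icc a b ⊆ J) (hη : ContDiff ℝ ∞ η) (hηs : tsupport η ⊆ Ioo a b)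
    (hβ : ContDiff ℝ ∞ β) (hβc : HasCompactSupport β)
    (hζ : ContDiff ℝ ∞ ζ) (hζc : HasCompactSupport ζ) :
    ∃ ε > 0, IsSmoothInGroupA1 A (Ioo (-ε) ε ×ˢ J) (testVariation g η β ζ) := by
  obtain ⟨ε, hε, hpos⟩ := exists_testVariation_pos hJ hg hIcc hη.continuous hηs hβ.continuous hβc
  have hU : IsOpen (Ioo (-ε) ε ×ˢ J : Set (ℝ × ℝ)) := isOpen_Ioo.prod hJ
  have hG := hg.comp_clm hJ hU (ContinuousLinearMap.snd ℝ ℝ ℝ) fun _ hp => hp.2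
  have hβA : InA A β := inA_of_hasCompactSupport hβ hβc
  have hζA : InA A ζ := inA_of_hasCompactSupport hζ hζc
  have hY := hβA.integral_Iic
  have hc : ContDiff ℝ ∞ fun q : (ℝ × ℝ) × ℝ => q.1.1 * η q.1.2 :=
    (contDiff_fst.comp contDiff_fst).mul (hη.comp (contDiff_snd.comp contDiff_fst))
  have hsm : ∀ γ : ℝ → ℝ, ContDiff ℝ ∞ γ → HasCompactSupport γ →
      IsSmoothInA A (Ioo (-ε) ε ×ˢ J) fun p x => p.1 * η p.2 * γ x := fun γ hγ hγc => by
    obtain ⟨R, hR⟩ := exists_forall_abs_eq_zero hγc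
    exact isSmoothInA_of_support (hc.mul (hγ.comp contDiff_snd)) (R := R)
      fun p x hx => by rw [hR x hx, mul_zero]
  have hsl : ∀ p ∈ Ioo (-ε) ε ×ˢ J, slopeSub (testVariation g η β ζ) p =
      fun x => slopeSub (fun p : ℝ × ℝ => g p.2) p x + p.1 * η p.2 * β x := fun p hp =>
    slopeSub_testVariation hg hβ hβc hp.2
  have hfst : ∀ p : ℝ × ℝ, (fun x => (testVariation g η β ζ p).1 x - x) =
      fun x => ((g p.2).1 x - x) + p.1 * η p.2 * ∫ z in Iic x, β z := fun p => by
    ext x; simp only [testVariation]; ring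
  have hmem : ∀ p ∈ Ioo (-ε) ε ×ˢ J, InA1 A (fun x => (testVariation g η β ζ p).1 x - x) :=
    fun p hp => by
      rw [hfst]
      exact (hg.1 _ hp.2).1.add_const_mul hY _
  refine ⟨ε, hε, fun p hp => ⟨hmem p hp, fun x => ?_, ?_⟩, ⟨?_, ?_, fun p hp => (hmem p hp).2.2⟩, ?_⟩
  · have h1 := (hasDerivAt_of_contDiff (hmem p hp).1 x).add (hasDerivAt_id x)
    have h2 : (fun x => (testVariation g η β ζ p).1 x - x) + id = (testVariation g η β ζ p).1 := by
      ext x; simp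
    rw [h2] at h1
    rw [h1.deriv, add_comm]
    have h3 := hpos p hp x
    rw [← congrFun (hsl p hp) x] at h3
    exact h3
  · refine (hg.1 _ hp.2).2.2.add ?_
    simpa only [mul_comm] using hζA.mul_const (p.1 * η p.2)
  · refine (hG.2.1.1.add (hc.mul (hY.1.comp contDiff_snd)).contDiffOn).congr fun q _ => ?_
    simp only [testVariation]
    exact congrFun (hfst q.1) q.2
  · exact (hG.2.1.2.1.add hU (hsm β hβ hβc)).congr hU hsl
  · exact hG.2.2.add hU (hsm ζ hζ hζc)

theorem eulerLagrange_continuousOn {U : Set (ℝ × ℝ)} {V : ℝ × ℝ → Pair} (hU : IsOpen U)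
    (hV : IsSmoothInGroupA1 A U V) :
    ContinuousOn (fun q : (ℝ × ℝ) × ℝ => eulerLagrange₁ (slopeSub V) (fun p => (V p).2) q.1 q.2)
      (U ×ˢ univ) ∧
    ContinuousOn (fun q : (ℝ × ℝ) × ℝ => eulerLagrange₂ (slopeSub V) (fun p => (V p).2) q.1 q.2)
      (U ×ˢ univ) := by
  have hN : IsSmoothInA A U (slopeSub V) := hV.2.1.2.1
  have hNt := hN.dir hU ((0, 1), 0)
  have hαt := hV.2.2.dir hU ((0, 1), 0)
  have cI := (hN.contBdd_inv hU hV.one_add_pos).1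
  have cN := hN.continuousOn
  have cNt := hNt.continuousOn
  have cαt := hαt.continuousOn
  have cNtt := (hNt.dir hU ((0, 1), 0)).continuousOn
  have cαtt := (hαt.dir hU ((0, 1), 0)).continuousOn
  have cW : ContinuousOn (fun q : (ℝ × ℝ) × ℝ => 1 + slopeSub V q.1 q.2) (U ×ˢ univ) :=
    continuousOn_const.add cN
  exact ⟨cNtt.sub ((((cNt.mul cNt).mul cI).add ((cαt.mul cαt).mul cW)).mul continuousOn_const),
    (cαtt.mul cW).add (cαt.mul cNt)⟩

/-- Necessity follows from test variations in which `β` and `ζ` are chosen independently.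
Sufficiency holds because the first variation formula pairs the variation with the Euler-Lagrange
expressions of the curve. -/
theorem isGeodesicA1_iff (hab : a < b) (hJ : IsOpen J) (hIcc : Icc a b ⊆ J)
    (hg : IsSmoothInGroupA1 A J g) :
    IsGeodesicA1 A a b g ↔ ∀ t ∈ Icc a b, ∀ x,
      eulerLagrange₁ (slopeSub fun p : ℝ × ℝ => g p.2) (fun p => (g p.2).2) (0, t) x = 0 ∧
      eulerLagrange₂ (slopeSub fun p : ℝ × ℝ => g p.2) (fun p => (g p.2).2) (0, t) x = 0 := by
  have hU : IsOpen (univ ×ˢ J : Set (ℝ × ℝ)) := isOpen_univ.prod hJ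
  have hG := hg.lift hJ
  have hs₀ : ∀ t ∈ Icc a b, ((0 : ℝ), t) ∈ (univ ×ˢ J : Set (ℝ × ℝ)) :=
    fun t ht => ⟨mem_univ _, hIcc ht⟩
  constructor
  · intro hgeo
    obtain ⟨c₁, c₂⟩ := eulerLagrange_continuousOn hU hG
    have hN : IsSmoothInA A (univ ×ˢ J) (slopeSub fun p : ℝ × ℝ => g p.2) := hG.2.1.2.1
    have cI := (hN.contBdd_inv hU hG.one_add_pos).1
    have key : ∀ η β ζ : ℝ → ℝ, ContDiff ℝ ∞ η → ContDiff ℝ ∞ β → HasCompactSupport β →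
        ContDiff ℝ ∞ ζ → HasCompactSupport ζ → tsupport η ⊆ Ioo a b →
        ∫ q, (η q.1 * β q.2 * ((1 + slopeSub (fun p : ℝ × ℝ => g p.2) (0, q.1) q.2)⁻¹ *
          eulerLagrange₁ (slopeSub fun p : ℝ × ℝ => g p.2) (fun p => (g p.2).2) (0, q.1) q.2) +
          η q.1 * ζ q.2 * eulerLagrange₂ (slopeSub fun p : ℝ × ℝ => g p.2) (fun p => (g p.2).2)
          (0, q.1) q.2) ∂stripMeasure a b = 0 := fun η β ζ hη hβ hβc hζ hζc hηs => by
      obtain ⟨ε, hε, hV⟩ := exists_testVariation_smooth hJ hg hIcc hη hηs hβ hβc hζ hζc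
      have hUε : IsOpen (Ioo (-ε) ε ×ˢ J : Set (ℝ × ℝ)) := isOpen_Ioo.prod hJ
      have hs : ∀ t ∈ Icc a b, ((0 : ℝ), t) ∈ (Ioo (-ε) ε ×ˢ J : Set (ℝ × ℝ)) :=
        fun t ht => ⟨⟨by linarith, hε⟩, hIcc ht⟩
      have hV0 : ∀ t, testVariation g η β ζ (0, t) = g t := fun t => by
        ext x <;> simp [testVariation]
      have hend : ∀ t, t ∉ Ioo a b → ∀ s, testVariation g η β ζ (s, t) = g t := fun t ht s => by
        have h1 : η t = 0 := image_eq_zero_of_notMem_tsupport fun h => ht (hηs h)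
        ext x <;> simp [testVariation, h1]
      have ha := hend a (by simp)
      have hb := hend b (by simp)
      have h1 := hgeo ε J (testVariation g η β ζ) hε hJ hIcc hV (fun t _ => hV0 t)
        fun s _ => ⟨ha s, hb s⟩
      have h2 := hV.hasDerivAt_energy hUε hab.le hs
        (Eventually.of_forall fun s => by rw [ha, ha]) (Eventually.of_forall fun s => by rw [hb, hb])
      have h3 := neg_eq_zero.1 (h2.unique h1)
      refine Eq.trans (integral_congr_ae ?_) h3
      filter_upwards [ae_stripMeasure_Ioo (a := a) (b := b)] with q hq
      have hqI := Ioo_subset_Icc_self hq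
      obtain ⟨e1, e2⟩ := eulerLagrange_congr hUε hU hV hG hs hs₀ (fun t _ => hV0 t) hq
      have hNV : IsSmoothInA A (Ioo (-ε) ε ×ˢ J) (slopeSub (testVariation g η β ζ)) :=
        hV.2.1.2.1
      have hnear : ∀ᶠ s in 𝓝 (0 : ℝ), s ∈ Ioo (-ε) ε :=
        isOpen_Ioo.mem_nhds ⟨by linarith, hε⟩
      have e3 : dir (slopeSub (testVariation g η β ζ)) ((1, 0), 0) (0, q.1) q.2 =
          η q.1 * β q.2 := by
        refine (hasDerivAt_dir_fst hUε hNV.1 (hs _ hqI) q.2).unique ?_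
        have h4 : HasDerivAt (fun s : ℝ => slopeSub (fun p : ℝ × ℝ => g p.2) (0, q.1) q.2 +
            s * η q.1 * β q.2) (η q.1 * β q.2) 0 := by
          simpa using (((hasDerivAt_id (0 : ℝ)).mul_const (η q.1)).mul_const (β q.2)).const_add
            (slopeSub (fun p : ℝ × ℝ => g p.2) (0, q.1) q.2)
        refine h4.congr_of_eventuallyEq ?_
        filter_upwards [hnear] with s _
        rw [slopeSub_testVariation (A := A) hg hβ hβc (hIcc hqI)]
        rfl
      have e4 : dir (fun p => (testVariation g η β ζ p).2) ((1, 0), 0) (0, q.1) q.2 =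
          η q.1 * ζ q.2 := by
        refine (hasDerivAt_dir_fst (f := fun p => (testVariation g η β ζ p).2) hUε hV.2.2.1
          (hs _ hqI) q.2).unique ?_
        simpa [testVariation] using (((hasDerivAt_id (0 : ℝ)).mul_const (η q.1)).mul_const
          (ζ q.2)).const_add ((g q.1).2 q.2)
      have e5 : slopeSub (testVariation g η β ζ) (0, q.1) =
          slopeSub (fun p : ℝ × ℝ => g p.2) (0, q.1) := by
        simp only [slopeSub, hV0]
      rw [e1, e2, e3, e4, e5]
      ring
    have hpull : ∀ F : (ℝ × ℝ) × ℝ → ℝ, ContinuousOn F ((univ ×ˢ J) ×ˢ univ) →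
        ContinuousOn (fun q : ℝ × ℝ => F ((0, q.1), q.2)) (Ioo a b ×ˢ univ) := fun F hF =>
      hF.comp (by fun_prop) fun q hq =>
        ⟨⟨mem_univ _, hIcc (Ioo_subset_Icc_self hq.1)⟩, mem_univ _⟩
    have hz0 : ContDiff ℝ ∞ (fun _ : ℝ => (0 : ℝ)) := contDiff_const
    have k₁ := eq_zero_of_integral_strip (hpull _ (cI.mul c₁)) fun η β hη hβ hβc hηs => by
      simpa using key η β (fun _ => 0) hη hβ hβc hz0 HasCompactSupport.zero hηs
    have k₂ := eq_zero_of_integral_strip (hpull _ c₂) fun η ζ hη hζ hζc hηs => by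
      simpa using key η (fun _ => 0) ζ hη hz0 HasCompactSupport.zero hζ hζc hηs
    -- The fundamental lemma covers interior times; continuity extends the equations to the closed
    -- interval.
    have hext : ∀ F : (ℝ × ℝ) × ℝ → ℝ, ContinuousOn F ((univ ×ˢ J) ×ˢ univ) → ∀ x,
        (∀ t ∈ Ioo a b, F ((0, t), x) = 0) → ∀ t ∈ Icc a b, F ((0, t), x) = 0 := fun F hF x h => by
      have hFx : ContinuousOn (fun t => F ((0, t), x)) (Icc a b) :=
        hF.comp (by fun_prop) fun t ht => ⟨⟨mem_univ _, hIcc ht⟩, mem_univ _⟩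
      have := Set.EqOn.of_subset_closure (s := Ioo a b) (g := fun _ => (0 : ℝ)) (fun t ht => h t ht)
        hFx continuousOn_const Ioo_subset_Icc_self (by rw [closure_Ioo hab.ne])
      exact fun t ht => this ht
    intro t ht x
    refine ⟨hext _ c₁ x (fun t ht => ?_) t ht, hext _ c₂ x (fun t ht => k₂ t ht x) t ht⟩
    exact (mul_eq_zero.1 (k₁ t ht x)).resolve_left
      (inv_ne_zero (hG.one_add_pos _ (hs₀ t (Ioo_subset_Icc_self ht)) x).ne')
  · intro hEL ε J' V hε hJ' hIcc' hV hV0 hends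
    have hUε : IsOpen (Ioo (-ε) ε ×ˢ J' : Set (ℝ × ℝ)) := isOpen_Ioo.prod hJ'
    have h0 : (0 : ℝ) ∈ Ioo (-ε) ε := ⟨by linarith, hε⟩
    have hs : ∀ t ∈ Icc a b, ((0 : ℝ), t) ∈ (Ioo (-ε) ε ×ˢ J' : Set (ℝ × ℝ)) :=
      fun t ht => ⟨h0, hIcc' ht⟩
    have hnear : ∀ᶠ s in 𝓝 (0 : ℝ), s ∈ Ioo (-ε) ε := isOpen_Ioo.mem_nhds h0
    have h1 := hV.hasDerivAt_energy hUε hab.le hs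
      (hnear.mono fun s h => by rw [(hends s h).1, (hends 0 h0).1])
      (hnear.mono fun s h => by rw [(hends s h).2, (hends 0 h0).2])
    refine h1.congr_deriv ?_
    rw [neg_eq_zero]
    refine integral_eq_zero_of_ae ?_
    filter_upwards [ae_stripMeasure_Ioo (a := a) (b := b)] with q hq
    obtain ⟨e1, e2⟩ := eulerLagrange_congr hUε hU hV hG hs hs₀ (fun t ht => hV0 t ht) hq
    obtain ⟨z1, z2⟩ := hEL q.1 (Ioo_subset_Icc_self hq) q.2
    rw [e1, e2, z1, z2]
    simp

end Test

end

/-! ### From the Euler-Lagrange equations to the Eulerian system. -/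

section

variable {A : DecayClass} {J : Set ℝ}

/-- The implicit function theorem for `Φ(τ, y) = Φ(t, x)` supplies a differentiable solution, which
injectivity of each slice identifies with the inverse function. -/
theorem differentiableAt_invFun_family {Φ : ℝ × ℝ → ℝ} {t x c : ℝ} (hΦ : ContDiffAt ℝ ∞ Φ (t, x))
    (hx : HasDerivAt (fun y => Φ (t, y)) c x) (hc : c ≠ 0)
    (hb : ∀ᶠ τ in 𝓝 t, Function.Bijective fun y => Φ (τ, y)) :
    DifferentiableAt ℝ (fun τ => Function.invFun (fun y => Φ (τ, y)) (Φ (t, x))) t := by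
  have hs := hΦ.hasStrictFDerivAt (by simp)
  have h1 : fderiv ℝ Φ (t, x) (0, 1) = c :=
    ((hs.hasFDerivAt.comp_hasDerivAt x ((hasDerivAt_const x t).prodMk (hasDerivAt_id x))).unique hx)
  have hinv : (fderiv ℝ Φ (t, x) ∘L ContinuousLinearMap.inr ℝ ℝ ℝ).IsInvertible := by
    refine ⟨ContinuousLinearEquiv.unitsEquivAut ℝ (Units.mk0 c hc), ?_⟩
    ext
    simp [h1]
  have h2 := (hs.hasStrictFDerivAt_implicitFunctionOfProdDomain hinv).hasFDerivAt.differentiableAt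
  refine h2.congr_of_eventuallyEq ?_
  filter_upwards [hs.eventually_apply_implicitFunctionOfProdDomain hinv, hb] with τ hτ hbτ
  rw [← hτ]
  exact Function.leftInverse_invFun hbτ.1 _

theorem dir_prod_smul {P : Type*} [NormedAddCommGroup P] [NormedSpace ℝ P] (f : P → ℝ → ℝ)
    (v : P) (c : ℝ) (p : P) (x : ℝ) :
    dir f (v, c) p x = dir f (v, 0) p x + dir f (0, 1) p x * c := by
  have h1 : ((v, c) : P × ℝ) = (v, 0) + c • ((0 : P), (1 : ℝ)) := by simp
  rw [dir, dir, dir, h1, map_add, map_smul, smul_eq_mul, mul_comm]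

section Curve

variable {g : ℝ → Pair}

theorem IsSmoothInGroupA1.hasDerivAt_invFun {t x : ℝ} (hJ : IsOpen J)
    (hg : IsSmoothInGroupA1 A J g) (ht : t ∈ J) :
    HasDerivAt (fun τ => Function.invFun (g τ).1 ((g t).1 x))
      (-(dir (fun (p : ℝ × ℝ) x => (g p.2).1 x - x) ((0, 1), 0) (0, t) x) *
        (1 + slopeSub (fun p : ℝ × ℝ => g p.2) (0, t) x)⁻¹) t := by
  have hU : IsOpen (univ ×ˢ J : Set (ℝ × ℝ)) := isOpen_univ.prod hJ
  have hG := hg.lift hJ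
  have htU : ((0 : ℝ), t) ∈ (univ ×ˢ J : Set (ℝ × ℝ)) := ⟨mem_univ _, ht⟩
  have hw := (hG.one_add_pos (0, t) htU x).ne'
  have hΦ : ContDiffAt ℝ ∞ (fun q : ℝ × ℝ => (g q.1).1 q.2) (t, x) := by
    have h1 := (hg.2.1.1.contDiffAt ((hJ.prod isOpen_univ).mem_nhds
      (show (t, x) ∈ J ×ˢ univ from ⟨ht, mem_univ _⟩))).add contDiffAt_snd
    exact h1.congr_of_eventuallyEq (Eventually.of_forall fun q => by simp)
  have hx : HasDerivAt (fun y => (g t).1 y) (1 + slopeSub (fun p : ℝ × ℝ => g p.2) (0, t) x) x := by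
    rw [← hG.deriv_eq htU]
    exact (hG.differentiable htU x).hasDerivAt
  have hb : ∀ τ ∈ J, Function.Bijective (g τ).1 := fun τ hτ =>
    hG.bijective (p := (0, τ)) ⟨mem_univ _, hτ⟩
  have hbe : ∀ᶠ τ in 𝓝 t, Function.Bijective (g τ).1 := by
    filter_upwards [hJ.mem_nhds ht] with τ hτ using hb τ hτ
  have hd := (differentiableAt_invFun_family (Φ := fun q => (g q.1).1 q.2) hΦ hx hw hbe).hasDerivAt
  simp only at hd
  have hinv : Function.invFun (g t).1 ((g t).1 x) = x := Function.leftInverse_invFun (hb t ht).1 x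
  set ψ := fun τ => Function.invFun (g τ).1 ((g t).1 x)
  have h2 := hasDerivAt_line (f := fun (p : ℝ × ℝ) x => (g p.2).1 x - x)
    (γ := fun τ => ((0, τ), ψ τ)) hU hG.2.1.1
    (((hasDerivAt_const t 0).prodMk (hasDerivAt_id t)).prodMk hd) htU
  -- Since `φ(τ, ψ τ)` is constant, `φ - Id` along `ψ` has derivative `-ψ'`. The chain rule gives
  -- `f_t + N ψ'` for the same derivative, with `f = φ - Id`, and comparison yields `(1 + N) ψ' =
  -- -f_t`.
  have h3 : HasDerivAt (fun τ => (g τ).1 (ψ τ) - ψ τ) (0 - deriv ψ t) t := by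
    refine ((hasDerivAt_const t ((g t).1 x)).sub hd).congr_of_eventuallyEq ?_
    filter_upwards [hbe] with τ hτ
    simp only [Pi.sub_apply, ψ, Function.rightInverse_invFun hτ.2 ((g t).1 x)]
  have h4 := h2.unique h3
  rw [dir_prod_smul, ← hG.slopeSub_eq hU _ htU] at h4
  simp only [ψ, hinv] at h4
  refine hd.congr_deriv ?_
  rw [← div_eq_mul_inv, eq_div_iff hw]
  simp only [ψ]
  linarith

/-- The time derivative of `F(t, φ(t)⁻¹(y))`. -/
theorem IsSmoothInGroupA1.hasDerivAt_comp_invFun {t x : ℝ} (hJ : IsOpen J)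
    (hg : IsSmoothInGroupA1 A J g) (ht : t ∈ J) {F : ℝ × ℝ → ℝ → ℝ}
    (hF : ContDiffOn ℝ ∞ (fun q : (ℝ × ℝ) × ℝ => F q.1 q.2) ((univ ×ˢ J) ×ˢ univ)) :
    HasDerivAt (fun τ => F (0, τ) (Function.invFun (g τ).1 ((g t).1 x)))
      (dir F ((0, 1), 0) (0, t) x + dir F (0, 1) (0, t) x *
        (-(dir (fun (p : ℝ × ℝ) x => (g p.2).1 x - x) ((0, 1), 0) (0, t) x) *
        (1 + slopeSub (fun p : ℝ × ℝ => g p.2) (0, t) x)⁻¹)) t := by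
  have hU : IsOpen (univ ×ˢ J : Set (ℝ × ℝ)) := isOpen_univ.prod hJ
  have htU : ((0 : ℝ), t) ∈ (univ ×ˢ J : Set (ℝ × ℝ)) := ⟨mem_univ _, ht⟩
  have h1 := hasDerivAt_line (γ := fun τ => ((0, τ), Function.invFun (g τ).1 ((g t).1 x))) hU hF
    (((hasDerivAt_const t 0).prodMk (hasDerivAt_id t)).prodMk
      (hg.hasDerivAt_invFun (x := x) hJ ht)) htU
  rw [dir_prod_smul] at h1
  simp only [Function.leftInverse_invFun ((hg.lift hJ).bijective htU).1 x] at h1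
  exact h1

end Curve

/-- Differentiation of primitives with respect to the parameter. -/
theorem dir_eq_integral_Iic {F H : ℝ × ℝ → ℝ → ℝ} (hJ : IsOpen J)
    (hF : ContDiffOn ℝ ∞ (fun q : (ℝ × ℝ) × ℝ => F q.1 q.2) ((univ ×ˢ J) ×ˢ univ))
    (hH : IsSmoothInA A (univ ×ˢ J) H)
    (h : ∀ t ∈ J, ∀ x, F (0, t) x = ∫ y in Iic x, H (0, t) y) {t : ℝ} (ht : t ∈ J) (x : ℝ) :
    dir F ((0, 1), 0) (0, t) x = ∫ y in Iic x, dir H ((0, 1), 0) (0, t) y := by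
  have hU : IsOpen (univ ×ˢ J : Set (ℝ × ℝ)) := isOpen_univ.prod hJ
  have hmem : ∀ τ ∈ J, ((0 : ℝ), τ) ∈ (univ ×ˢ J : Set (ℝ × ℝ)) := fun τ hτ => ⟨mem_univ _, hτ⟩
  have hHt := hH.dir hU ((0, 1), 0)
  obtain ⟨r, hr, hrJ⟩ := Metric.nhds_basis_closedBall.mem_iff.1 (hJ.mem_nhds ht)
  obtain ⟨k, ki, kb⟩ := hHt.domOn hU (K := {0} ×ˢ Metric.closedBall t r)
    (isCompact_singleton.prod (isCompact_closedBall t r)) fun p hp => ⟨mem_univ _, hrJ hp.2⟩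
  have hnb : Metric.closedBall t r ∈ 𝓝 t := Metric.closedBall_mem_nhds _ hr
  have hcont : ∀ τ ∈ J, Continuous (H (0, τ)) := fun τ hτ =>
    continuous_slice hH.continuousOn (hmem τ hτ)
  have hint : Integrable (H (0, t)) :=
    (hH.domOn hU isCompact_singleton (singleton_subset_iff.2 (hmem t ht))).integrable_slice
      (mem_singleton _) (hcont t ht)
  have h1 := (hasDerivAt_integral_of_dominated_loc_of_deriv_le (μ := volume.restrict (Iic x))
    (F := fun τ y => H (0, τ) y) (F' := fun τ y => dir H ((0, 1), 0) (0, τ) y) (bound := k)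
    hnb (by
      filter_upwards [hnb] with τ hτ using (hcont τ (hrJ hτ)).aestronglyMeasurable)
    hint.integrableOn (continuous_slice hHt.continuousOn (hmem t ht)).aestronglyMeasurable
    (Eventually.of_forall fun y τ hτ => kb (0, τ) ⟨rfl, hτ⟩ y) ki.integrableOn
    (Eventually.of_forall fun y τ hτ => hasDerivAt_dir_snd hU hH.1 (hmem τ (hrJ hτ)) y)).2
  refine (hasDerivAt_dir_snd hU hF (hmem t ht) x).unique (h1.congr_of_eventuallyEq ?_)
  filter_upwards [hJ.mem_nhds ht] with τ hτ using h τ hτ x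

theorem eq_zero_of_integral_Iic_eq_zero {f : ℝ → ℝ} (hf : Continuous f) (hi : Integrable f)
    (h : ∀ x, ∫ y in Iic x, f y = 0) (x : ℝ) : f x = 0 := by
  have h1 := hasDerivAt_integral_Iic hf hi x
  rw [funext h] at h1
  exact h1.unique (hasDerivAt_const x 0)

section System

variable {φ α u ρ : ℝ → ℝ → ℝ}

/-- At the point `φ(t, x)` the material derivative of `u` is `φ_tt`, and surjectivity of `φ(t, ·)`
carries statements at such points to all of `ℝ`. The first equation is integrated once in `x`; the
second differs from the transport equation for `ρ` by the positive factor `φ_x`. -/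
theorem eulerLagrange_iff_solves {a b : ℝ} (hJ : IsOpen J) (hIcc : Icc a b ⊆ J)
    (hg : IsSmoothInGroupA1 A J fun t => (φ t, α t))
    (hu : ∀ t ∈ J, u t = (fun x => deriv (fun τ => φ τ x) t) ∘ Function.invFun (φ t))
    (hρ : ∀ t ∈ J, ρ t = (fun x => deriv (fun τ => α τ x) t) ∘ Function.invFun (φ t)) :
    (∀ t ∈ Icc a b, ∀ x,
      eulerLagrange₁ (slopeSub fun p : ℝ × ℝ => (φ p.2, α p.2)) (fun p => α p.2) (0, t) x = 0 ∧
      eulerLagrange₂ (slopeSub fun p : ℝ × ℝ => (φ p.2, α p.2)) (fun p => α p.2) (0, t) x = 0) ↔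
    SolvesTwoComponentHS (Icc a b) u ρ := by
  have hU : IsOpen (univ ×ˢ J : Set (ℝ × ℝ)) := isOpen_univ.prod hJ
  have hmem : ∀ τ ∈ J, ((0 : ℝ), τ) ∈ (univ ×ˢ J : Set (ℝ × ℝ)) := fun τ hτ => ⟨mem_univ _, hτ⟩
  have hG := hg.lift hJ
  have hN : IsSmoothInA A (univ ×ˢ J) (slopeSub fun p : ℝ × ℝ => (φ p.2, α p.2)) := hG.2.1.2.1
  have hNt := hN.dir hU ((0, 1), 0)
  have hNtt := hNt.dir hU ((0, 1), 0)
  have hα : IsSmoothInA A (univ ×ˢ J) fun p : ℝ × ℝ => α p.2 := hG.2.2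
  have hαt := hα.dir hU ((0, 1), 0)
  set N := slopeSub fun p : ℝ × ℝ => (φ p.2, α p.2) with hNdef
  set α' : ℝ × ℝ → ℝ → ℝ := fun p => α p.2
  set f : ℝ × ℝ → ℝ → ℝ := fun p x => φ p.2 x - x with hfdef
  have hf : ContDiffOn ℝ ∞ (fun q : (ℝ × ℝ) × ℝ => f q.1 q.2) ((univ ×ˢ J) ×ˢ univ) := hG.2.1.1
  have hft : ContDiffOn ℝ ∞ (fun q : (ℝ × ℝ) × ℝ => dir f ((0, 1), 0) q.1 q.2)
      ((univ ×ˢ J) ×ˢ univ) := contDiffOn_fderiv_apply hf (hU.prod isOpen_univ) _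
  have hbot : ∀ t ∈ J, ∀ x, f (0, t) x = ∫ y in Iic x, N (0, t) y := fun t ht x => by
    have hi : Integrable (N (0, t)) := (hG.1 _ (hmem t ht)).1.2.1.integrable
    have h1 := integral_Iic_of_hasDerivAt_of_tendsto' (a := x)
      (fun y _ => hasDerivAt_of_contDiff (hG.1 _ (hmem t ht)).1.1 y) hi.integrableOn
      (hG.1 _ (hmem t ht)).1.2.2
    rw [sub_zero] at h1
    exact h1.symm
  -- Two time derivatives pass under `∫_{-∞}^x`, so `φ_tt` is the primitive of `N_tt` that vanishes
  -- at `-∞`.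
  have hftt : ∀ t ∈ J, ∀ x, dir (dir f ((0, 1), 0)) ((0, 1), 0) (0, t) x =
      ∫ y in Iic x, dir (dir N ((0, 1), 0)) ((0, 1), 0) (0, t) y := fun t ht x =>
    dir_eq_integral_Iic hJ hft hNt (fun t ht x => dir_eq_integral_Iic hJ hf hN hbot ht x) ht x
  have hut : ∀ t ∈ J, u t = dir f ((0, 1), 0) (0, t) ∘ Function.invFun (φ t) := fun t ht => by
    have h1 := hG.velocity_eq hU (hmem t ht)
    rw [hu t ht]
    exact congrArg (· ∘ Function.invFun (φ t)) (congrArg Prod.fst h1)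
  have hρt : ∀ t ∈ J, ρ t = dir α' ((0, 1), 0) (0, t) ∘ Function.invFun (φ t) := fun t ht => by
    have h1 := hG.velocity_eq hU (hmem t ht)
    rw [hρ t ht]
    exact congrArg (· ∘ Function.invFun (φ t)) (congrArg Prod.snd h1)
  have hdφ : ∀ t ∈ J, Differentiable ℝ (φ t) := fun t ht => hG.differentiable (hmem t ht)
  have hpos : ∀ t ∈ J, ∀ x, 0 < deriv (φ t) x := fun t ht => (hG.1 _ (hmem t ht)).2.1
  have hbij : ∀ t ∈ J, Function.Bijective (φ t) := fun t ht => hG.bijective (hmem t ht)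
  have hφx : ∀ t ∈ J, ∀ x, deriv (φ t) x = 1 + N (0, t) x := fun t ht => hG.deriv_eq (hmem t ht)
  have hftx : ∀ t ∈ J, ∀ x, HasDerivAt (dir f ((0, 1), 0) (0, t)) (dir N ((0, 1), 0) (0, t) x) x :=
    fun t ht x => hG.hasDerivAt_dir hU (hmem t ht) _ x
  have hαtx : ∀ t ∈ J, ∀ x, HasDerivAt (dir α' ((0, 1), 0) (0, t))
      (dir (dir α' ((0, 1), 0)) (0, 1) (0, t) x) x :=
    fun t ht x => hasDerivAt_dir_space hU hαt.1 (hmem t ht) x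
  have hux : ∀ t ∈ J, ∀ x, deriv (u t) (φ t x) = dir N ((0, 1), 0) (0, t) x * (1 + N (0, t) x)⁻¹ :=
    fun t ht x => by
      rw [hut t ht, deriv_comp_invFun (hdφ t ht) (hpos t ht) (hbij t ht)
        fun y => (hftx t ht y).differentiableAt, (hftx t ht x).deriv, hφx t ht, div_eq_mul_inv]
  have hinv : ∀ t ∈ J, ∀ x, Function.invFun (φ t) (φ t x) = x := fun t ht =>
    Function.leftInverse_invFun (hbij t ht).1
  have hφmem : ∀ t ∈ J, ∀ y, ∃ x, φ t x = y := fun t ht => (hbij t ht).2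
  have hUt : ∀ t ∈ J, ∀ x, HasDerivAt (fun τ => u τ (φ t x))
      (dir (dir f ((0, 1), 0)) ((0, 1), 0) (0, t) x -
        u t (φ t x) * deriv (u t) (φ t x)) t := fun t ht x => by
    have h1 := hg.hasDerivAt_comp_invFun (x := x) hJ ht hft
    have h2 : dir (dir f ((0, 1), 0)) (0, 1) (0, t) x = dir N ((0, 1), 0) (0, t) x :=
      (hasDerivAt_dir_space hU hft (hmem t ht) x).unique (hftx t ht x)
    rw [h2] at h1
    refine (h1.congr_of_eventuallyEq ?_).congr_deriv ?_
    · filter_upwards [hJ.mem_nhds ht] with τ hτ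
      rw [hut τ hτ]
      rfl
    · rw [hux t ht, hut t ht, Function.comp_apply, hinv t ht]
      ring
  have hRt : ∀ t ∈ J, ∀ x, HasDerivAt (fun τ => ρ τ (φ t x))
      (dir (dir α' ((0, 1), 0)) ((0, 1), 0) (0, t) x + dir (dir α' ((0, 1), 0)) (0, 1) (0, t) x *
        (-(dir f ((0, 1), 0) (0, t) x) * (1 + N (0, t) x)⁻¹)) t := fun t ht x => by
    refine (hg.hasDerivAt_comp_invFun (x := x) hJ ht hαt.1).congr_of_eventuallyEq ?_
    filter_upwards [hJ.mem_nhds ht] with τ hτ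
    rw [hρt τ hτ]
    rfl
  have hρu : ∀ t ∈ J, ∀ x, deriv (fun y => ρ t y * u t y) (φ t x) =
      (dir (dir α' ((0, 1), 0)) (0, 1) (0, t) x * dir f ((0, 1), 0) (0, t) x +
        dir α' ((0, 1), 0) (0, t) x * dir N ((0, 1), 0) (0, t) x) * (1 + N (0, t) x)⁻¹ :=
    fun t ht x => by
      have h1 : (fun y => ρ t y * u t y) = (fun x => dir α' ((0, 1), 0) (0, t) x *
          dir f ((0, 1), 0) (0, t) x) ∘ Function.invFun (φ t) := by
        rw [hut t ht, hρt t ht]; rfl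
      have h2 := fun x => (hαtx t ht x).fun_mul (hftx t ht x)
      rw [h1, deriv_comp_invFun (hdφ t ht) (hpos t ht) (hbij t ht)
        fun y => (h2 y).differentiableAt, (h2 x).deriv, hφx t ht, div_eq_mul_inv]
  have hrhs : ∀ t ∈ J, ∀ x, ∫ z in Iic (φ t x), (deriv (u t) z ^ 2 + ρ t z ^ 2) =
      ∫ y in Iic x, (dir N ((0, 1), 0) (0, t) y * dir N ((0, 1), 0) (0, t) y * (1 + N (0, t) y)⁻¹ +
      dir α' ((0, 1), 0) (0, t) y * dir α' ((0, 1), 0) (0, t) y * (1 + N (0, t) y)) :=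
    fun t ht x => by
      rw [integral_Iic_comp_diffeo (hdφ t ht) (hpos t ht) (hbij t ht)]
      refine integral_congr_ae (Eventually.of_forall fun y => ?_)
      have hw := (hpos t ht y).ne'
      rw [hφx t ht] at hw
      simp only [hux t ht, hφx t ht, hρt t ht, Function.comp_apply, hinv t ht]
      field_simp
  have hII : ∀ t ∈ J, ∀ x, ∫ y in Iic x, eulerLagrange₁ N α' (0, t) y =
      dir (dir f ((0, 1), 0)) ((0, 1), 0) (0, t) x -
        1 / 2 * ∫ z in Iic (φ t x), (deriv (u t) z ^ 2 + ρ t z ^ 2) := fun t ht x => by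
    have hK : IsCompact ({((0 : ℝ), t)} : Set (ℝ × ℝ)) := isCompact_singleton
    have hKU := singleton_subset_iff.2 (hmem t ht)
    have c2 : ContDom (univ ×ˢ J) fun q : (ℝ × ℝ) × ℝ =>
        dir N ((0, 1), 0) q.1 q.2 * dir N ((0, 1), 0) q.1 q.2 * (1 + N q.1 q.2)⁻¹ +
        dir α' ((0, 1), 0) q.1 q.2 * dir α' ((0, 1), 0) q.1 q.2 * (1 + N q.1 q.2) :=
      (((hNt.contDom hU).mul (hNt.contBdd hU)).mul (hN.contBdd_inv hU hG.one_add_pos)).add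
        (((hαt.contDom hU).mul (hαt.contBdd hU)).mul ((contBdd_const 1).add (hN.contBdd hU)))
    have i1 := (hNtt.domOn hU hK hKU).integrable_slice (mem_singleton _)
      (continuous_slice hNtt.continuousOn (hmem t ht))
    have i2 := (c2.2 _ hK hKU).integrable_slice (mem_singleton _)
      (continuous_slice c2.1 (hmem t ht))
    have h1 := integral_sub i1.integrableOn (i2.mul_const (1 / 2)).integrableOn (μ := volume.restrict (Iic x))
    rw [integral_mul_const, ← hftt t ht] at h1
    rw [hrhs t ht, mul_comm]
    exact h1
  -- A continuous integrable function vanishes exactly when all its integrals over left half-lines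
  -- do, so the integrated equation loses no information.
  have hzero : ∀ t ∈ J, (∀ x, eulerLagrange₁ N α' (0, t) x = 0) ↔
      ∀ x, dir (dir f ((0, 1), 0)) ((0, 1), 0) (0, t) x =
        1 / 2 * ∫ z in Iic (φ t x), (deriv (u t) z ^ 2 + ρ t z ^ 2) := fun t ht => by
    constructor
    · intro h x
      have h1 := hII t ht x
      simp only [h, integral_zero] at h1
      linarith
    · intro h
      have c1 : ContDom (univ ×ˢ J) fun q : (ℝ × ℝ) × ℝ => eulerLagrange₁ N α' q.1 q.2 :=
        (hNtt.contDom hU).sub (((((hNt.contDom hU).mul (hNt.contBdd hU)).mul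
          (hN.contBdd_inv hU hG.one_add_pos)).add (((hαt.contDom hU).mul (hαt.contBdd hU)).mul
          ((contBdd_const 1).add (hN.contBdd hU)))).mul (contBdd_const (1 / 2)))
      have hc := continuous_slice c1.1 (hmem t ht)
      refine eq_zero_of_integral_Iic_eq_zero hc
        ((c1.2 _ isCompact_singleton (singleton_subset_iff.2 (hmem t ht))).integrable_slice
          (mem_singleton _) hc) fun x => ?_
      rw [hII t ht, h, sub_self]
  have hfst : ∀ t ∈ J, (∀ x, eulerLagrange₁ N α' (0, t) x = 0) ↔
      ∀ y, HasDerivAt (fun τ => u τ y) (-(u t y * deriv (u t) y) +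
        1 / 2 * ∫ z in Iic y, (deriv (u t) z ^ 2 + ρ t z ^ 2)) t := fun t ht => by
    rw [hzero t ht]
    constructor
    · intro h y
      obtain ⟨x, rfl⟩ := hφmem t ht y
      refine (hUt t ht x).congr_deriv ?_
      rw [h x]; ring
    · intro h x
      have h1 := (hUt t ht x).unique (h (φ t x))
      linarith
  have hsnd : ∀ t ∈ J, (∀ x, eulerLagrange₂ N α' (0, t) x = 0) ↔
      ∀ y, HasDerivAt (fun τ => ρ τ y) (-deriv (fun y => ρ t y * u t y) y) t := fun t ht => by
    -- Divided by `φ_x`, the second Euler-Lagrange expression is `ρ_t + (ρu)_x` evaluated at `φ(t,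
    -- x)`.
    have halg : ∀ x, eulerLagrange₂ N α' (0, t) x * (1 + N (0, t) x)⁻¹ =
        (dir (dir α' ((0, 1), 0)) ((0, 1), 0) (0, t) x +
          dir (dir α' ((0, 1), 0)) (0, 1) (0, t) x *
          (-(dir f ((0, 1), 0) (0, t) x) * (1 + N (0, t) x)⁻¹)) +
        deriv (fun y => ρ t y * u t y) (φ t x) := fun x => by
      have hw : (1 + N (0, t) x) * (1 + N (0, t) x)⁻¹ = 1 :=
        mul_inv_cancel₀ (hG.one_add_pos _ (hmem t ht) x).ne'
      rw [hρu t ht, eulerLagrange₂]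
      linear_combination dir (dir α' ((0, 1), 0)) ((0, 1), 0) (0, t) x * hw
    constructor
    · intro h y
      obtain ⟨x, rfl⟩ := hφmem t ht y
      refine (hRt t ht x).congr_deriv ?_
      have h1 := halg x
      rw [h x, zero_mul] at h1
      linarith
    · intro h x
      have h1 := (hRt t ht x).unique (h (φ t x))
      have h2 := halg x
      rw [h1, neg_add_cancel] at h2
      exact (mul_eq_zero.1 h2).resolve_right
        (inv_ne_zero (hG.one_add_pos _ (hmem t ht) x).ne')
  constructor
  · intro h t ht x
    exact ⟨(hfst t (hIcc ht)).1 (fun x => (h t ht x).1) x,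
      (hsnd t (hIcc ht)).1 (fun x => (h t ht x).2) x⟩
  · intro h t ht x
    exact ⟨(hfst t (hIcc ht)).2 (fun x => (h t ht x).1) x,
      (hsnd t (hIcc ht)).2 (fun x => (h t ht x).2) x⟩

end System

end

end TwoHS

end

/-! ### Assembly of the statements. -/

theorem mainTheorem9 (A : TwoHS.DecayClass) :
    -- existence of the geodesic equation on `Diff_{𝒜₁}(ℝ) ⋉ 𝒜(ℝ)`
    (TwoHS.GeodesicEquationExists (TwoHS.lieA1 A) ∧
      ∀ X a : ℝ → ℝ, (X, a) ∈ TwoHS.lieA1 A →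
        TwoHS.RepresentsAdjoint (TwoHS.lieA1 A) (X, a)
          (fun x => X x * deriv X x - 1 / 2 * ∫ z in Set.Iic x, (deriv X z ^ 2 + a z ^ 2),
           fun x => deriv (fun y => a y * X y) x)) ∧
    -- the geodesics are the curves whose right trivialized velocity solves the system
    (∀ (a b : ℝ) (J : Set ℝ) (φ α u ρ : ℝ → ℝ → ℝ), a < b → IsOpen J → Set.Icc a b ⊆ J →
      TwoHS.IsSmoothInGroupA1 A J (fun t => (φ t, α t)) →
      (∀ t ∈ J, u t = (fun x => deriv (fun τ => φ τ x) t) ∘ Function.invFun (φ t)) →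
      (∀ t ∈ J, ρ t = (fun x => deriv (fun τ => α τ x) t) ∘ Function.invFun (φ t)) →
      (TwoHS.IsGeodesicA1 A a b (fun t => (φ t, α t)) ↔
        TwoHS.SolvesTwoComponentHS (Set.Icc a b) u ρ)) ∧
    -- non-existence of the geodesic equation on `Diff_𝒜(ℝ) ⋉ 𝒜(ℝ)`
    ¬ TwoHS.GeodesicEquationExists (TwoHS.lieA A) ∧
    (∀ ξ ∈ TwoHS.lieA A, ξ ≠ 0 → ¬ ∃ ζ, TwoHS.RepresentsAdjoint (TwoHS.lieA A) ξ ζ) ∧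
    -- no Levi-Civita covariant derivative, hence no robust Riemannian manifold
    (¬ ∃ Γ, TwoHS.IsChristoffel A Γ) ∧
    ¬ TwoHS.IsRobustA A := by
  refine ⟨⟨?_, fun X a h => TwoHS.representsAdjoint_lieA1 h⟩, ?_,
    TwoHS.not_geodesicEquationExists_lieA, fun ξ h h0 => TwoHS.not_representsAdjoint_lieA h h0,
    TwoHS.not_exists_isChristoffel, TwoHS.not_isRobustA⟩
  · rintro ⟨X, a⟩ h
    exact ⟨_, TwoHS.representsAdjoint_lieA1 h⟩
  · intro a b J φ α u ρ hab hJ hIcc hg hu hρ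
    rw [TwoHS.isGeodesicA1_iff hab hJ hIcc hg]
    exact TwoHS.eulerLagrange_iff_solves hJ hIcc hg hu hρ
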